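/- Let $M$ be a complex manifold, $E$ a holomorphic vector bundle of rank $r$ on $M$ with underlying $C^\infty$ bundle $H$, $h$ a $C^\infty$ positive definite Hermitian metric on $E$, $D'+\bar\partial$ its Chern connection, and $\dagger$ the adjoint with respect to $h$. Let $\Phi:E\to\Omega^1_M\otimes E$ be $\mathcal O_M$-linear with $\Phi\wedge\Phi=0$ and such that $D'+\bar\partial+\Phi+\Phi^\dagger$ is an integrable (flat) connection on $H$. Let $\mathcal U,\mathcal Q$ be $C^\infty$ endomorphisms of $H$ with $$\bar\partial(\mathcal U)=0,\quad \mathcal Q^\dagger=\mathcal Q,\quad [\Phi,\mathcal U]=0,\quad D'(\mathcal U)-[\Phi,\mathcal Q]+\Phi=0,\quad D'(\mathcal Q)+[\Phi,\mathcal U^\dagger]=0,$$ that is, $(E,h,\Phi,\mathcal U,\mathcal Q)$ is an integrable harmonic Higgs bundle. Say that $\mathcal Q$ satisfies the IS condition at $q\in M$ if no two eigenvalues of $\mathcal Q(q):E_q\to E_q$ differ by $1$ or $-1$. Assume that $\mathcal Q$ satisfies the IS condition at $p\in M$. Then there is an open neighbourhood $W$ of $p$ such that the following hold. 1. $\mathcal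 Q$ satisfies the IS condition at every $q\in W$. 2. On $W$, $\Phi$ is uniquely determined by $D'(\mathcal U)$: at every $q\in W$ and for every tangent vector $v$ at $q$, $\Phi_v$ is the unique endomorphism $X$ of $E_q$ with $D'_v(\mathcal U)-[X,\mathcal Q]+X=0$; in particular, if $(E,h,\Phi_1,\mathcal U_1,\mathcal Q)$ is an integrable harmonic Higgs bundle with the same $E,h,\mathcal Q$ and $D'(\mathcal U_1)=D'(\mathcal U)$ at $q\in W$, then $\Phi_1=\Phi$ at $q$. If $D'(\mathcal U)=0$ on an open set $V\subseteq W$, then $\Phi=0$ on $V$, and $D'$ is holomorphic on $V$, i.e. $D'\bar\partial+\bar\partial D'=0$. 3. If $D'(\mathcal U)=0$ on an open set $V\subseteq W$, then every point of $V$ has an open neighbourhood $V'\subseteq V$ with a $D'$-flat holomorphic frame $e_1,\dots,e_r$ of $E$ on $V'$ in which the matrix of $\mathcal Q$ is a constant diagonal matrix $\Lambda=\mathrm{diag}(\lambda_1,\dots,\lambda_r)$ with $\lambda_i\in\mathbb R$. If moreover $\mathcal U=0$ on $V'$, then for every constant $w$ the structure connection of weight $w$, $$D'+\tfrac1z\Phi+\Big(\tfrac1z\,\mathcal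 U-\mathcal Q+\tfrac w2-z\,\mathcal U^\dagger\Big)\frac{dz}{z}$$ on the pull-back of $E$ to $\mathbb C^*\times V'$ (with holomorphic structure $\bar\partial+z\Phi^\dagger$) equals $D'+\big(-\Lambda+\tfrac w2\big)\frac{dz}{z}$, and it is the direct sum of the holomorphic line bundles spanned by the $e_i$ with the connections $d+\big(-\lambda_i+\tfrac w2\big)\frac{dz}{z}$. Finally, if $\mathcal Q$ satisfies the IS condition at every point of $M$ and $D'(\mathcal U)=0$ on $M$, then $\mathcal U$ is a potential of the Higgs field: $\Phi=D'(\mathcal U)$ on $M$. -/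

import Mathlib

open Bundle Complex
open scoped Manifold ContDiff Topology Matrix ComplexConjugate

noncomputable section

namespace HiggsBundle

section Functions

variable {EM : Type*} [NormedAddCommGroup EM] [NormedSpace ℂ EM]
  {M : Type*} [TopologicalSpace M] [ChartedSpace EM M]
  {F : Type*} [NormedAddCommGroup F] [NormedSpace ℂ F]

/-- The real differential of a vector-valued function on `M`. -/
def realDiff (f : M → F) (q : M) : EM →L[ℝ] F :=
  mfderiv 𝓘(ℝ, EM) 𝓘(ℝ, F) f q

/-- The `(1,0)`-part `∂ f` of the differential, evaluated on `v`: `(df(v) - i df(iv)) / 2`. -/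
def del (f : M → F) (q : M) (v : TangentSpace 𝓘(ℂ, EM) q) : F :=
  (1 / 2 : ℂ) • (realDiff (EM := EM) f q v - I • realDiff (EM := EM) f q (I • v))

/-- The `(0,1)`-part `∂̄ f` of the differential, evaluated on `v`: `(df(v) + i df(iv)) / 2`.
It is conjugate-linear in `v`. -/
def delBar (f : M → F) (q : M) (v : TangentSpace 𝓘(ℂ, EM) q) : F :=
  (1 / 2 : ℂ) • (realDiff (EM := EM) f q v + I • realDiff (EM := EM) f q (I • v))

end Functions

section Sections

variable {EM : Type*} [NormedAddCommGroup EM] [NormedSpace ℂ EM]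
  {M : Type*} [TopologicalSpace M] [ChartedSpace EM M]
  (F : Type*) [NormedAddCommGroup F] [NormedSpace ℂ F]
  {E : M → Type*} [TopologicalSpace (TotalSpace F E)] [∀ x, TopologicalSpace (E x)]
  [FiberBundle F E]

/-- The section `s` of the `C^∞` bundle underlying `E` is `C^∞` (in the real sense) at `q`. -/
def SmoothAt (EM : Type*) [NormedAddCommGroup EM] [NormedSpace ℂ EM] [ChartedSpace EM M]
    (s : ∀ x, E x) (q : M) : Prop :=
  ContMDiffAt 𝓘(ℝ, EM) (𝓘(ℝ, EM).prod 𝓘(ℝ, F)) ∞ (fun x => TotalSpace.mk' F x (s x)) q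

/-- The section `s` is holomorphic on `V` (used for open `V`): it is complex differentiable at
every point of `V`. -/
def HolomorphicOn (EM : Type*) [NormedAddCommGroup EM] [NormedSpace ℂ EM] [ChartedSpace EM M]
    (s : ∀ x, E x) (V : Set M) : Prop :=
  ∀ q ∈ V, MDifferentiableAt 𝓘(ℂ, EM) (𝓘(ℂ, EM).prod 𝓘(ℂ, F))
    (fun x => TotalSpace.mk' F x (s x)) q

/-- The coordinate vector field, in the preferred holomorphic chart at `q`, that extends `v`. -/
def coordField [IsManifold 𝓘(ℂ, EM) ω M] (q : M) (v : TangentSpace 𝓘(ℂ, EM) q) (x : M) :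
    TangentSpace 𝓘(ℂ, EM) x :=
  (trivializationAt EM (TangentSpace 𝓘(ℂ, EM)) q).symm x v

end Sections

variable {EM : Type*} [NormedAddCommGroup EM] [NormedSpace ℂ EM]
  {M : Type*} [TopologicalSpace M] [ChartedSpace EM M] {r : ℕ}
  {E : M → Type*} [∀ x, AddCommGroup (E x)] [∀ x, Module ℂ (E x)]
  [TopologicalSpace (TotalSpace (Fin r → ℂ) E)] [∀ x, TopologicalSpace (E x)]
  [FiberBundle (Fin r → ℂ) E]

/-- The local holomorphic frame of `E` near `q` given by the preferred trivialization at `q`. -/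
def stdFrame (r : ℕ) [TopologicalSpace (TotalSpace (Fin r → ℂ) E)]
    [FiberBundle (Fin r → ℂ) E] (q : M) (i : Fin r) (x : M) : E x :=
  (trivializationAt (Fin r → ℂ) E q).symm x (Pi.single i 1)

/-- The operator `∂̄` of the holomorphic bundle `E`, acting on `C^∞` sections: differentiate the
coordinates of `s` in a holomorphic trivialization. -/
def dbar (r : ℕ) [TopologicalSpace (TotalSpace (Fin r → ℂ) E)] [FiberBundle (Fin r → ℂ) E]
    (s : ∀ x, E x) (q : M) (v : TangentSpace 𝓘(ℂ, EM) q) : E q :=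
  (trivializationAt (Fin r → ℂ) E q).symm q
    (delBar (fun x => (trivializationAt (Fin r → ℂ) E q ⟨x, s x⟩).2) q v)

/-- A `C^∞` positive definite Hermitian metric on `E`, conjugate-linear in the first variable. -/
structure HermitianMetric (EM : Type*) [NormedAddCommGroup EM] [NormedSpace ℂ EM]
    {M : Type*} [TopologicalSpace M] [ChartedSpace EM M] (r : ℕ)
    (E : M → Type*) [∀ x, AddCommGroup (E x)] [∀ x, Module ℂ (E x)]
    [TopologicalSpace (TotalSpace (Fin r → ℂ) E)] [∀ x, TopologicalSpace (E x)]
    [FiberBundle (Fin r → ℂ) E] where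
  form : ∀ x, E x →ₗ⋆[ℂ] E x →ₗ[ℂ] ℂ
  symm : ∀ x (a b : E x), conj (form x a b) = form x b a
  pos : ∀ x (a : E x), a ≠ 0 → 0 < (form x a a).re
  smooth : ∀ (q : M) (s t : ∀ x, E x), SmoothAt (Fin r → ℂ) EM s q →
    SmoothAt (Fin r → ℂ) EM t q →
    ContMDiffAt 𝓘(ℝ, EM) 𝓘(ℝ, ℂ) ∞ (fun x => form x (s x) (t x)) q

namespace HermitianMetric

variable (h : HermitianMetric EM r E)

/-- The Gram matrix of `h` at `q` in the frame `stdFrame r q`. -/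
def gram (q : M) : Matrix (Fin r) (Fin r) ℂ :=
  Matrix.of fun i j => h.form q (stdFrame r q i q) (stdFrame r q j q)

/-- The vector `a ∈ E_q` with `h(e_j, a) = c_j` for all `j`, where `e = stdFrame r q`. -/
def dualVec (q : M) (c : Fin r → ℂ) : E q :=
  ∑ i, ((h.gram q)⁻¹ *ᵥ c) i • stdFrame r q i q

/-- The adjoint `A†` of an endomorphism `A` of `E_q` with respect to `h`. -/
def adj {q : M} (A : Module.End ℂ (E q)) : Module.End ℂ (E q) where
  toFun b := h.dualVec q fun j => h.form q (A (stdFrame r q j q)) b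
  map_add' a b := by
    have : (fun j => h.form q (A (stdFrame r q j q)) (a + b)) =
        (fun j => h.form q (A (stdFrame r q j q)) a) +
          fun j => h.form q (A (stdFrame r q j q)) b := by
      ext j; simp
    simp only [dualVec, this, Matrix.mulVec_add, Pi.add_apply, add_smul, Finset.sum_add_distrib]
  map_smul' c a := by
    have : (fun j => h.form q (A (stdFrame r q j q)) (c • a)) =
        c • fun j => h.form q (A (stdFrame r q j q)) a := by
      ext j; simp
    simp only [dualVec, this, Matrix.mulVec_smul, Pi.smul_apply, smul_eq_mul, mul_smul,
      Finset.smul_sum, RingHom.id_apply]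

/-- The `(1,0)`-part `D'` of the Chern connection of `h`. As the frame `e = stdFrame r q` is
holomorphic, compatibility with `h` and with `∂̄` says `h(e_j, D'_v s) = ∂_v h(e_j, s)` for
all `j`. -/
def chernD (s : ∀ x, E x) (q : M) (v : TangentSpace 𝓘(ℂ, EM) q) : E q :=
  h.dualVec q fun j => del (fun x => h.form x (stdFrame r q j x) (s x)) q v

/-- `(D'_v A) s = D'_v (A s) - A (D'_v s)` for an endomorphism `A` of the bundle. -/
def chernDEnd (A : ∀ x, Module.End ℂ (E x)) (s : ∀ x, E x) (q : M)
    (v : TangentSpace 𝓘(ℂ, EM) q) : E q :=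
  h.chernD (fun x => A x (s x)) q v - A q (h.chernD s q v)

/-- `D'(A) = 0` on `V`. -/
def ChernDEndZeroOn (A : ∀ x, Module.End ℂ (E x)) (V : Set M) : Prop :=
  ∀ q ∈ V, ∀ s : ∀ x, E x, SmoothAt (Fin r → ℂ) EM s q → ∀ v, h.chernDEnd A s q v = 0

/-- `D'` is holomorphic on `V`: `D' ∂̄ + ∂̄ D' = 0` there. For coordinate fields `v`, `w` the
`(v, w̄)`-component of this operator is `D'_v ∂̄_w - ∂̄_w D'_v`. -/
def ChernDHolomorphicOn [IsManifold 𝓘(ℂ, EM) ω M] (V : Set M) : Prop :=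
  ∀ q ∈ V, ∀ s : ∀ x, E x, SmoothAt (Fin r → ℂ) EM s q → ∀ v w : TangentSpace 𝓘(ℂ, EM) q,
    h.chernD (fun x => dbar r s x (coordField q w x)) q v
      - dbar r (fun x => h.chernD s x (coordField q v x)) q w = 0

/-- The connection `D' + ∂̄ + Φ + Φ†`, applied to `s` in the direction of a real tangent vector
`v`. -/
def higgsConn (Φ : ∀ x, TangentSpace 𝓘(ℂ, EM) x →ₗ[ℂ] Module.End ℂ (E x)) (s : ∀ x, E x)
    (q : M) (v : TangentSpace 𝓘(ℂ, EM) q) : E q :=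
  h.chernD s q v + dbar r s q v + Φ q v (s q) + h.adj (Φ q v) (s q)

end HermitianMetric

/-- A `C^∞` endomorphism of the bundle: it maps `C^∞` sections to `C^∞` sections. -/
def SmoothEnd (EM : Type*) [NormedAddCommGroup EM] [NormedSpace ℂ EM] [ChartedSpace EM M] (r : ℕ)
    [TopologicalSpace (TotalSpace (Fin r → ℂ) E)] [FiberBundle (Fin r → ℂ) E]
    (A : ∀ x, Module.End ℂ (E x)) : Prop :=
  ∀ (q : M) (s : ∀ x, E x), SmoothAt (Fin r → ℂ) EM s q →
    SmoothAt (Fin r → ℂ) EM (fun x => A x (s x)) q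

/-- `(E, h, Φ)` is a harmonic Higgs bundle. -/
structure IsHarmonicHiggs [IsManifold 𝓘(ℂ, EM) ω M] (h : HermitianMetric EM r E)
    (Φ : ∀ x, TangentSpace 𝓘(ℂ, EM) x →ₗ[ℂ] Module.End ℂ (E x)) : Prop where
  /-- `Φ` maps holomorphic sections of `E` to holomorphic `E`-valued `1`-forms. -/
  holomorphic : ∀ (V : Set M), IsOpen V → ∀ (X : ∀ x : M, TangentSpace 𝓘(ℂ, EM) x)
    (s : ∀ x, E x), HolomorphicOn EM EM X V → HolomorphicOn (Fin r → ℂ) EM s V →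
    HolomorphicOn (Fin r → ℂ) EM (fun x => Φ x (X x) (s x)) V
  /-- `Φ ∧ Φ = 0`. -/
  wedge : ∀ (q : M) (v w : TangentSpace 𝓘(ℂ, EM) q), Φ q v * Φ q w - Φ q w * Φ q v = 0
  /-- The connection `D' + ∂̄ + Φ + Φ†` is integrable: its curvature vanishes. -/
  integrable : ∀ (q : M) (s : ∀ x, E x), SmoothAt (Fin r → ℂ) EM s q →
    ∀ v w : TangentSpace 𝓘(ℂ, EM) q,
      h.higgsConn Φ (fun x => h.higgsConn Φ s x (coordField q w x)) q v
        - h.higgsConn Φ (fun x => h.higgsConn Φ s x (coordField q v x)) q w = 0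

/-- `(E, h, Φ, U, Q)` is an integrable harmonic Higgs bundle. -/
structure IsIntegrableHarmonicHiggs [IsManifold 𝓘(ℂ, EM) ω M] (h : HermitianMetric EM r E)
    (Φ : ∀ x, TangentSpace 𝓘(ℂ, EM) x →ₗ[ℂ] Module.End ℂ (E x))
    (U Q : ∀ x, Module.End ℂ (E x)) : Prop extends IsHarmonicHiggs h Φ where
  smooth_U : SmoothEnd EM r U
  smooth_Q : SmoothEnd EM r Q
  /-- `∂̄(U) = 0`. -/
  dbar_U : ∀ (q : M) (s : ∀ x, E x), SmoothAt (Fin r → ℂ) EM s q →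
    ∀ v : TangentSpace 𝓘(ℂ, EM) q,
      dbar r (fun x => U x (s x)) q v - U q (dbar r s q v) = 0
  /-- `Q† = Q`. -/
  adj_Q : ∀ q, h.adj (Q q) = Q q
  /-- `[Φ, U] = 0`. -/
  comm_U : ∀ (q : M) (v : TangentSpace 𝓘(ℂ, EM) q), Φ q v * U q - U q * Φ q v = 0
  /-- `D'(U) - [Φ, Q] + Φ = 0`. -/
  chern_U : ∀ (q : M) (s : ∀ x, E x), SmoothAt (Fin r → ℂ) EM s q →
    ∀ v : TangentSpace 𝓘(ℂ, EM) q,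
      h.chernDEnd U s q v - (Φ q v * Q q - Q q * Φ q v) (s q) + Φ q v (s q) = 0
  /-- `D'(Q) + [Φ, U†] = 0`. -/
  chern_Q : ∀ (q : M) (s : ∀ x, E x), SmoothAt (Fin r → ℂ) EM s q →
    ∀ v : TangentSpace 𝓘(ℂ, EM) q,
      h.chernDEnd Q s q v + (Φ q v * h.adj (U q) - h.adj (U q) * Φ q v) (s q) = 0

/-- The `C^∞` endomorphism `A` is a potential of the Higgs field: `Φ = D'(A)`. -/
def IsPotential (h : HermitianMetric EM r E)
    (Φ : ∀ x, TangentSpace 𝓘(ℂ, EM) x →ₗ[ℂ] Module.End ℂ (E x))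
    (A : ∀ x, Module.End ℂ (E x)) : Prop :=
  SmoothEnd EM r A ∧ ∀ (q : M) (s : ∀ x, E x), SmoothAt (Fin r → ℂ) EM s q →
    ∀ v : TangentSpace 𝓘(ℂ, EM) q, Φ q v (s q) = h.chernDEnd A s q v

/-- The IS condition for an endomorphism: no two eigenvalues differ by `1` or `-1`. -/
def IS {V : Type*} [AddCommGroup V] [Module ℂ V] (A : Module.End ℂ V) : Prop :=
  ∀ α β : ℂ, A.HasEigenvalue α → A.HasEigenvalue β → α - β ≠ 1 ∧ α - β ≠ -1

/-- `e` is a holomorphic frame of `E` on `V` that is flat for `D'`. -/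
structure IsFlatHolomorphicFrameOn (h : HermitianMetric EM r E) (e : Fin r → ∀ x, E x)
    (V : Set M) : Prop where
  holomorphic : ∀ i, HolomorphicOn (Fin r → ℂ) EM (e i) V
  flat : ∀ i, ∀ q ∈ V, ∀ v, h.chernD (e i) q v = 0
  linearIndependent : ∀ q ∈ V, LinearIndependent ℂ fun i => e i q
  span : ∀ q ∈ V, Submodule.span ℂ (Set.range fun i => e i q) = ⊤

/-! Sections of the pull-back of `E` to `ℂ^* × M` are written `σ z x`, with `z ≠ 0` and
`σ z x ∈ E_x`; tangent vectors of `ℂ^* × M` are written `(ζ, v)`. -/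

section StructureConnection

/-- `∂ f` on `ℂ^* × M`, at `(z, q)` and in the direction `(ζ, v)`. -/
def delProd (f : ℂ → M → ℂ) (z : ℂ) (q : M) (ζ : ℂ) (v : TangentSpace 𝓘(ℂ, EM) q) : ℂ :=
  del (EM := ℂ) (fun z' => f z' q) z ζ + del (f z) q v

/-- `∂̄ f` on `ℂ^* × M`, at `(z, q)` and in the direction `(ζ, v)`. -/
def delBarProd (f : ℂ → M → ℂ) (z : ℂ) (q : M) (ζ : ℂ) (v : TangentSpace 𝓘(ℂ, EM) q) : ℂ :=
  delBar (EM := ℂ) (fun z' => f z' q) z ζ + delBar (f z) q v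

/-- The pull-back of `D'` to `ℂ^* × M`. -/
def pullD (h : HermitianMetric EM r E) (σ : ℂ → ∀ x, E x) (z : ℂ) (q : M) (ζ : ℂ)
    (v : TangentSpace 𝓘(ℂ, EM) q) : E q :=
  (trivializationAt (Fin r → ℂ) E q).symm q
      (del (EM := ℂ) (fun z' => (trivializationAt (Fin r → ℂ) E q ⟨q, σ z' q⟩).2) z ζ)
    + h.chernD (σ z) q v

/-- The pull-back of `∂̄` to `ℂ^* × M`. -/
def pullDbar (r : ℕ) [TopologicalSpace (TotalSpace (Fin r → ℂ) E)]
    [FiberBundle (Fin r → ℂ) E] (σ : ℂ → ∀ x, E x) (z : ℂ) (q : M) (ζ : ℂ)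
    (v : TangentSpace 𝓘(ℂ, EM) q) : E q :=
  (trivializationAt (Fin r → ℂ) E q).symm q
      (delBar (EM := ℂ) (fun z' => (trivializationAt (Fin r → ℂ) E q ⟨q, σ z' q⟩).2) z ζ)
    + dbar r (σ z) q v

/-- The structure connection of weight `w`,
`D' + Φ / z + (U / z - Q + w / 2 - z U†) dz / z`. -/
def structureConn (h : HermitianMetric EM r E)
    (Φ : ∀ x, TangentSpace 𝓘(ℂ, EM) x →ₗ[ℂ] Module.End ℂ (E x))
    (U Q : ∀ x, Module.End ℂ (E x)) (w : ℂ) (σ : ℂ → ∀ x, E x) (z : ℂ) (q : M) (ζ : ℂ)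
    (v : TangentSpace 𝓘(ℂ, EM) q) : E q :=
  pullD h σ z q ζ v + z⁻¹ • Φ q v (σ z q)
    + (ζ / z) • (z⁻¹ • U q (σ z q) - Q q (σ z q) + (w / 2) • σ z q
        - z • h.adj (U q) (σ z q))

/-- The operator `∂̄ + z Φ†`, the holomorphic structure of the pull-back bundle on `ℂ^* × M`. -/
def structureDbar (h : HermitianMetric EM r E)
    (Φ : ∀ x, TangentSpace 𝓘(ℂ, EM) x →ₗ[ℂ] Module.End ℂ (E x)) (σ : ℂ → ∀ x, E x)
    (z : ℂ) (q : M) (ζ : ℂ) (v : TangentSpace 𝓘(ℂ, EM) q) : E q :=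
  pullDbar r σ z q ζ v + z • h.adj (Φ q v) (σ z q)

end StructureConnection

end HiggsBundle

end

/-! At a point `q` the equation `D'(U) - [Φ, Q] + Φ = 0` is a linear equation for `Φ_v` with
operator `X ↦ X - [X, Q]`. If `X` lies in the kernel, then `(Q + 1) X = X Q`, hence `p(Q + 1) X = X
p(Q)` for every polynomial `p`. Taking for `p` the characteristic polynomial `χ` of `Q` gives `χ(Q +
1) X = 0` by Cayley–Hamilton, and the IS condition says exactly that `χ(Q + 1)` is invertible
(`IS_iff_isUnit_aeval_charpoly`, `IS.eq_zero`). So `Φ` is determined by `D'(U)`. The same criterion,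
read as `det χ(Q + 1) ≠ 0`, is open, because the determinant depends continuously on the matrix of
`Q` (`isOpen_setOf_IS`).

If `D'(U) = 0`, then `X = 0` is a solution, so `Φ = 0` and the flat connection is `D' + ∂̄`. In a
holomorphic frame with Gram operator `L` one has `D' = L⁻¹ ∘ ∂ ∘ L = ∂ + θ` with `θ = L⁻¹ ∂L`. The
`(2,0)`-curvature vanishes automatically, and comparing the directions `v` and `iv` isolates the
`(1,1)`-part, so `D'` is holomorphic (`chernDHolomorphicOn_of_higgs_eq_zero`).

Holomorphy of `D'` makes `θ` holomorphic, so `dθ = ∂θ = -θ ∧ θ` and the system `dF = -θF` is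
integrable. Its local solution comes from a Frobenius theorem, proved by solving along rays
(`exists_parallel_frame`). Parallel sections are holomorphic because `θ` has type `(1,0)`.

For the eigenframe, an eigenbasis of the self-adjoint `Q(q₀)`, with real eigenvalues, is transported
by `F`. Since `Φ = 0`, the equation for `D'(Q)` reads `D'(Q) = 0`, and self-adjointness turns this
into holomorphy of the sections `Q e_i`. Thus `Q e_i` and `λ_i e_i` are parallel and agree at `q₀`;
Grönwall makes them equal (`exists_flat_eigenframe`). In such a frame the structure connection with
`U = 0` follows from the Leibniz rule. In the global statement both `Φ` and `D'(U)` are zero. -/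

section FrobeniusTheorem

open Set Metric Filter

/-! ### Linear differential equations on the unit interval -/

section LinearODE

variable {A : Type*} [NormedRing A] [NormedAlgebra ℝ A] [CompleteSpace A]

/-- Existence on `[0, 1]` for the linear equation `Y' = a Y` with small coefficient. -/
theorem exists_linear_ode_solution {a : ℝ → A} (ha : ContinuousOn a (Icc 0 1))
    (hb : ∀ t ∈ Icc (0 : ℝ) 1, ‖a t‖ ≤ 1 / 2) :
    ∃ Y : ℝ → A, Y 0 = 1 ∧ (∀ t ∈ Icc (0 : ℝ) 1, HasDerivWithinAt Y (a t * Y t) (Icc 0 1) t) := by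
  -- On the ball of radius `‖1‖ + 1` about `1` the norm is at most `2‖1‖ + 1`, so the field is
  -- bounded by half of that, below the speed bound `‖1‖ + 1`. In time `1` a solution therefore
  -- stays in the ball. The norm of `1` is kept since it need not be `1` in a `NormedRing`.
  have hP : IsPicardLindelof (fun t Y => a t * Y) (⟨0, by simp⟩ : Icc (0 : ℝ) 1) (1 : A)
      (‖(1 : A)‖₊ + 1) 0 (‖(1 : A)‖₊ + 1) 1 := by
    refine ⟨fun t ht => ?_, fun x _ => ha.mul continuousOn_const, fun t ht x hx => ?_, ?_⟩
    · refine LipschitzOnWith.of_dist_le_mul fun x _ y _ => ?_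
      rw [dist_eq_norm, dist_eq_norm, ← mul_sub]
      refine (norm_mul_le _ _).trans ?_
      have := hb t ht
      have h2 : (0 : ℝ) ≤ ‖x - y‖ := norm_nonneg _
      norm_num
      nlinarith
    · have h1 : ‖x‖ ≤ ‖(1 : A)‖ + (‖(1 : A)‖ + 1) := by
        have := mem_closedBall.1 hx
        rw [dist_eq_norm] at this
        have h3 : ‖x‖ ≤ ‖x - 1‖ + ‖(1 : A)‖ := by simpa using norm_add_le (x - 1) 1
        push_cast at this
        linarith
      refine (norm_mul_le _ _).trans ?_
      have h2 := hb t ht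
      have h3 := norm_nonneg (a t)
      push_cast
      have h4 := norm_nonneg (1 : A)
      nlinarith
    · simp
  obtain ⟨Y, h0, hY⟩ := hP.exists_eq_forall_mem_Icc_hasDerivWithinAt₀
  exact ⟨Y, h0, hY⟩

theorem HasDerivWithinAt.Icc_to_Ici {F : Type*} [NormedAddCommGroup F] [NormedSpace ℝ F]
    {f : ℝ → F} {f' : F} {a b t : ℝ} (h : HasDerivWithinAt f f' (Icc a b) t) (ht : t ∈ Ico a b) :
    HasDerivWithinAt f f' (Ici t) t :=
  h.mono_of_mem_nhdsWithin (mem_of_superset (Icc_mem_nhdsGE ht.2) (Icc_subset_Icc_left ht.1))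

/-- Grönwall's inequality with rate `1`. It serves twice: with `ε = 0` to bound the solutions along
rays, and with `δ = 0` and `ε` quadratic to compare neighbouring rays. -/
theorem norm_le_of_linear_ode {F : Type*} [NormedAddCommGroup F] [NormedSpace ℝ F]
    {f f' : ℝ → F} {δ ε : ℝ}
    (hf : ∀ t ∈ Icc (0 : ℝ) 1, HasDerivWithinAt f (f' t) (Icc 0 1) t) (h0 : ‖f 0‖ ≤ δ)
    (bound : ∀ t ∈ Icc (0 : ℝ) 1, ‖f' t‖ ≤ 1 * ‖f t‖ + ε) (hδ : 0 ≤ δ) (hε : 0 ≤ ε) :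
    ∀ t ∈ Icc (0 : ℝ) 1, ‖f t‖ ≤ Real.exp 1 * (δ + ε) := by
  intro t ht
  have := norm_le_gronwallBound_of_norm_deriv_right_le
    (fun t ht => (hf t ht).continuousWithinAt)
    (fun t ht => (hf t (Ico_subset_Icc_self ht)).Icc_to_Ici ht) h0
    (fun t ht => bound t (Ico_subset_Icc_self ht)) t ht
  refine this.trans ?_
  rw [gronwallBound_of_K_ne_0 one_ne_zero]
  have h1 : Real.exp (1 * (t - 0)) ≤ Real.exp 1 := Real.exp_le_exp.2 (by linarith [ht.2])
  have h2 := Real.exp_pos 1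
  simp only [div_one]
  nlinarith

end LinearODE

/-! ### Frobenius theorem for flat linear connections -/

section Flat

variable {E : Type*} [NormedAddCommGroup E] [NormedSpace ℝ E]

/-- Mean value inequality on the segment, where the derivative differs from its value at `x` by at
most `K * ‖y - x‖`. It supplies a quadratic Taylor remainder. -/
theorem norm_sub_sub_fderiv_le {F : Type*} [NormedAddCommGroup F] [NormedSpace ℝ F]
    {f : E → F} {s : Set E} (hs : Convex ℝ s) {K : ℝ}
    (hd : ∀ x ∈ s, DifferentiableAt ℝ f x)
    (hK : ∀ x ∈ s, ∀ y ∈ s, ‖fderiv ℝ f x - fderiv ℝ f y‖ ≤ K * ‖x - y‖) (hK0 : 0 ≤ K)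
    {x y : E} (hx : x ∈ s) (hy : y ∈ s) :
    ‖f y - f x - fderiv ℝ f x (y - x)‖ ≤ K * ‖y - x‖ * ‖y - x‖ := by
  refine (convex_segment x y).norm_image_sub_le_of_norm_hasFDerivWithin_le'
    (f' := fderiv ℝ f)
    (fun z hz => (hd z (hs.segment_subset hx hy hz)).hasFDerivAt.hasFDerivWithinAt)
    (fun z hz => ?_) (left_mem_segment ℝ x y) (right_mem_segment ℝ x y)
  refine (hK z (hs.segment_subset hx hy hz) x hx).trans ?_
  gcongr
  have := norm_sub_le_of_mem_segment hz
  simpa [norm_sub_rev] using this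

/-- A function on a ball whose differential is bounded by a multiple of the function, and which
vanishes at the centre, vanishes identically. -/
theorem eq_zero_of_norm_fderiv_le {F : Type*} [NormedAddCommGroup F] [NormedSpace ℝ F]
    {y₀ : E} {ρ c : ℝ} {g : E → F} (hg : ∀ y ∈ ball y₀ ρ, DifferentiableAt ℝ g y)
    (hb : ∀ y ∈ ball y₀ ρ, ∀ v, ‖fderiv ℝ g y v‖ ≤ c * ‖v‖ * ‖g y‖) (h0 : g y₀ = 0) :
    ∀ y ∈ ball y₀ ρ, g y = 0 := by
  intro y hy
  have hmem : ∀ t ∈ Icc (0 : ℝ) 1, y₀ + t • (y - y₀) ∈ ball y₀ ρ := by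
    intro t ht
    have h1 : ‖y - y₀‖ < ρ := by simpa [dist_eq_norm] using hy
    rw [mem_ball, dist_eq_norm, add_sub_cancel_left, norm_smul, Real.norm_of_nonneg ht.1]
    nlinarith [norm_nonneg (y - y₀), ht.2, ht.1]
  have hd : ∀ t ∈ Icc (0 : ℝ) 1, HasDerivAt (fun t : ℝ => g (y₀ + t • (y - y₀)))
      (fderiv ℝ g (y₀ + t • (y - y₀)) (y - y₀)) t := by
    intro t ht
    have h1 : HasDerivAt (fun t : ℝ => y₀ + t • (y - y₀)) (y - y₀) t := by
      simpa using ((hasDerivAt_id t).smul_const (y - y₀)).const_add y₀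
    exact (hg _ (hmem t ht)).hasFDerivAt.comp_hasDerivAt t h1
  -- Along the ray from the centre to `y` the hypothesis becomes a scalar Grönwall inequality with
  -- this constant.
  have := eq_zero_of_abs_deriv_le_mul_abs_self_of_eq_zero_right (K := c * ‖y - y₀‖)
    (fun t ht => (hd t ht).continuousAt.continuousWithinAt)
    (fun t ht => (hd t (Ico_subset_Icc_self ht)).hasDerivWithinAt) (by simpa using h0)
    (fun t ht => hb _ (hmem t (Ico_subset_Icc_self ht)) _) 1 (by simp)
  simpa using this

variable {A : Type*} [NormedRing A] [NormedAlgebra ℝ A] [CompleteSpace A]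

set_option synthInstance.maxHeartbeats 200000 in
set_option maxHeartbeats 1600000 in
/-- Frobenius theorem for linear connections: if the connection form `-Θ` is flat, then
`dF = Θ F` has a local solution with `F y₀ = 1`. -/
theorem exists_parallel_frame {Θ : E → E →L[ℝ] A} {y₀ : E} (hΘ : ContDiffAt ℝ 2 Θ y₀)
    (hflat : ∀ᶠ y in 𝓝 y₀, ∀ v w : E, fderiv ℝ Θ y v w - fderiv ℝ Θ y w v =
      Θ y v * Θ y w - Θ y w * Θ y v) :
    ∃ F : E → A, F y₀ = 1 ∧ ∀ᶠ y in 𝓝 y₀,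
      HasFDerivAt F (((ContinuousLinearMap.mul ℝ A).flip (F y)).comp (Θ y)) y := by
  -- This is where order `2` is needed: the derivative of `Θ` must be Lipschitz for the Taylor
  -- remainder of `Θ` to be quadratic.
  have hD : ContDiffAt ℝ 1 (fderiv ℝ Θ) y₀ := hΘ.fderiv_right (by norm_num)
  obtain ⟨K, s, hs, hK⟩ := hD.exists_lipschitzOnWith
  have hdiff : ∀ᶠ y in 𝓝 y₀, DifferentiableAt ℝ Θ y := by
    filter_upwards [hΘ.eventually (by simp)] with y hy
      using hy.differentiableAt (by norm_num)
  set C : ℝ := ‖Θ y₀‖ + 1 with hC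
  obtain ⟨C', s', hs₁, hK'⟩ := (hΘ.of_le one_le_two).exists_lipschitzOnWith
  have hCb : ∀ᶠ y in 𝓝 y₀, ‖Θ y‖ < C :=
    hΘ.continuousAt.norm.eventually_lt continuousAt_const (lt_add_one _)
  have hC0 : 0 < C := by positivity
  obtain ⟨ρ₁, hρ₁, hball⟩ := Metric.eventually_nhds_iff_ball.1
    (hflat.and (hdiff.and (hCb.and ((show ∀ᶠ y in 𝓝 y₀, y ∈ s' from hs₁).and hs))))
  -- The second bound makes the coefficient along any ray shorter than `ρ` at most `1 / 2`, as
  -- `exists_linear_ode_solution` requires.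
  set ρ : ℝ := min ρ₁ (1 / (2 * C)) with hρdef
  have hρ : 0 < ρ := by positivity
  have hρC : C * ρ ≤ 1 / 2 := by
    have : ρ ≤ 1 / (2 * C) := min_le_right _ _
    calc C * ρ ≤ C * (1 / (2 * C)) := by gcongr
      _ = 1 / 2 := by field_simp
  have hsub : ball y₀ ρ ⊆ ball y₀ ρ₁ := ball_subset_ball (min_le_left _ _)
  have hflat' := fun y hy => (hball y (hsub hy)).1
  have hdiff' := fun y hy => (hball y (hsub hy)).2.1
  have hb := fun y hy => (hball y (hsub hy)).2.2.1.le
  have hs₁' := fun y hy => (hball y (hsub hy)).2.2.2.1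
  have hs' := fun y hy => (hball y (hsub hy)).2.2.2.2
  have hmem : ∀ z ∈ ball (0 : E) ρ, ∀ t ∈ Icc (0 : ℝ) 1, y₀ + t • z ∈ ball y₀ ρ := by
    intro z hz t ht
    have h1 : ‖z‖ < ρ := by simpa using hz
    rw [mem_ball, dist_eq_norm, add_sub_cancel_left, norm_smul, Real.norm_of_nonneg ht.1]
    nlinarith [norm_nonneg z, ht.2, ht.1]
  have hline : ∀ (z : E) (t : ℝ), HasDerivAt (fun t : ℝ => y₀ + t • z) z t := fun z t => by
    simpa using ((hasDerivAt_id t).smul_const z).const_add y₀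
  -- the coefficient along the ray in direction `z`
  have hda : ∀ z ∈ ball (0 : E) ρ, ∀ w, ∀ t ∈ Icc (0 : ℝ) 1,
      HasDerivAt (fun t : ℝ => Θ (y₀ + t • z) w) (fderiv ℝ Θ (y₀ + t • z) z w) t := by
    intro z hz w t ht
    have := (hdiff' _ (hmem z hz t ht)).hasFDerivAt.comp_hasDerivAt t (hline z t)
    exact (ContinuousLinearMap.apply ℝ A w).hasFDerivAt.comp_hasDerivAt t this
  have hab : ∀ z ∈ ball (0 : E) ρ, ∀ t ∈ Icc (0 : ℝ) 1, ‖Θ (y₀ + t • z) z‖ ≤ 1 / 2 := by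
    intro z hz t ht
    refine (ContinuousLinearMap.le_opNorm _ _).trans (le_trans ?_ hρC)
    have h1 : ‖z‖ < ρ := by simpa using hz
    gcongr
    exact hb _ (hmem z hz t ht)
  -- The equation is solved along each ray `t ↦ y₀ + t z`; the candidate is `F (y₀ + z) = Y z 1`.
  -- Nothing is needed outside the ball, so `0` fills in there.
  have hex : ∀ z : E, ∃ Y : ℝ → A, z ∈ ball (0 : E) ρ → (Y 0 = 1 ∧
      ∀ t ∈ Icc (0 : ℝ) 1, HasDerivWithinAt Y (Θ (y₀ + t • z) z * Y t) (Icc 0 1) t) := by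
    intro z
    by_cases hz : z ∈ ball (0 : E) ρ
    · obtain ⟨Y, hY⟩ := exists_linear_ode_solution
        (fun t ht => (hda z hz z t ht).continuousAt.continuousWithinAt) (hab z hz)
      exact ⟨Y, fun _ => hY⟩
    · exact ⟨0, fun h => absurd h hz⟩
  choose Y hY using hex
  set N : ℝ := Real.exp 1 * ‖(1 : A)‖ with hN
  have hN0 : 0 ≤ N := by positivity
  have hYb : ∀ z ∈ ball (0 : E) ρ, ∀ t ∈ Icc (0 : ℝ) 1, ‖Y z t‖ ≤ N := by
    intro z hz t ht
    have := norm_le_of_linear_ode (hY z hz).2 (δ := ‖(1 : A)‖) (ε := 0) (by rw [(hY z hz).1])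
      (fun t ht => ?_) (norm_nonneg _) le_rfl t ht
    · simpa using this
    · refine (norm_mul_le _ _).trans ?_
      have := hab z hz t ht
      nlinarith [norm_nonneg (Y z t)]
  set S : ℝ := (K * ρ + C' + (C' * ρ + C) * C) * N with hS
  have hS0 : 0 ≤ S := by positivity
  -- A first-order expansion of the candidate with quadratic error; it gives differentiability, with
  -- the required derivative, at every point of the ball.
  have key : ∀ z ∈ ball (0 : E) ρ, ∀ z' ∈ ball (0 : E) ρ,
      ‖Y z' 1 - Y z 1 - Θ (y₀ + z) (z' - z) * Y z 1‖ ≤ Real.exp 1 * (S * ‖z' - z‖ ^ 2) := by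
    intro z hz z' hz'
    set δ := z' - z with hδ
    -- `(1 + B t) * Y z t` is the first-order prediction for `Y z' t`: if `F` solves the system,
    -- moving from `y₀ + t z` to `y₀ + t z'` changes it by about `Θ (t δ) F`.
    set B : ℝ → A := fun t => t • Θ (y₀ + t • z) δ with hB
    have hBd : ∀ t ∈ Icc (0 : ℝ) 1, HasDerivAt B
        (t • fderiv ℝ Θ (y₀ + t • z) z δ + Θ (y₀ + t • z) δ) t := fun t ht => by
      have h := (hasDerivAt_id t).smul (hda z hz δ t ht)
      rw [one_smul] at h
      exact h
    set f : ℝ → A := fun t => Y z' t - (1 + B t) * Y z t with hf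
    have hfd : ∀ t ∈ Icc (0 : ℝ) 1, HasDerivWithinAt f
        (Θ (y₀ + t • z') z' * Y z' t - ((t • fderiv ℝ Θ (y₀ + t • z) z δ + Θ (y₀ + t • z) δ) * Y z t
          + (1 + B t) * (Θ (y₀ + t • z) z * Y z t))) (Icc 0 1) t := fun t ht =>
      ((hY z' hz').2 t ht).sub
        (((hBd t ht).hasDerivWithinAt.const_add 1).mul ((hY z hz).2 t ht))
    have := norm_le_of_linear_ode hfd (δ := 0) (ε := S * ‖δ‖ ^ 2) (by
      simp [hf, hB, (hY z hz).1, (hY z' hz').1]) (fun t ht => ?_) le_rfl (by positivity) 1 (by simp)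
    · have h1 : f 1 = Y z' 1 - Y z 1 - Θ (y₀ + z) δ * Y z 1 := by
        simp only [hf, hB, one_smul, add_mul, one_mul]; abel
      rw [h1] at this
      simpa using this
    · have hx := hmem z hz t ht
      have hx' := hmem z' hz' t ht
      set x := y₀ + t • z with hxdef
      set x' := y₀ + t • z' with hxdef'
      have hxx : x' - x = t • δ := by simp [hxdef, hxdef', hδ, smul_sub]
      have hnt : ‖t • δ‖ ≤ ‖δ‖ := by
        rw [norm_smul, Real.norm_of_nonneg ht.1]; nlinarith [norm_nonneg δ, ht.2]
      have hz1 : ‖z‖ ≤ ρ := by simpa using (mem_ball_zero_iff.1 hz).le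
      have hz1' : ‖z'‖ ≤ ρ := by simpa using (mem_ball_zero_iff.1 hz').le
      have hT := norm_sub_sub_fderiv_le (convex_ball y₀ ρ) hdiff'
        (fun a ha b hb => by simpa [dist_eq_norm] using hK.dist_le_mul a (hs' a ha) b (hs' b hb))
        K.2 hx hx'
      have hT1 : ‖Θ x' - Θ x‖ ≤ C' * ‖δ‖ := by
        have := hK'.dist_le_mul x' (hs₁' x' hx') x (hs₁' x hx)
        rw [dist_eq_norm, dist_eq_norm, hxx] at this
        exact this.trans (by gcongr)
      have hfl := hflat' x hx z δ
      set R : A := (Θ x' - Θ x - fderiv ℝ Θ x (x' - x)) z + (Θ x' - Θ x) δ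
        + ((Θ x' - Θ x) z' + Θ x δ) * B t with hR
      have hz'e : z' = z + δ := by simp [hδ]
      have e1 : Θ x' z' * Y z' t - ((t • fderiv ℝ Θ x z δ + Θ x δ) * Y z t
          + (1 + B t) * (Θ x z * Y z t)) = Θ x' z' * f t + R * Y z t := by
        -- Flatness enters only here. The swapped derivative joins `Θ x' z - Θ x z` to form a Taylor
        -- remainder, and the commutator cancels the first-order products with `B t`, leaving the
        -- quadratic error `R`.
        have e2 : fderiv ℝ Θ x z δ = fderiv ℝ Θ x δ z + (Θ x z * Θ x δ - Θ x δ * Θ x z) := by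
          rw [← hfl]; abel
        simp only [hR, hf, hxx, e2, hB, hz'e, map_add, map_smul,
          sub_apply, smul_apply, ← hxdef]
        simp only [mul_add, add_mul, mul_sub, sub_mul, smul_mul_assoc, mul_smul_comm, smul_add,
          smul_sub, mul_assoc, one_mul]
        abel
      have hBn : ‖B t‖ ≤ C * ‖δ‖ := by
        have h1 : B t = Θ x (t • δ) := by simp [hB, hxdef]
        rw [h1]
        refine (ContinuousLinearMap.le_opNorm _ _).trans ?_
        gcongr
        exact hb x hx
      have hRn : ‖R‖ ≤ (K * ρ + C' + (C' * ρ + C) * C) * ‖δ‖ ^ 2 := by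
        have r1 : ‖(Θ x' - Θ x - fderiv ℝ Θ x (x' - x)) z‖ ≤ (K * ‖δ‖ * ‖δ‖) * ρ := by
          refine (ContinuousLinearMap.le_opNorm _ _).trans ?_
          gcongr
          refine hT.trans ?_
          rw [hxx]; gcongr; exact le_rfl
        have r2 : ‖(Θ x' - Θ x) δ‖ ≤ C' * ‖δ‖ * ‖δ‖ :=
          (ContinuousLinearMap.le_opNorm _ _).trans (by gcongr)
        have r3 : ‖(Θ x' - Θ x) z' + Θ x δ‖ ≤ C' * ‖δ‖ * ρ + C * ‖δ‖ := by
          refine (norm_add_le _ _).trans (add_le_add ?_ ?_)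
          · exact (ContinuousLinearMap.le_opNorm _ _).trans (by gcongr)
          · exact (ContinuousLinearMap.le_opNorm _ _).trans (by gcongr; exact hb x hx)
        have r4 : ‖((Θ x' - Θ x) z' + Θ x δ) * B t‖ ≤ (C' * ‖δ‖ * ρ + C * ‖δ‖) * (C * ‖δ‖) :=
          (norm_mul_le _ _).trans (by gcongr)
        calc ‖R‖ ≤ (K * ‖δ‖ * ‖δ‖) * ρ + C' * ‖δ‖ * ‖δ‖
              + (C' * ‖δ‖ * ρ + C * ‖δ‖) * (C * ‖δ‖) :=
              (norm_add₃_le).trans (add_le_add (add_le_add r1 r2) r4)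
          _ = _ := by ring
      rw [e1]
      refine (norm_add_le _ _).trans (add_le_add ?_ ?_)
      · refine (norm_mul_le _ _).trans ?_
        have := hab z' hz' t ht
        nlinarith [norm_nonneg (f t)]
      · refine (norm_mul_le _ _).trans ?_
        calc ‖R‖ * ‖Y z t‖ ≤ ((K * ρ + C' + (C' * ρ + C) * C) * ‖δ‖ ^ 2) * N := by
              gcongr; exact hYb z hz t ht
          _ = S * ‖δ‖ ^ 2 := by rw [hS]; ring
  refine ⟨fun y => Y (y - y₀) 1, ?_, ?_⟩
  · have h0 : (0 : E) ∈ ball (0 : E) ρ := by simpa using hρ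
    -- For the ray `z = 0` the coefficient `Θ y₀ 0` is zero, so the solution keeps its initial
    -- value.
    have := constant_of_has_deriv_right_zero (f := Y 0) (a := 0) (b := 1)
      (fun t ht => ((hY 0 h0).2 t ht).continuousWithinAt)
      (fun t ht => by
        simpa using ((hY 0 h0).2 t (Ico_subset_Icc_self ht)).Icc_to_Ici ht) 1 (by simp)
    simp [this, (hY 0 h0).1]
  · filter_upwards [ball_mem_nhds y₀ hρ] with y hy
    rw [hasFDerivAt_iff_isLittleO]
    have hO : (fun x' => Y (x' - y₀) 1 - Y (y - y₀) 1 -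
        (((ContinuousLinearMap.mul ℝ A).flip (Y (y - y₀) 1)).comp (Θ y)) (x' - y)) =O[𝓝 y]
        fun x' => ‖x' - y‖ ^ 2 := by
      refine Asymptotics.IsBigO.of_bound (Real.exp 1 * S) ?_
      filter_upwards [isOpen_ball.mem_nhds hy] with x' hx'
      have := key (y - y₀) (by simpa [dist_eq_norm] using hy) (x' - y₀)
        (by simpa [dist_eq_norm] using hx')
      simpa [mul_assoc, sub_mul] using this
    refine hO.trans_isLittleO ?_
    have h2 : (fun x' => ‖x' - y‖ ^ 2) =o[𝓝 y] fun x' => ‖x' - y‖ ^ 1 :=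
      (Asymptotics.isLittleO_pow_pow one_lt_two).comp_tendsto (by
        have : Continuous fun x' => ‖x' - y‖ := by fun_prop
        simpa using this.tendsto y)
    simpa using h2

end Flat

end FrobeniusTheorem

noncomputable section

set_option linter.unusedSectionVars false

namespace HiggsBundle

/-! ### The IS condition and the spectral theorem as linear algebra -/

section Algebra

variable {V : Type*} [AddCommGroup V] [Module ℂ V]

/-- By spectral mapping, `χ(A + 1)` is singular exactly when `χ` vanishes at `β + 1` for some
eigenvalue `β`. One sign suffices, since exchanging the two eigenvalues exchanges the differences
`1` and `-1`. The zero space is treated apart because spectral mapping is used for nonempty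
spectrum. -/
theorem IS_iff_isUnit_aeval_charpoly [FiniteDimensional ℂ V] (A : Module.End ℂ V) :
    IS A ↔ IsUnit (Polynomial.aeval (A + 1) A.charpoly) := by
  rcases subsingleton_or_nontrivial V with hV | hV
  · have : Subsingleton (Module.End ℂ V) := inferInstance
    refine ⟨fun _ => isUnit_of_subsingleton _, fun _ α β hα => ?_⟩
    obtain ⟨v, hv⟩ := hα.exists_hasEigenvector
    exact absurd (Subsingleton.elim v 0) hv.2
  rw [← not_iff_not, ← spectrum.zero_mem_iff ℂ,
    spectrum.map_polynomial_aeval_of_nonempty _ _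
      (spectrum.nonempty_of_isAlgClosed_of_finiteDimensional ℂ _)]
  have hadd : ∀ μ : ℂ, μ ∈ spectrum ℂ (A + 1) ↔ A.HasEigenvalue (μ - 1) := by
    intro μ
    rw [Module.End.hasEigenvalue_iff_mem_spectrum]
    have := spectrum.add_mem_add_iff (R := ℂ) (a := A) (r := μ - 1) (s := 1)
    simp only [sub_add_cancel, map_one] at this
    rw [← this, add_comm]
  constructor
  · intro h
    simp only [IS, not_forall, not_and_or, not_not] at h
    obtain ⟨α, β, hα, hβ, h | h⟩ := h
    · exact ⟨α, (hadd _).2 (by rwa [← h, sub_sub_cancel]),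
        (A.hasEigenvalue_iff_isRoot_charpoly α).1 hα⟩
    · exact ⟨β, (hadd _).2 (by rwa [show β - 1 = α by linear_combination -h]),
        (A.hasEigenvalue_iff_isRoot_charpoly β).1 hβ⟩
  · rintro ⟨μ, hμ, h0⟩ h
    exact (h μ (μ - 1) ((A.hasEigenvalue_iff_isRoot_charpoly μ).2 h0) ((hadd μ).1 hμ)).1 (by ring)

/-- Under the IS condition the map `X ↦ X - [X, A]` is injective. -/
theorem IS.eq_zero [FiniteDimensional ℂ V] {A : Module.End ℂ V} (hA : IS A) {X : Module.End ℂ V}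
    (hX : -(X * A - A * X) + X = 0) : X = 0 := by
  have hAX : (A + 1) * X = X * A := by
    rw [add_mul, one_mul, ← sub_eq_zero, ← hX]; abel
  -- The intertwining relation passes to polynomials. For the characteristic polynomial the right
  -- side is zero by Cayley–Hamilton, while the factor on the left is invertible.
  have hp : ∀ p : Polynomial ℂ, Polynomial.aeval (A + 1) p * X = X * Polynomial.aeval A p := by
    intro p
    induction p using Polynomial.induction_on' with
    | add p q hp hq => simp [add_mul, mul_add, hp, hq]
    | monomial n a =>
      have : (A + 1) ^ n * X = X * A ^ n := by
        induction n with
        | zero => simp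
        | succ n ih => rw [pow_succ', mul_assoc, ih, ← mul_assoc, hAX, mul_assoc, ← pow_succ']
      simp only [Polynomial.aeval_monomial, mul_assoc, this]
      rw [← mul_assoc, ← mul_assoc, (Algebra.commutes a X)]
  have h := hp A.charpoly
  rw [LinearMap.aeval_self_charpoly, mul_zero] at h
  exact ((IS_iff_isUnit_aeval_charpoly A).1 hA).mul_right_eq_zero.1 h

theorem IS.conj {V' : Type*} [AddCommGroup V'] [Module ℂ V'] {A : Module.End ℂ V}
    {A' : Module.End ℂ V'} (e : V ≃ₗ[ℂ] V') (he : ∀ v, e (A v) = A' (e v)) (hA : IS A) : IS A' := by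
  have h : ∀ α, A'.HasEigenvalue α → A.HasEigenvalue α := by
    intro α hα
    obtain ⟨v, hv⟩ := hα.exists_hasEigenvector
    refine Module.End.hasEigenvalue_of_hasEigenvector (x := e.symm v)
      (Module.End.hasEigenvector_iff.2 ⟨Module.End.mem_eigenspace_iff.2 (e.injective ?_), ?_⟩)
    · rw [he, e.apply_symm_apply, hv.apply_eq_smul, map_smul, e.apply_symm_apply]
    · simpa using hv.2
  exact fun α β hα hβ => hA α β (h α hα) (h β hβ)

/-- The IS condition is open. -/
theorem isOpen_setOf_IS (n : Type*) [Fintype n] [DecidableEq n] :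
    IsOpen {N : Matrix n n ℂ | IS (Matrix.toLin' N)} := by
  have h : ∀ N : Matrix n n ℂ, IS (Matrix.toLin' N) ↔
      (Polynomial.aeval (N + 1) N.charpoly).det ≠ 0 := by
    intro N
    rw [IS_iff_isUnit_aeval_charpoly, Matrix.charpoly_toLin', ← isUnit_iff_ne_zero,
      ← Matrix.isUnit_iff_isUnit_det, ← isUnit_map_iff (Matrix.toLinAlgEquiv' (R := ℂ) (n := n)),
      ← Polynomial.aeval_algHom_apply]
    simp
    rfl
  have hc : ∀ i, Continuous fun N : Matrix n n ℂ => N.charpoly.coeff i := by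
    intro i
    -- The coefficients are universal polynomials in the matrix entries, hence continuous.
    have : (fun N : Matrix n n ℂ => N.charpoly.coeff i) = fun N =>
        MvPolynomial.eval (fun ij : n × n => (Matrix.of.symm N) ij.1 ij.2)
          ((Matrix.charpoly.univ ℂ n).coeff i) := by
      ext N
      exact (Matrix.charpoly.univ_coeff_eval₂Hom n (RingHom.id ℂ)
        (fun ij : n × n => (Matrix.of.symm N) ij.1 ij.2) i).symm
    rw [this]
    exact (MvPolynomial.continuous_eval _).comp
      (continuous_pi fun ij => continuous_apply_apply ij.1 ij.2)
  simp_rw [h]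
  refine isOpen_ne.preimage (f := fun N : Matrix n n ℂ => (Polynomial.aeval (N + 1) N.charpoly).det)
    (Continuous.matrix_det ?_)
  -- The degree of the characteristic polynomial does not depend on `N`, so the sum has a fixed
  -- range and continuity can be checked term by term.
  have : (fun N : Matrix n n ℂ => Polynomial.aeval (N + 1) N.charpoly) = fun N =>
      ∑ i ∈ Finset.range (Fintype.card n + 1), N.charpoly.coeff i • (N + 1) ^ i := by
    ext1 N
    rw [Polynomial.aeval_eq_sum_range, Matrix.charpoly_natDegree_eq_dim]
  rw [this]
  exact continuous_finsetSum _ fun i _ => (hc i).smul ((continuous_id.add continuous_const).pow i)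

/-- A linear map that is self-adjoint for a positive definite Hermitian form has a basis of
eigenvectors, with real eigenvalues. -/
theorem exists_eigenbasis_of_selfAdjoint [FiniteDimensional ℂ V] {n : ℕ}
    (hn : Module.finrank ℂ V = n) (B : V →ₗ⋆[ℂ] V →ₗ[ℂ] ℂ)
    (hB : ∀ a b, conj (B a b) = B b a) (hpos : ∀ a, a ≠ 0 → 0 < (B a a).re)
    (A : Module.End ℂ V) (hA : ∀ a b, B (A a) b = B a (A b)) :
    ∃ (b : Module.Basis (Fin n) ℂ V) (Λ : Fin n → ℝ), ∀ i, A (b i) = (Λ i : ℂ) • b i := by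
  -- The form is installed as the inner product, whose first variable is also the conjugate-linear
  -- one; then the spectral theorem for symmetric operators applies.
  let core : InnerProductSpace.Core ℂ V :=
    { inner := fun a b => B a b
      conj_inner_symm := fun a b => hB b a
      re_inner_nonneg := fun a => by
        by_cases h : a = 0
        · simp [h]
        · exact (hpos a h).le
      definite := fun a ha => by
        by_contra h
        have := hpos a h
        rw [show B a a = 0 from ha] at this
        simp at this
      add_left := fun a b c => by simp
      smul_left := fun a b c => by simp }
  let : NormedAddCommGroup V := core.toNormedAddCommGroup
  let : InnerProductSpace ℂ V := InnerProductSpace.ofCore core.toCore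
  have hs : A.IsSymmetric := fun a b => hA a b
  refine ⟨(hs.eigenvectorBasis hn).toBasis, hs.eigenvalues hn, fun i => ?_⟩
  simp [hs.apply_eigenvectorBasis hn i]

end Algebra

/-! ### Real and complex calculus in a fixed holomorphic chart -/

section Charts

variable {EM : Type*} [NormedAddCommGroup EM] [NormedSpace ℂ EM]
  {M : Type*} [TopologicalSpace M] [ChartedSpace EM M] [IsManifold 𝓘(ℂ, EM) ω M]
  {F : Type*} [NormedAddCommGroup F] [NormedSpace ℂ F]

theorem contDiffAt_chart_transition {q q' x : M}
    (hx : x ∈ (chartAt EM q).source) (hx' : x ∈ (chartAt EM q').source) :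
    ContDiffAt ℂ ω (chartAt EM q' ∘ (chartAt EM q).symm) (chartAt EM q x) := by
  have h := contDiffWithinAt_ext_coord_change (I := 𝓘(ℂ, EM)) (n := ω) q' q
    (y := chartAt EM q x) (by
      simp [PartialEquiv.trans_source, hx, hx', (chartAt EM q).map_source hx])
  rw [modelWithCornersSelf_coe, Set.range_id, contDiffWithinAt_univ] at h
  simpa using h

/-- The `C^∞` manifold underlying a complex manifold. -/
theorem isManifold_real : IsManifold 𝓘(ℝ, EM) ω M := by
  refine isManifold_of_contDiffOn _ _ _ fun e e' he he' => ?_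
  have h := (contDiffGroupoid ω 𝓘(ℂ, EM)).compatible he he'
  rw [contDiffGroupoid, mem_groupoid_of_pregroupoid] at h
  exact ContDiffOn.restrict_scalars ℝ h.1

/-- The chart stays at `q` while `x` moves, so that one coordinate expression serves a whole
neighbourhood and can be differentiated again. -/
theorem contMDiffAt_real_iff {F : Type*} [NormedAddCommGroup F] [NormedSpace ℝ F]
    {f : M → F} {q x : M} {n : ℕ∞ω}
    (hx : x ∈ (chartAt EM q).source) : ContMDiffAt 𝓘(ℝ, EM) 𝓘(ℝ, F) n f x ↔
      ContDiffAt ℝ n (f ∘ (chartAt EM q).symm) (chartAt EM q x) := by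
  have : IsManifold 𝓘(ℝ, EM) ω M := isManifold_real
  have : IsManifold 𝓘(ℝ, EM) n M := .of_le le_top
  rw [contMDiffAt_iff_source_of_mem_source hx, contMDiffWithinAt_iff_contDiffWithinAt,
    modelWithCornersSelf_coe, Set.range_id, contDiffWithinAt_univ]
  simp

theorem mdifferentiableAt_complex_iff {f : M → F} {q x : M}
    (hx : x ∈ (chartAt EM q).source) : MDifferentiableAt 𝓘(ℂ, EM) 𝓘(ℂ, F) f x ↔
      DifferentiableAt ℂ (f ∘ (chartAt EM q).symm) (chartAt EM q x) := by
  rw [mdifferentiableAt_iff_source_of_mem_source hx,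
    mdifferentiableWithinAt_iff_differentiableWithinAt, modelWithCornersSelf_coe, Set.range_id,
    differentiableWithinAt_univ]
  simp

theorem contMDiffAt_complex_iff {f : M → F} {q x : M} {n : ℕ∞ω}
    (hx : x ∈ (chartAt EM q).source) : ContMDiffAt 𝓘(ℂ, EM) 𝓘(ℂ, F) n f x ↔
      ContDiffAt ℂ n (f ∘ (chartAt EM q).symm) (chartAt EM q x) := by
  have : IsManifold 𝓘(ℂ, EM) n M := .of_le (n := ω) le_top
  rw [contMDiffAt_iff_source_of_mem_source hx, contMDiffWithinAt_iff_contDiffWithinAt,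
    modelWithCornersSelf_coe, Set.range_id, contDiffWithinAt_univ]
  simp

/-- The tangent space at `x` is identified with `EM` through the chart at `x`, so the derivative of
the transition map appears. -/
theorem coordField_eq {q x : M} (hx : x ∈ (chartAt EM q).source) (v : TangentSpace 𝓘(ℂ, EM) q) :
    coordField q v x = fderiv ℂ (chartAt EM x ∘ (chartAt EM q).symm) (chartAt EM q x) v := by
  have h := TangentBundle.symmL_trivializationAt_eq_core (I := 𝓘(ℂ, EM)) hx
  rw [tangentBundleCore_coordChange_achart] at h
  have hb : x ∈ (trivializationAt EM (TangentSpace 𝓘(ℂ, EM)) q).baseSet := by simpa using hx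
  have h2 := DFunLike.congr_fun h v
  erw [Trivialization.symmL_apply _ hb] at h2
  rw [modelWithCornersSelf_coe, Set.range_id, fderivWithin_univ] at h2
  simp only [extChartAt, OpenPartialHomeomorph.extend, modelWithCornersSelf_partialEquiv,
    PartialEquiv.trans_refl] at h2
  exact h2

theorem coordField_self (q : M) (v : TangentSpace 𝓘(ℂ, EM) q) : coordField q v q = v := by
  rw [coordField_eq (mem_chart_source EM q)]
  have h : (chartAt EM q ∘ (chartAt EM q).symm) =ᶠ[𝓝 (chartAt EM q q)] id := by
    filter_upwards [(chartAt EM q).open_target.mem_nhds (mem_chart_target EM q)] with y hy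
    simp [hy]
  rw [h.fderiv_eq, fderiv_id]
  rfl

/-- The coordinate vector field of the chart at `q` in the direction of `v`, at the point `x`. -/
def constField (q : M) (v : EM) (x : M) : TangentSpace 𝓘(ℂ, EM) x :=
  coordField q (show TangentSpace 𝓘(ℂ, EM) q from v) x

theorem constField_self (q : M) (v : EM) : constField q v q = v :=
  coordField_self q v

theorem constField_smul {q x : M} (hx : x ∈ (chartAt EM q).source)
    (c : ℂ) (v : EM) : constField q (c • v) x = c • constField q v x := by
  rw [constField, constField, coordField_eq hx, coordField_eq hx]
  exact map_smul _ _ _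

theorem exists_constField_eq {q x : M} (hx : x ∈ (chartAt EM q).source)
    (u : TangentSpace 𝓘(ℂ, EM) x) : ∃ v : EM, constField q v x = u := by
  have hb : x ∈ (trivializationAt EM (TangentSpace 𝓘(ℂ, EM)) q).baseSet := by simpa using hx
  refine ⟨((trivializationAt EM (TangentSpace 𝓘(ℂ, EM)) q) ⟨x, u⟩).2, ?_⟩
  exact Trivialization.symm_apply_apply_mk _ hb u

/-- The intrinsic differential uses the chart at `x`, and the coordinate field of the chart at `q`
carries the derivative of the transition map; the chain rule absorbs it. -/
theorem realDiff_constField {F : Type*} [NormedAddCommGroup F] [NormedSpace ℂ F] {f : M → F}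
    {q x : M} (hx : x ∈ (chartAt EM q).source)
    (hf : DifferentiableAt ℝ (f ∘ (chartAt EM q).symm) (chartAt EM q x))
    (v : EM) :
    realDiff (EM := EM) f x (constField q v x)
      = fderiv ℝ (f ∘ (chartAt EM q).symm) (chartAt EM q x) v := by
  have : IsManifold 𝓘(ℝ, EM) ω M := isManifold_real
  have : IsManifold 𝓘(ℝ, EM) 1 M := .of_le (n := ω) le_top
  set φ := chartAt EM q
  set ψ := chartAt EM x
  have hm : MDifferentiableAt 𝓘(ℝ, EM) 𝓘(ℝ, F) f x := by
    rw [mdifferentiableAt_iff_source_of_mem_source hx,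
      mdifferentiableWithinAt_iff_differentiableWithinAt, modelWithCornersSelf_coe, Set.range_id,
      differentiableWithinAt_univ]
    simpa using hf
  have h1 : realDiff (EM := EM) f x = fderiv ℝ (f ∘ ψ.symm) (ψ x) := by
    rw [realDiff, hm.mfderiv, modelWithCornersSelf_coe, Set.range_id, fderivWithin_univ]
    simp only [writtenInExtChartAt, extChartAt, OpenPartialHomeomorph.extend,
      modelWithCornersSelf_partialEquiv, PartialEquiv.trans_refl]
    rfl
  have hx' : x ∈ ψ.source := mem_chart_source EM x
  have hT := (contDiffAt_chart_transition hx hx').differentiableAt (by simp)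
  have hTR : HasFDerivAt (ψ ∘ φ.symm) ((fderiv ℂ (ψ ∘ φ.symm) (φ x)).restrictScalars ℝ) (φ x) :=
    hT.hasFDerivAt.restrictScalars ℝ
  have hψ : (ψ ∘ φ.symm) (φ x) = ψ x := by simp [φ.left_inv hx]
  have hd : DifferentiableAt ℝ (f ∘ ψ.symm) (ψ x) := by
    have := (mdifferentiableAt_iff_source_of_mem_source hx').1 hm
    rw [mdifferentiableWithinAt_iff_differentiableWithinAt, modelWithCornersSelf_coe,
      Set.range_id, differentiableWithinAt_univ] at this
    simpa using this
  have hE : f ∘ φ.symm =ᶠ[𝓝 (φ x)] (f ∘ ψ.symm) ∘ (ψ ∘ φ.symm) := by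
    have hc : ContinuousAt φ.symm (φ x) := φ.continuousAt_symm (φ.map_source hx)
    have : ∀ᶠ y in 𝓝 (φ x), φ.symm y ∈ ψ.source :=
      hc.eventually_mem (by rw [φ.left_inv hx]; exact ψ.open_source.mem_nhds hx')
    filter_upwards [this] with y hy
    simp [ψ.left_inv hy]
  rw [hE.fderiv_eq, constField, coordField_eq hx, h1]
  have := (HasFDerivAt.comp (φ x) (by rw [hψ]; exact hd.hasFDerivAt) hTR).fderiv
  rw [this]
  rfl

end Charts

/-! ### Wirtinger calculus on complex normed spaces -/

section Wirtinger

variable {V : Type*} [NormedAddCommGroup V] [NormedSpace ℂ V]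
  {F : Type*} [NormedAddCommGroup F] [NormedSpace ℂ F]
  {G : Type*} [NormedAddCommGroup G] [NormedSpace ℂ G]

/-- The `(1,0)`-part of the differential of a function on a complex vector space. -/
def pdel (f : V → F) (y v : V) : F :=
  (1 / 2 : ℂ) • (fderiv ℝ f y v - I • fderiv ℝ f y (I • v))

/-- The `(0,1)`-part of the differential of a function on a complex vector space. -/
def pdelBar (f : V → F) (y v : V) : F :=
  (1 / 2 : ℂ) • (fderiv ℝ f y v + I • fderiv ℝ f y (I • v))

theorem pdel_add_pdelBar (f : V → F) (y v : V) : pdel f y v + pdelBar f y v = fderiv ℝ f y v := by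
  simp only [pdel, pdelBar]; module

theorem pdel_I_smul (f : V → F) (y v : V) : pdel f y (I • v) = I • pdel f y v := by
  simp only [pdel, smul_smul, I_mul_I, neg_smul, one_smul, map_neg, smul_sub, smul_neg]
  match_scalars
  all_goals ring_nf
  all_goals norm_num [I_sq]

theorem pdelBar_I_smul (f : V → F) (y v : V) : pdelBar f y (I • v) = -(I • pdelBar f y v) := by
  simp only [pdelBar, smul_smul, I_mul_I, neg_smul, one_smul, map_neg, smul_add, smul_neg]
  match_scalars
  all_goals ring_nf
  all_goals norm_num [I_sq]

theorem pdel_congr {f g : V → F} {y : V} (h : f =ᶠ[𝓝 y] g) (v : V) : pdel f y v = pdel g y v := by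
  simp only [pdel, h.fderiv_eq]

theorem pdelBar_congr {f g : V → F} {y : V} (h : f =ᶠ[𝓝 y] g) (v : V) :
    pdelBar f y v = pdelBar g y v := by
  simp only [pdelBar, h.fderiv_eq]

theorem pdel_add {f g : V → F} {y : V} (hf : DifferentiableAt ℝ f y) (hg : DifferentiableAt ℝ g y)
    (v : V) : pdel (fun y => f y + g y) y v = pdel f y v + pdel g y v := by
  simp only [pdel, fderiv_fun_add hf hg, add_apply]; module

theorem pdelBar_add {f g : V → F} {y : V} (hf : DifferentiableAt ℝ f y)
    (hg : DifferentiableAt ℝ g y) (v : V) :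
    pdelBar (fun y => f y + g y) y v = pdelBar f y v + pdelBar g y v := by
  simp only [pdelBar, fderiv_fun_add hf hg, add_apply]; module

theorem pdel_const_smul {f : V → F} {y : V} (hf : DifferentiableAt ℝ f y) (c : ℂ) (v : V) :
    pdel (fun y => c • f y) y v = c • pdel f y v := by
  simp only [pdel, fderiv_fun_const_smul hf c, smul_apply]; module

theorem pdelBar_const_smul {f : V → F} {y : V} (hf : DifferentiableAt ℝ f y) (c : ℂ) (v : V) :
    pdelBar (fun y => c • f y) y v = c • pdelBar f y v := by
  simp only [pdelBar, fderiv_fun_const_smul hf c, smul_apply]; module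

theorem pdel_clm_comp (L : F →L[ℂ] G) {f : V → F} {y : V} (hf : DifferentiableAt ℝ f y) (v : V) :
    pdel (fun y => L (f y)) y v = L (pdel f y v) := by
  have h : HasFDerivAt (fun y => L (f y)) ((L.restrictScalars ℝ).comp (fderiv ℝ f y)) y :=
    (L.restrictScalars ℝ).hasFDerivAt.comp y hf.hasFDerivAt
  simp [pdel, h.fderiv]

theorem pdelBar_clm_comp (L : F →L[ℂ] G) {f : V → F} {y : V} (hf : DifferentiableAt ℝ f y)
    (v : V) : pdelBar (fun y => L (f y)) y v = L (pdelBar f y v) := by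
  have h : HasFDerivAt (fun y => L (f y)) ((L.restrictScalars ℝ).comp (fderiv ℝ f y)) y :=
    (L.restrictScalars ℝ).hasFDerivAt.comp y hf.hasFDerivAt
  simp [pdelBar, h.fderiv]

/-- The operators are complex-linear but depend on `y` only real-differentiably, so scalars are
restricted before the product rule is applied. -/
theorem differentiableAt_clm_apply {L : V → F →L[ℂ] G} {g : V → F} {y : V}
    (hL : DifferentiableAt ℝ L y) (hg : DifferentiableAt ℝ g y) :
    DifferentiableAt ℝ (fun y => L y (g y)) y :=
  ((ContinuousLinearMap.restrictScalarsL ℂ F G ℝ ℝ).differentiableAt.comp y hL).clm_apply hg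

theorem contDiffAt_clm_apply {L : V → F →L[ℂ] G} {g : V → F} {y : V} {n : ℕ∞ω}
    (hL : ContDiffAt ℝ n L y) (hg : ContDiffAt ℝ n g y) :
    ContDiffAt ℝ n (fun y => L y (g y)) y :=
  ((ContinuousLinearMap.restrictScalarsL ℂ F G ℝ ℝ).contDiff.contDiffAt.comp y hL).clm_apply hg

theorem fderiv_clm_apply_complex {L : V → F →L[ℂ] G} {g : V → F} {y : V}
    (hL : DifferentiableAt ℝ L y) (hg : DifferentiableAt ℝ g y) (v : V) :
    fderiv ℝ (fun y => L y (g y)) y v = L y (fderiv ℝ g y v) + fderiv ℝ L y v (g y) := by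
  have h1 : HasFDerivAt (fun y => ContinuousLinearMap.restrictScalarsL ℂ F G ℝ ℝ (L y))
      ((ContinuousLinearMap.restrictScalarsL ℂ F G ℝ ℝ).comp (fderiv ℝ L y)) y :=
    (ContinuousLinearMap.restrictScalarsL ℂ F G ℝ ℝ).hasFDerivAt.comp y hL.hasFDerivAt
  have := (h1.clm_apply hg.hasFDerivAt).fderiv
  exact (DFunLike.congr_fun this v)

theorem pdel_clm_apply {L : V → F →L[ℂ] G} {g : V → F} {y : V}
    (hL : DifferentiableAt ℝ L y) (hg : DifferentiableAt ℝ g y) (v : V) :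
    pdel (fun y => L y (g y)) y v = L y (pdel g y v) + pdel L y v (g y) := by
  simp only [pdel, fderiv_clm_apply_complex hL hg, map_smul, map_sub, smul_apply, sub_apply]
  module

theorem pdelBar_clm_apply {L : V → F →L[ℂ] G} {g : V → F} {y : V}
    (hL : DifferentiableAt ℝ L y) (hg : DifferentiableAt ℝ g y) (v : V) :
    pdelBar (fun y => L y (g y)) y v = L y (pdelBar g y v) + pdelBar L y v (g y) := by
  simp only [pdelBar, fderiv_clm_apply_complex hL hg, map_smul, map_add, smul_apply, add_apply]
  module

theorem fderiv_real_eq {f : V → F} {y : V} (hf : DifferentiableAt ℂ f y) (v : V) :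
    fderiv ℝ f y v = fderiv ℂ f y v := by
  rw [hf.fderiv_restrictScalars ℝ]; rfl

theorem pdelBar_eq_zero {f : V → F} {y : V} (hf : DifferentiableAt ℂ f y) (v : V) :
    pdelBar f y v = 0 := by
  simp [pdelBar, fderiv_real_eq hf, smul_smul]

/-- The Cauchy–Riemann equations imply complex differentiability. -/
theorem differentiableAt_of_pdelBar_eq_zero {f : V → F} {y : V} (hf : DifferentiableAt ℝ f y)
    (h : ∀ v, pdelBar f y v = 0) : DifferentiableAt ℂ f y := by
  have hI : ∀ v, fderiv ℝ f y (I • v) = I • fderiv ℝ f y v := by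
    intro v
    have h1 := h v
    simp only [pdelBar, smul_eq_zero] at h1
    have h2 := congrArg (I • ·) (h1.resolve_left (by norm_num))
    simp only [smul_add, smul_smul, I_mul_I, smul_zero, neg_smul, one_smul] at h2
    exact (sub_eq_zero.1 (by rw [sub_eq_add_neg]; exact h2)).symm
  let D : V →L[ℂ] F :=
    { toFun := fderiv ℝ f y
      map_add' := map_add _
      map_smul' := fun c v => by
        conv_lhs => rw [← re_add_im c, add_smul, mul_smul, map_add]
        rw [RingHom.id_apply]
        conv_rhs => rw [← re_add_im c, add_smul, mul_smul]
        rw [coe_smul, coe_smul, coe_smul, coe_smul, map_smul, map_smul, hI]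
      cont := (fderiv ℝ f y).cont }
  have : HasFDerivAt f D y := by
    rw [hasFDerivAt_iff_isLittleO]
    exact (hasFDerivAt_iff_isLittleO (f' := fderiv ℝ f y)).1 hf.hasFDerivAt
  exact this.differentiableAt

/-- Conjugation exchanges `∂` and `∂̄`. For holomorphic `b` the first term drops out, which is why
the Chern connection does not depend on the holomorphic frame. -/
theorem pdel_conj_mul {b M : V → ℂ} {y : V} (hb : DifferentiableAt ℝ b y)
    (hM : DifferentiableAt ℝ M y) (v : V) :
    pdel (fun y => conj (b y) * M y) y v =
      conj (pdelBar b y v) * M y + conj (b y) * pdel M y v := by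
  have h1 : HasFDerivAt (fun y => conj (b y))
      ((conjCLE : ℂ →L[ℝ] ℂ).comp (fderiv ℝ b y)) y :=
    (conjCLE : ℂ →L[ℝ] ℂ).hasFDerivAt.comp y hb.hasFDerivAt
  have h := (h1.mul hM.hasFDerivAt).fderiv
  have h2 : ∀ v, fderiv ℝ (fun y => conj (b y) * M y) y v
      = conj (b y) * fderiv ℝ M y v + M y * conj (fderiv ℝ b y v) :=
    fun v => DFunLike.congr_fun h v
  simp only [pdel, pdelBar, h2, smul_eq_mul, map_mul, map_add, conj_I, map_div₀, map_one,
    map_ofNat]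
  ring

theorem pdel_finset_sum {ι : Type*} (s : Finset ι) {f : ι → V → F} {y : V}
    (hf : ∀ i ∈ s, DifferentiableAt ℝ (f i) y) (v : V) :
    pdel (fun y => ∑ i ∈ s, f i y) y v = ∑ i ∈ s, pdel (f i) y v := by
  simp [pdel, fderiv_fun_sum hf, Finset.smul_sum, Finset.sum_sub_distrib, smul_sub]

theorem pdelBar_finset_sum {ι : Type*} (s : Finset ι) {f : ι → V → F} {y : V}
    (hf : ∀ i ∈ s, DifferentiableAt ℝ (f i) y) (v : V) :
    pdelBar (fun y => ∑ i ∈ s, f i y) y v = ∑ i ∈ s, pdelBar (f i) y v := by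
  simp [pdelBar, fderiv_fun_sum hf, Finset.smul_sum, Finset.sum_add_distrib, smul_add]

theorem pdel_pi {ι : Type*} [Fintype ι] {f : V → ι → ℂ} {y : V} (hf : DifferentiableAt ℝ f y)
    (v : V) (i : ι) : pdel f y v i = pdel (fun y => f y i) y v :=
  (pdel_clm_comp (ContinuousLinearMap.proj (R := ℂ) (φ := fun _ : ι => ℂ) i) hf v).symm

/-- The `(1,0)`-part of the differential as a continuous real-linear map. -/
def pdelL (f : V → F) (y : V) : V →L[ℝ] F :=
  (1 / 2 : ℂ) • (fderiv ℝ f y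
    - I • (fderiv ℝ f y).comp ((I • ContinuousLinearMap.id ℂ V).restrictScalars ℝ))

theorem pdelL_apply (f : V → F) (y v : V) : pdelL f y v = pdel f y v := by
  simp [pdelL, pdel]

theorem contDiffAt_pdelL {f : V → F} {y : V} (hf : ContDiffAt ℝ ∞ f y) :
    ContDiffAt ℝ ∞ (pdelL f) y := by
  have h : ContDiffAt ℝ ∞ (fderiv ℝ f) y := hf.fderiv_right (by simp)
  have h2 : ContDiffAt ℝ ∞ (fun y => (fderiv ℝ f y).comp
      ((I • ContinuousLinearMap.id ℂ V).restrictScalars ℝ)) y :=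
    h.clm_comp contDiffAt_const
  exact (h.sub (h2.const_smul I)).const_smul (1 / 2 : ℂ)

theorem contDiffAt_pdel {f : V → F} {y : V} (hf : ContDiffAt ℝ ∞ f y) (v : V) :
    ContDiffAt ℝ ∞ (fun y => pdel f y v) y := by
  simp_rw [← pdelL_apply]
  exact (contDiffAt_pdelL hf).clm_apply contDiffAt_const

theorem contDiffAt_pdelBar {f : V → F} {y : V} (hf : ContDiffAt ℝ ∞ f y) (v : V) :
    ContDiffAt ℝ ∞ (fun y => pdelBar f y v) y := by
  have h : ContDiffAt ℝ ∞ (fderiv ℝ f) y := hf.fderiv_right (by simp)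
  exact ((h.clm_apply contDiffAt_const).add
    ((h.clm_apply contDiffAt_const).const_smul I)).const_smul (1 / 2 : ℂ)

/-- Second `(1,0)`-derivatives commute. -/
theorem pdel_pdel_comm {f : V → F} {y : V} (hf : ContDiffAt ℝ ∞ f y) (v w : V) :
    pdel (fun y => pdel f y w) y v = pdel (fun y => pdel f y v) y w := by
  have h : DifferentiableAt ℝ (fderiv ℝ f) y :=
    (hf.fderiv_right (m := ∞) (by simp)).differentiableAt (by simp)
  have hd : ∀ u, DifferentiableAt ℝ (fun y => fderiv ℝ f y u) y := fun u =>
    h.clm_apply (differentiableAt_const u)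
  have hs : ∀ a b, fderiv ℝ (fun y => fderiv ℝ f y a) y b = fderiv ℝ (fderiv ℝ f) y b a := by
    intro a b
    have := (h.hasFDerivAt.clm_apply (hasFDerivAt_const a y)).fderiv
    simpa using DFunLike.congr_fun this b
  have hsym : ∀ a b, fderiv ℝ (fderiv ℝ f) y a b = fderiv ℝ (fderiv ℝ f) y b a :=
    fun a b => (hf.isSymmSndFDerivAt (by
      simpa using WithTop.coe_le_coe.2 (le_top : (2 : ℕ∞) ≤ ⊤))).eq a b
  have key : ∀ a b, fderiv ℝ (fun y => pdel f y a) y b = (1 / 2 : ℂ) •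
      (fderiv ℝ (fderiv ℝ f) y b a - I • fderiv ℝ (fderiv ℝ f) y b (I • a)) := by
    intro a b
    have := (((hd a).hasFDerivAt.sub ((hd (I • a)).hasFDerivAt.const_smul I)).const_smul
      (1 / 2 : ℂ)).fderiv
    have h2 := DFunLike.congr_fun this b
    simp only [smul_apply, sub_apply, hs] at h2
    exact h2
  rw [pdel, pdel]
  simp only [key]
  rw [hsym v w, hsym (I • v) w, hsym v (I • w), hsym (I • v) (I • w)]
  module

end Wirtinger

/-! ### The form `L⁻¹ ∂L` and its parallel frames -/

section Parallel

variable {V : Type*} [NormedAddCommGroup V] [NormedSpace ℂ V]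
  {A : Type*} [NormedRing A] [NormedAlgebra ℂ A]

/-- The `(1, 0)`-form `L⁻¹ ∂ L`. -/
def logDel (L : V → A) (y : V) : V →L[ℝ] A :=
  (ContinuousLinearMap.mul ℝ A (Ring.inverse (L y))).comp (pdelL L y)

theorem logDel_apply (L : V → A) (y v : V) :
    logDel L y v = Ring.inverse (L y) * pdel L y v := by
  rw [← pdelL_apply]; rfl

variable [CompleteSpace A]

theorem contDiffAt_logDel {L : V → A} {y : V} (hL : ContDiffAt ℝ ∞ L y) (hu : IsUnit (L y)) :
    ContDiffAt ℝ ∞ (logDel L) y := by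
  obtain ⟨u, hu⟩ := hu
  have hi := contDiffAt_ringInverse (n := ∞) ℝ u
  rw [hu] at hi
  exact ((ContinuousLinearMap.mul ℝ A).contDiff.contDiffAt.comp _ (hi.comp _ hL)).clm_comp
    (contDiffAt_pdelL hL)

/-- A uniform bound near `y₀`, the constant for the Grönwall argument that makes parallel sections
unique. -/
theorem exists_bound_logDel {L : V → A} {y₀ : V} (hL : ContDiffAt ℝ ∞ L y₀)
    (hu : IsUnit (L y₀)) :
    ∃ c : ℝ, ∀ᶠ y in 𝓝 y₀, ∀ v, ‖Ring.inverse (L y) * pdel L y v‖ ≤ c * ‖v‖ := by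
  refine ⟨‖logDel L y₀‖ + 1, ?_⟩
  have := (contDiffAt_logDel hL hu).continuousAt.norm.eventually_lt continuousAt_const
    (lt_add_one _)
  filter_upwards [this] with y hy v
  rw [← logDel_apply]
  exact (ContinuousLinearMap.le_opNorm _ _).trans (by gcongr)

theorem pdel_eq_fderiv_of_pdelBar_eq_zero {F : Type*} [NormedAddCommGroup F] [NormedSpace ℂ F]
    {f : V → F} {y v : V} (h : pdelBar f y v = 0) : pdel f y v = fderiv ℝ f y v := by
  rw [← pdel_add_pdelBar, h, add_zero]

theorem fderiv_mul_apply {f g : V → A} {y : V} (hf : DifferentiableAt ℝ f y)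
    (hg : DifferentiableAt ℝ g y) (v : V) :
    fderiv ℝ (fun y => f y * g y) y v = f y * fderiv ℝ g y v + fderiv ℝ f y v * g y := by
  have := (hf.hasFDerivAt.mul' hg.hasFDerivAt).fderiv
  exact DFunLike.congr_fun this v

theorem pdel_mul {f g : V → A} {y : V} (hf : DifferentiableAt ℝ f y)
    (hg : DifferentiableAt ℝ g y) (v : V) :
    pdel (fun y => f y * g y) y v = f y * pdel g y v + pdel f y v * g y := by
  simp only [pdel, fderiv_mul_apply hf hg, mul_smul_comm, smul_mul_assoc, mul_sub, sub_mul]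
  module

/-- Solutions of `dF = Θ F` are as smooth as `Θ`. -/
theorem contDiffOn_of_hasFDerivAt {Θ : V → V →L[ℝ] A} {F : V → A} {s : Set V} (hs : IsOpen s)
    (hΘ : ∀ y ∈ s, ContDiffAt ℝ ∞ Θ y)
    (hF : ∀ y ∈ s, HasFDerivAt F (((ContinuousLinearMap.mul ℝ A).flip (F y)).comp (Θ y)) y) :
    ContDiffOn ℝ ∞ F s := by
  have hΘ' : ContDiffOn ℝ ∞ Θ s := fun y hy => (hΘ y hy).contDiffWithinAt
  have : ∀ n : ℕ, ContDiffOn ℝ n F s := by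
    intro n
    -- Bootstrapping: the derivative of `F` is bilinear in `F` and `Θ`, so each order of smoothness
    -- of `F` yields the next.
    induction n with
    | zero =>
      rw [Nat.cast_zero, contDiffOn_zero]
      exact fun y hy => (hF y hy).continuousAt.continuousWithinAt
    | succ n ih =>
      rw [Nat.cast_succ, contDiffOn_succ_iff_fderiv_of_isOpen hs]
      refine ⟨fun y hy => (hF y hy).differentiableAt.differentiableWithinAt, by simp, ?_⟩
      have h1 : ContDiffOn ℝ n
          (fun y => ((ContinuousLinearMap.mul ℝ A).flip (F y)).comp (Θ y)) s :=
        ((ContinuousLinearMap.mul ℝ A).flip.contDiff.comp_contDiffOn ih).clm_comp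
          (hΘ'.of_le (by exact_mod_cast le_top))
      exact h1.congr fun y hy => (hF y hy).fderiv
  exact contDiffOn_infty.2 this

/-- If `L⁻¹ ∂ L` is holomorphic, then the connection `d + L⁻¹ ∂ L` has a local parallel frame. -/
theorem exists_frame_of_logDel {L : V → A} {y₀ : V}
    (hL : ∀ᶠ y in 𝓝 y₀, ContDiffAt ℝ ∞ L y) (hu : ∀ᶠ y in 𝓝 y₀, IsUnit (L y))
    (hhol : ∀ᶠ y in 𝓝 y₀, ∀ v w, pdelBar (fun y => Ring.inverse (L y) * pdel L y w) y v = 0) :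
    ∃ F : V → A, F y₀ = 1 ∧ ∀ᶠ y in 𝓝 y₀, ContDiffAt ℝ ∞ F y ∧ IsUnit (F y) ∧
      ∀ v, fderiv ℝ F y v = -(Ring.inverse (L y) * pdel L y v * F y) := by
  have hθ : ∀ᶠ y in 𝓝 y₀, ContDiffAt ℝ ∞ (logDel L) y := by
    filter_upwards [hL, hu] with y h1 h2 using contDiffAt_logDel h1 h2
  -- Write `θ` for `logDel L`. Holomorphy gives `dθ = ∂θ`, and `∂θ = -θ ∧ θ` holds for any `L`
  -- because second `∂`-derivatives of `L` commute.
  have hflat : ∀ᶠ y in 𝓝 y₀, ∀ v w : V, fderiv ℝ (fun y => -logDel L y) y v w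
      - fderiv ℝ (fun y => -logDel L y) y w v =
      (-logDel L y) v * (-logDel L y) w - (-logDel L y) w * (-logDel L y) v := by
    filter_upwards [hL, hu, hθ, hhol, hu.eventually_nhds] with y h1 h2 h3 h4 h5 v w
    have hd : ∀ v w, fderiv ℝ (fun y => -logDel L y) y v w =
        -pdel (fun y => Ring.inverse (L y) * pdel L y w) y v := by
      intro v w
      rw [pdel_eq_fderiv_of_pdelBar_eq_zero (h4 v w), fderiv_fun_neg]
      simp_rw [← logDel_apply]
      have := ((h3.differentiableAt (by simp)).hasFDerivAt.clm_apply (hasFDerivAt_const w y)).fderiv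
      rw [this]
      simp
    have hiv : ∀ w, DifferentiableAt ℝ (fun y => Ring.inverse (L y) * pdel L y w) y := by
      intro w
      simp_rw [← logDel_apply]
      exact (h3.differentiableAt (by simp)).clm_apply (differentiableAt_const w)
    -- Differentiating the product `∂_w L = L θ_w` avoids differentiating the inverse of `L`.
    have key : ∀ v w, pdel (fun y => pdel L y w) y v =
        L y * pdel (fun y => Ring.inverse (L y) * pdel L y w) y v
          + pdel L y v * (Ring.inverse (L y) * pdel L y w) := by
      intro v w
      rw [← pdel_mul (h1.differentiableAt (by simp)) (hiv w)]
      refine pdel_congr ?_ v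
      filter_upwards [h5] with z hz
      rw [← mul_assoc, Ring.mul_inverse_cancel _ hz, one_mul]
    have key2 : ∀ v w, pdel (fun y => Ring.inverse (L y) * pdel L y w) y v =
        Ring.inverse (L y) * pdel (fun y => pdel L y w) y v - logDel L y v * logDel L y w := by
      intro v w
      rw [key, mul_add, ← mul_assoc, Ring.inverse_mul_cancel _ h2, one_mul, logDel_apply,
        logDel_apply, ← mul_assoc (Ring.inverse (L y)) (pdel L y v), add_sub_cancel_right]
    rw [hd, hd, key2 v w, key2 w v, pdel_pdel_comm h1 v w]
    simp only [neg_apply, neg_mul_neg]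
    abel
  obtain ⟨F, hF0, hF⟩ := exists_parallel_frame (Θ := fun y => -logDel L y) (y₀ := y₀)
    (hθ.self_of_nhds.neg.of_le
      (by simpa using WithTop.coe_le_coe.2 (le_top : (2 : ℕ∞) ≤ ⊤))) hflat
  refine ⟨F, hF0, ?_⟩
  have hFu : ∀ᶠ y in 𝓝 y₀, IsUnit (F y) :=
    hF.self_of_nhds.continuousAt.eventually_mem
      (Units.isOpen.mem_nhds (by rw [hF0]; exact isUnit_one))
  obtain ⟨ρ, hρ, hball⟩ := Metric.eventually_nhds_iff_ball.1 (hθ.and hF)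
  have hsm := contDiffOn_of_hasFDerivAt Metric.isOpen_ball (fun y hy => (hball y hy).1.neg)
    (fun y hy => (hball y hy).2)
  filter_upwards [Metric.ball_mem_nhds y₀ hρ, hFu] with y hy hy'
  refine ⟨hsm.contDiffAt (Metric.isOpen_ball.mem_nhds hy), hy', fun v => ?_⟩
  rw [(hball y hy).2.fderiv]
  simp [logDel_apply]

end Parallel

/-! ### Sections and `∂̄` in a fixed trivialization -/

section Coordinates

variable {EM : Type*} [NormedAddCommGroup EM] [NormedSpace ℂ EM]
  {M : Type*} [TopologicalSpace M] [ChartedSpace EM M] {r : ℕ}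
  {E : M → Type*} [∀ x, AddCommGroup (E x)] [∀ x, Module ℂ (E x)]
  [TopologicalSpace (TotalSpace (Fin r → ℂ) E)] [∀ x, TopologicalSpace (E x)]
  [FiberBundle (Fin r → ℂ) E]

variable (EM E) in
/-- The domain of the preferred chart at `q` on which `E` is trivialized. -/
def dom (r : ℕ) [TopologicalSpace (TotalSpace (Fin r → ℂ) E)] [FiberBundle (Fin r → ℂ) E]
    (q : M) : Set M :=
  (chartAt EM q).source ∩ (trivializationAt (Fin r → ℂ) E q).baseSet

omit [∀ x, AddCommGroup (E x)] [∀ x, Module ℂ (E x)] in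
variable (EM E) in
theorem isOpen_dom (q : M) : IsOpen (dom EM E r q) :=
  (chartAt EM q).open_source.inter (trivializationAt (Fin r → ℂ) E q).open_baseSet

omit [∀ x, AddCommGroup (E x)] [∀ x, Module ℂ (E x)] in
variable (EM E) in
theorem mem_dom (q : M) : q ∈ dom EM E r q :=
  ⟨mem_chart_source EM q, FiberBundle.mem_baseSet_trivializationAt' q⟩

/-- The coordinates of a section in the preferred trivialization at `q`. -/
def coord (r : ℕ) [TopologicalSpace (TotalSpace (Fin r → ℂ) E)]
    [FiberBundle (Fin r → ℂ) E] (q : M) (s : ∀ x, E x) (x : M) : Fin r → ℂ :=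
  (trivializationAt (Fin r → ℂ) E q ⟨x, s x⟩).2

variable (EM) in
/-- The coordinates of a section, as a function on the chart at `q`. -/
def loc (r : ℕ) [TopologicalSpace (TotalSpace (Fin r → ℂ) E)]
    [FiberBundle (Fin r → ℂ) E] (q : M) (s : ∀ x, E x) (y : EM) : Fin r → ℂ :=
  coord r q s ((chartAt EM q).symm y)

omit [∀ x, AddCommGroup (E x)] [∀ x, Module ℂ (E x)] in
variable (EM) in
theorem loc_chart {q x : M} (hx : x ∈ (chartAt EM q).source) (s : ∀ x, E x) :
    loc EM r q s (chartAt EM q x) = coord r q s x := by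
  rw [loc, (chartAt EM q).left_inv hx]

omit [∀ x, AddCommGroup (E x)] [∀ x, Module ℂ (E x)] in
theorem eventually_chart_symm_mem {q x : M} (hx : x ∈ (chartAt EM q).source) {S : Set M}
    (hS : S ∈ 𝓝 x) : ∀ᶠ y in 𝓝 (chartAt EM q x), (chartAt EM q).symm y ∈ S := by
  have hc : ContinuousAt (chartAt EM q).symm (chartAt EM q x) :=
    (chartAt EM q).continuousAt_symm ((chartAt EM q).map_source hx)
  exact hc.eventually_mem (by rwa [(chartAt EM q).left_inv hx])

variable [VectorBundle ℂ (Fin r → ℂ) E]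

/-- The vector of `E x` with given coordinates in the preferred trivialization at `q`. -/
def vec (r : ℕ) [TopologicalSpace (TotalSpace (Fin r → ℂ) E)] [FiberBundle (Fin r → ℂ) E]
    [VectorBundle ℂ (Fin r → ℂ) E] (q x : M) : (Fin r → ℂ) →ₗ[ℂ] E x :=
  (trivializationAt (Fin r → ℂ) E q).symmₗ ℂ x

theorem vec_apply {q x : M} (hx : x ∈ (trivializationAt (Fin r → ℂ) E q).baseSet) (k : Fin r → ℂ) :
    vec (E := E) r q x k = (trivializationAt (Fin r → ℂ) E q).symm x k := by
  rw [vec, Trivialization.symmₗ_apply _ hx]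

theorem vec_coord {q x : M} (hx : x ∈ (trivializationAt (Fin r → ℂ) E q).baseSet) (s : ∀ x, E x) :
    vec (E := E) r q x (coord r q s x) = s x := by
  rw [vec_apply hx, coord]
  exact Trivialization.symm_apply_apply_mk _ hx _

theorem coord_vec {q x : M} (hx : x ∈ (trivializationAt (Fin r → ℂ) E q).baseSet)
    {s : ∀ x, E x} {k : Fin r → ℂ} (hs : s x = vec r q x k) : coord r q s x = k := by
  rw [coord, hs, vec_apply hx, Trivialization.apply_mk_symm _ hx]

theorem vec_injective {q x : M} (hx : x ∈ (trivializationAt (Fin r → ℂ) E q).baseSet) :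
    Function.Injective (vec (E := E) r q x) := by
  intro a b hab
  have ha := coord_vec (s := fun x' => vec (E := E) r q x' a) hx rfl
  have hb := coord_vec (s := fun x' => vec (E := E) r q x' a) hx hab
  exact ha.symm.trans hb

theorem vec_surjective {q x : M} (hx : x ∈ (trivializationAt (Fin r → ℂ) E q).baseSet) :
    Function.Surjective (vec (E := E) r q x) := by
  intro a
  refine ⟨(trivializationAt (Fin r → ℂ) E q ⟨x, a⟩).2, ?_⟩
  rw [vec_apply hx]
  exact Trivialization.symm_apply_apply_mk _ hx _

theorem stdFrame_eq {q x : M} (hx : x ∈ (trivializationAt (Fin r → ℂ) E q).baseSet) (i : Fin r) :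
    stdFrame (E := E) r q i x = vec r q x (Pi.single i 1) :=
  (vec_apply hx _).symm

theorem vec_eq_sum {q x : M} (hx : x ∈ (trivializationAt (Fin r → ℂ) E q).baseSet)
    (k : Fin r → ℂ) : vec (E := E) r q x k = ∑ i, k i • stdFrame r q i x := by
  simp_rw [stdFrame_eq hx, ← map_smul, ← map_sum]
  congr 1
  ext j
  simp [Finset.sum_apply, Pi.single_apply]

theorem coord_linear {q x : M} (hx : x ∈ (trivializationAt (Fin r → ℂ) E q).baseSet)
    {ι : Type*} (I : Finset ι) (f : ι → ℂ) (s : ι → ∀ x, E x) :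
    coord r q (fun x => ∑ i ∈ I, f i • s i x) x = ∑ i ∈ I, f i • coord r q (s i) x := by
  refine coord_vec hx ?_
  simp [vec_coord hx]

/-- The coordinate change from the trivialization at `q` to the one at `q'`. -/
def trans (r : ℕ) (E : M → Type*) [∀ x, AddCommGroup (E x)] [∀ x, Module ℂ (E x)]
    [TopologicalSpace (TotalSpace (Fin r → ℂ) E)] [∀ x, TopologicalSpace (E x)]
    [FiberBundle (Fin r → ℂ) E] [VectorBundle ℂ (Fin r → ℂ) E] (q q' x : M) :
    (Fin r → ℂ) →L[ℂ] (Fin r → ℂ) :=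
  (trivializationAt (Fin r → ℂ) E q).coordChangeL ℂ (trivializationAt (Fin r → ℂ) E q') x

theorem trans_coord {q q' x : M} (hx : x ∈ (trivializationAt (Fin r → ℂ) E q).baseSet)
    (hx' : x ∈ (trivializationAt (Fin r → ℂ) E q').baseSet) (s : ∀ x, E x) :
    trans r E q q' x (coord r q s x) = coord r q' s x := by
  rw [trans, ContinuousLinearEquiv.coe_coe, Trivialization.coordChangeL_apply _ _ ⟨hx, hx'⟩,
    ← vec_apply hx, vec_coord hx]
  rfl

theorem vec_trans {q q' x : M} (hx : x ∈ (trivializationAt (Fin r → ℂ) E q).baseSet)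
    (hx' : x ∈ (trivializationAt (Fin r → ℂ) E q').baseSet) (k : Fin r → ℂ) :
    vec (E := E) r q' x (trans r E q q' x k) = vec r q x k := by
  have h := trans_coord hx hx' fun x => vec (E := E) r q x k
  rw [coord_vec hx rfl] at h
  rw [h, vec_coord hx']

variable [IsManifold 𝓘(ℂ, EM) ω M] [ContMDiffVectorBundle ω (Fin r → ℂ) E 𝓘(ℂ, EM)]

theorem contDiffAt_trans {p q q' x : M} (hp : x ∈ (chartAt EM p).source)
    (hx : x ∈ (trivializationAt (Fin r → ℂ) E q).baseSet)
    (hx' : x ∈ (trivializationAt (Fin r → ℂ) E q').baseSet) :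
    ContDiffAt ℂ ω (fun y => trans r E q q' ((chartAt EM p).symm y)) (chartAt EM p x) :=
  (contMDiffAt_complex_iff hp).1 (contMDiffAt_coordChangeL (IB := 𝓘(ℂ, EM)) (n := ω) hx hx')

theorem coord_eventuallyEq {p q q' x : M} (hp : x ∈ (chartAt EM p).source)
    (hx : x ∈ (trivializationAt (Fin r → ℂ) E q).baseSet)
    (hx' : x ∈ (trivializationAt (Fin r → ℂ) E q').baseSet) (s : ∀ x, E x) :
    (coord r q' s ∘ (chartAt EM p).symm) =ᶠ[𝓝 (chartAt EM p x)]
      fun y => trans r E q q' ((chartAt EM p).symm y) (coord r q s ((chartAt EM p).symm y)) := by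
  filter_upwards [eventually_chart_symm_mem hp
    ((trivializationAt (Fin r → ℂ) E q).open_baseSet.mem_nhds hx),
    eventually_chart_symm_mem hp
    ((trivializationAt (Fin r → ℂ) E q').open_baseSet.mem_nhds hx')] with y h1 h2
  exact (trans_coord h1 h2 s).symm

/-- Smoothness at `x` is tested in the trivialization at `x`; passing to the one at `q` multiplies
coordinates by a holomorphic, hence smooth, matrix in either direction. -/
theorem smoothAt_iff {q x : M} (hx : x ∈ dom EM E r q) (s : ∀ x, E x) :
    SmoothAt (Fin r → ℂ) EM s x ↔ ContDiffAt ℝ ∞ (loc EM r q s) (chartAt EM q x) := by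
  rw [SmoothAt, contMDiffAt_section, contMDiffAt_real_iff hx.1]
  have h0 := FiberBundle.mem_baseSet_trivializationAt' (F := Fin r → ℂ) (E := E) x
  constructor
  · intro h
    refine ContDiffAt.congr_of_eventuallyEq ?_ (coord_eventuallyEq hx.1 h0 hx.2 s)
    exact contDiffAt_clm_apply (((contDiffAt_trans hx.1 h0 hx.2).of_le le_top).restrict_scalars ℝ) h
  · intro h
    refine ContDiffAt.congr_of_eventuallyEq ?_ (coord_eventuallyEq hx.1 hx.2 h0 s)
    exact contDiffAt_clm_apply (((contDiffAt_trans hx.1 hx.2 h0).of_le le_top).restrict_scalars ℝ) h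

theorem mdifferentiableAt_section_iff_loc {q x : M} (hx : x ∈ dom EM E r q) (s : ∀ x, E x) :
    MDifferentiableAt 𝓘(ℂ, EM) (𝓘(ℂ, EM).prod 𝓘(ℂ, Fin r → ℂ))
      (fun x => TotalSpace.mk' (Fin r → ℂ) x (s x)) x ↔
      DifferentiableAt ℂ (loc EM r q s) (chartAt EM q x) := by
  have : ContMDiffVectorBundle 1 (Fin r → ℂ) E 𝓘(ℂ, EM) := .of_le (n := ω) le_top
  rw [Trivialization.mdifferentiableAt_section_iff 𝓘(ℂ, EM)
    (trivializationAt (Fin r → ℂ) E q) s hx.2, mdifferentiableAt_complex_iff hx.1]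
  rfl

/-- Independence of the trivialization: the transition matrix is holomorphic, so `∂̄` passes through
it. -/
theorem dbar_constField {q x : M} (hx : x ∈ dom EM E r q) {s : ∀ x, E x}
    (hs : DifferentiableAt ℝ (loc EM r q s) (chartAt EM q x)) (v : EM) :
    dbar r s x (constField q v x) = vec r q x (pdelBar (loc EM r q s) (chartAt EM q x) v) := by
  have h0 := FiberBundle.mem_baseSet_trivializationAt' (F := Fin r → ℂ) (E := E) x
  have hT : DifferentiableAt ℂ (fun y => trans r E q x ((chartAt EM q).symm y)) (chartAt EM q x) :=
    (contDiffAt_trans hx.1 hx.2 h0).differentiableAt (by simp)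
  have hE := coord_eventuallyEq hx.1 hx.2 h0 s
  have hd : DifferentiableAt ℝ (coord r x s ∘ (chartAt EM q).symm) (chartAt EM q x) :=
    (differentiableAt_clm_apply (hT.restrictScalars ℝ) hs).congr_of_eventuallyEq hE
  have h1 : delBar (coord r x s) x (constField q v x) =
      pdelBar (coord r x s ∘ (chartAt EM q).symm) (chartAt EM q x) v := by
    rw [delBar, ← constField_smul hx.1, realDiff_constField hx.1 hd, realDiff_constField hx.1 hd]
    rfl
  have h2 : pdelBar (coord r x s ∘ (chartAt EM q).symm) (chartAt EM q x) v =
      trans r E q x x (pdelBar (loc EM r q s) (chartAt EM q x) v) := by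
    rw [pdelBar_congr hE]
    have := pdelBar_clm_apply (hT.restrictScalars ℝ) hs v
    rw [pdelBar_eq_zero hT, (chartAt EM q).left_inv hx.1, zero_apply, add_zero] at this
    exact this
  rw [← vec_trans hx.2 h0, ← h2, ← h1, vec_apply h0]
  rfl

theorem del_constField {F : Type*} [NormedAddCommGroup F] [NormedSpace ℂ F] {f : M → F}
    {q x : M} (hx : x ∈ (chartAt EM q).source)
    (hf : DifferentiableAt ℝ (f ∘ (chartAt EM q).symm) (chartAt EM q x))
    (v : EM) :
    del f x (constField q v x) = pdel (f ∘ (chartAt EM q).symm) (chartAt EM q x) v := by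
  rw [del, ← constField_smul hx, realDiff_constField hx hf, realDiff_constField hx hf]
  rfl

end Coordinates

/-! ### The Gram operator and the Chern connection in coordinates -/

section Metric

variable {EM : Type*} [NormedAddCommGroup EM] [NormedSpace ℂ EM]
  {M : Type*} [TopologicalSpace M] [ChartedSpace EM M] {r : ℕ}
  {E : M → Type*} [∀ x, AddCommGroup (E x)] [∀ x, Module ℂ (E x)]
  [TopologicalSpace (TotalSpace (Fin r → ℂ) E)] [∀ x, TopologicalSpace (E x)]
  [FiberBundle (Fin r → ℂ) E]

namespace HermitianMetric

variable (h : HermitianMetric EM r E)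

/-- The Gram matrix of `h` at `x` in the frame `stdFrame r q`. -/
def frameGram (q x : M) : Matrix (Fin r) (Fin r) ℂ :=
  Matrix.of fun i j => h.form x (stdFrame r q i x) (stdFrame r q j x)

theorem frameGram_self (q : M) : h.frameGram q q = h.gram q := rfl

/-- The operator of the Gram matrix, as a function on the chart at `q`. -/
def gramL (q : M) (y : EM) : (Fin r → ℂ) →L[ℂ] (Fin r → ℂ) :=
  LinearMap.toContinuousLinearMap (Matrix.toLin' (h.frameGram q ((chartAt EM q).symm y)))

variable [VectorBundle ℂ (Fin r → ℂ) E]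

theorem frameGram_mulVec {q x : M} (hx : x ∈ (trivializationAt (Fin r → ℂ) E q).baseSet)
    (k : Fin r → ℂ) (j : Fin r) :
    (h.frameGram q x *ᵥ k) j = h.form x (stdFrame r q j x) (vec r q x k) := by
  simp [frameGram, Matrix.mulVec, dotProduct, vec_eq_sum hx, mul_comm]

theorem form_vec {q x : M} (hx : x ∈ (trivializationAt (Fin r → ℂ) E q).baseSet)
    (k : Fin r → ℂ) (b : E x) :
    h.form x (vec r q x k) b = ∑ j, conj (k j) * h.form x (stdFrame r q j x) b := by
  simp [vec_eq_sum hx]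

/-- A vector is determined by its products with a frame. -/
theorem ext_stdFrame {q x : M} (hx : x ∈ (trivializationAt (Fin r → ℂ) E q).baseSet)
    {a b : E x} (hab : ∀ j, h.form x (stdFrame r q j x) a = h.form x (stdFrame r q j x) b) :
    a = b := by
  rw [← sub_eq_zero]
  by_contra h0
  have := h.pos x _ h0
  obtain ⟨k, hk⟩ := vec_surjective hx (a - b)
  have h1 : h.form x (a - b) (a - b) = 0 := by
    conv_lhs => rw [← hk, h.form_vec hx, hk]
    simp [hab]
  rw [h1] at this
  simp at this

/-- Positivity gives injectivity, through `ext_stdFrame`; for a square matrix this is invertibility.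
-/
theorem isUnit_frameGram {q x : M} (hx : x ∈ (trivializationAt (Fin r → ℂ) E q).baseSet) :
    IsUnit (h.frameGram q x) := by
  rw [← Matrix.mulVec_injective_iff_isUnit]
  intro a b hab
  refine vec_injective hx (h.ext_stdFrame hx fun j => ?_)
  rw [← h.frameGram_mulVec hx, ← h.frameGram_mulVec hx, hab]

theorem form_dualVec (q : M) (c : Fin r → ℂ) (j : Fin r) :
    h.form q (stdFrame r q j q) (h.dualVec q c) = c j := by
  have h0 := FiberBundle.mem_baseSet_trivializationAt' (F := Fin r → ℂ) (E := E) q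
  have hu := h.isUnit_frameGram h0
  rw [frameGram_self, Matrix.isUnit_iff_isUnit_det] at hu
  rw [dualVec, ← vec_eq_sum h0, ← h.frameGram_mulVec h0, frameGram_self, Matrix.mulVec_mulVec,
    Matrix.mul_nonsing_inv _ hu, Matrix.one_mulVec]

/-- The identity holds on frame vectors by construction of the dual vector, and both sides are
conjugate-linear in `a`. Hence `adj` is the true adjoint, independent of the frame used to define
it. -/
theorem form_adj {q : M} (A : Module.End ℂ (E q)) (a b : E q) :
    h.form q a (h.adj A b) = h.form q (A a) b := by
  have h0 := FiberBundle.mem_baseSet_trivializationAt' (F := Fin r → ℂ) (E := E) q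
  obtain ⟨k, rfl⟩ := vec_surjective h0 a
  rw [vec_eq_sum h0]
  simp only [map_sum, map_smul, LinearMap.map_smulₛₗ, LinearMap.sum_apply, LinearMap.smul_apply]
  refine Finset.sum_congr rfl fun j _ => ?_
  congr 1
  exact h.form_dualVec q _ j

theorem isUnit_gramL {q : M} {y : EM}
    (hy : (chartAt EM q).symm y ∈ (trivializationAt (Fin r → ℂ) E q).baseSet) :
    IsUnit (h.gramL q y) := by
  have hu := h.isUnit_frameGram hy
  rw [ContinuousLinearMap.isUnit_iff_bijective]
  exact ⟨Matrix.mulVec_injective_iff_isUnit.2 hu, Matrix.mulVec_surjective_iff_isUnit.2 hu⟩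

theorem gramL_apply {q : M} {y : EM}
    (hy : (chartAt EM q).symm y ∈ (trivializationAt (Fin r → ℂ) E q).baseSet)
    (k : Fin r → ℂ) (j : Fin r) :
    h.gramL q y k j = h.form _ (stdFrame r q j ((chartAt EM q).symm y)) (vec r q _ k) := by
  rw [← h.frameGram_mulVec hy]
  rfl

end HermitianMetric

variable [VectorBundle ℂ (Fin r → ℂ) E]
variable [IsManifold 𝓘(ℂ, EM) ω M] [ContMDiffVectorBundle ω (Fin r → ℂ) E 𝓘(ℂ, EM)]

theorem loc_vec_eventuallyEq {q x : M} (hx : x ∈ dom EM E r q) (g : EM → Fin r → ℂ) :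
    loc EM r q (fun x => vec (E := E) r q x (g (chartAt EM q x))) =ᶠ[𝓝 (chartAt EM q x)] g := by
  filter_upwards [eventually_chart_symm_mem hx.1 ((isOpen_dom EM E q).mem_nhds hx),
    (chartAt EM q).open_target.mem_nhds ((chartAt EM q).map_source hx.1)] with y hy hy'
  rw [loc, coord_vec hy.2 rfl, (chartAt EM q).right_inv hy']

theorem smoothAt_vec {q x : M} (hx : x ∈ dom EM E r q) {g : EM → Fin r → ℂ}
    (hg : ContDiffAt ℝ ∞ g (chartAt EM q x)) :
    SmoothAt (Fin r → ℂ) EM (fun x => vec (E := E) r q x (g (chartAt EM q x))) x :=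
  (smoothAt_iff hx _).2 (hg.congr_of_eventuallyEq (loc_vec_eventuallyEq hx g))

theorem smoothAt_congr {s s' : ∀ x, E x} {x : M} (h : ∀ᶠ x' in 𝓝 x, s x' = s' x') :
    SmoothAt (Fin r → ℂ) EM s x ↔ SmoothAt (Fin r → ℂ) EM s' x := by
  refine Filter.EventuallyEq.contMDiffAt_iff ?_
  filter_upwards [h] with x' hx'
  rw [hx']

theorem loc_congr {q x : M} (hx : x ∈ (chartAt EM q).source) {s s' : ∀ x, E x}
    (h : ∀ᶠ x' in 𝓝 x, s x' = s' x') : loc EM r q s =ᶠ[𝓝 (chartAt EM q x)] loc EM r q s' := by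
  filter_upwards [eventually_chart_symm_mem hx h] with y (hy : s _ = s' _)
  rw [loc, loc, coord, coord, hy]

theorem smoothAt_stdFrame {q x : M} (hx : x ∈ dom EM E r q) (i : Fin r) :
    SmoothAt (Fin r → ℂ) EM (stdFrame (E := E) r q i) x := by
  rw [smoothAt_congr (s' := fun x => vec (E := E) r q x (Pi.single i 1))]
  · exact smoothAt_vec hx (g := fun _ => Pi.single i 1) contDiffAt_const
  · filter_upwards [(isOpen_dom EM E q).mem_nhds hx] with x' hx' using stdFrame_eq hx'.2 i

/-- Every vector is the value of a smooth section. -/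
theorem exists_smoothAt_eq (q : M) (a : E q) :
    ∃ s : ∀ x, E x, SmoothAt (Fin r → ℂ) EM s q ∧ s q = a := by
  obtain ⟨k, hk⟩ := vec_surjective (mem_dom (r := r) EM E q).2 a
  exact ⟨fun x => vec r q x k, smoothAt_vec (mem_dom (r := r) EM E q) (g := fun _ => k)
    contDiffAt_const, hk⟩

namespace HermitianMetric

variable (h : HermitianMetric EM r E)

theorem contDiffAt_gramL {q x : M} (hx : x ∈ dom EM E r q) :
    ContDiffAt ℝ ∞ (h.gramL q) (chartAt EM q x) := by
  -- `T` assembles the operator linearly from the matrix entries, so smoothness reduces to the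
  -- entries, which are products of smooth frame sections.
  let T : (Fin r → Fin r → ℂ) →ₗ[ℂ] ((Fin r → ℂ) →L[ℂ] (Fin r → ℂ)) :=
    (LinearMap.toContinuousLinearMap.toLinearMap).comp
      ((Matrix.toLin' (R := ℂ) (m := Fin r) (n := Fin r)).toLinearMap.comp
        (Matrix.ofLinearEquiv ℂ).toLinearMap)
  have hT : h.gramL q = fun y => LinearMap.toContinuousLinearMap T
      fun i j => h.form _ (stdFrame r q i ((chartAt EM q).symm y)) (stdFrame r q j _) := rfl
  rw [hT]
  refine ((LinearMap.toContinuousLinearMap T).restrictScalars ℝ).contDiff.contDiffAt.comp _ ?_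
  refine contDiffAt_pi.2 fun i => contDiffAt_pi.2 fun j => ?_
  exact (contMDiffAt_real_iff hx.1).1
    (h.smooth x _ _ (smoothAt_stdFrame hx i) (smoothAt_stdFrame hx j))

/-- The operator `D'_v = L⁻¹ ∂_v L` in coordinates. -/
def locD (q : M) (g : EM → Fin r → ℂ) (y v : EM) : Fin r → ℂ :=
  Ring.inverse (h.gramL q y) (pdel (fun y => h.gramL q y (g y)) y v)

/-- The definition at `x` uses the frame at `x`, whose coefficients in the frame at `q` are
holomorphic. In the conjugate-linear slot they become antiholomorphic, so `∂` passes through them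
and the formula `L⁻¹ ∂ L` holds in the fixed frame. -/
theorem chernD_constField {q x : M} (hx : x ∈ dom EM E r q) {s : ∀ x, E x}
    (hs : DifferentiableAt ℝ (loc EM r q s) (chartAt EM q x)) (v : EM) :
    h.chernD s x (constField q v x) =
      vec r q x (h.locD q (loc EM r q s) (chartAt EM q x) v) := by
  have h0 := FiberBundle.mem_baseSet_trivializationAt' (F := Fin r → ℂ) (E := E) x
  have hL : DifferentiableAt ℝ (h.gramL q) (chartAt EM q x) :=
    (h.contDiffAt_gramL hx).differentiableAt (by simp)
  have hM := differentiableAt_clm_apply hL hs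
  have hMj : ∀ j, DifferentiableAt ℝ (fun y => h.gramL q y (loc EM r q s y) j) (chartAt EM q x) :=
    fun j => differentiableAt_pi.1 hM j
  have hT : DifferentiableAt ℂ (fun y => trans r E x q ((chartAt EM q).symm y)) (chartAt EM q x) :=
    (contDiffAt_trans hx.1 h0 hx.2).differentiableAt (by simp)
  refine h.ext_stdFrame h0 fun k => ?_
  rw [chernD, form_dualVec]
  have hb : ∀ j, DifferentiableAt ℂ
      (fun y => trans r E x q ((chartAt EM q).symm y) (Pi.single k 1) j) (chartAt EM q x) :=
    fun j => differentiableAt_pi.1 (hT.clm_apply (differentiableAt_const _)) j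
  have hframe : ∀ x' : M, x' ∈ (trivializationAt (Fin r → ℂ) E q).baseSet →
      x' ∈ (trivializationAt (Fin r → ℂ) E x).baseSet → ∀ b : E x',
      h.form x' (stdFrame r x k x') b = ∑ j, conj (trans r E x q x' (Pi.single k 1) j) *
        h.form x' (stdFrame r q j x') b := by
    intro x' h1 h2 b
    rw [stdFrame_eq h2, ← vec_trans h2 h1, h.form_vec h1]
  have hE : ((fun x' => h.form x' (stdFrame r x k x') (s x')) ∘ (chartAt EM q).symm)
      =ᶠ[𝓝 (chartAt EM q x)] fun y => ∑ j,
        conj (trans r E x q ((chartAt EM q).symm y) (Pi.single k 1) j) *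
          (h.gramL q y (loc EM r q s y) j) := by
    filter_upwards [eventually_chart_symm_mem hx.1 ((isOpen_dom EM E q).mem_nhds hx),
      eventually_chart_symm_mem hx.1
        ((trivializationAt (Fin r → ℂ) E x).open_baseSet.mem_nhds h0)] with y h1 h2
    rw [Function.comp, hframe _ h1.2 h2]
    refine Finset.sum_congr rfl fun j _ => ?_
    rw [h.gramL_apply h1.2, loc, vec_coord h1.2]
  have hprod : ∀ j, DifferentiableAt ℝ (fun y =>
      conj (trans r E x q ((chartAt EM q).symm y) (Pi.single k 1) j) *
          (h.gramL q y (loc EM r q s y) j)) (chartAt EM q x) := fun j =>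
    ((conjCLE : ℂ →L[ℝ] ℂ).differentiableAt.comp _ ((hb j).restrictScalars ℝ)).mul (hMj j)
  rw [del_constField hx.1 ((DifferentiableAt.fun_sum fun j _ => hprod j).congr_of_eventuallyEq hE),
    pdel_congr hE, pdel_finset_sum _ fun j _ => hprod j, hframe x hx.2 h0]
  refine Finset.sum_congr rfl fun j _ => ?_
  rw [pdel_conj_mul ((hb j).restrictScalars ℝ) (hMj j), pdelBar_eq_zero (hb j), map_zero, zero_mul,
    zero_add, (chartAt EM q).left_inv hx.1]
  congr 1
  have hyx : (chartAt EM q).symm (chartAt EM q x) = x := (chartAt EM q).left_inv hx.1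
  have hu : IsUnit (h.gramL q (chartAt EM q x)) := h.isUnit_gramL (by rw [hyx]; exact hx.2)
  have h1 := h.frameGram_mulVec hx.2 (h.locD q (loc EM r q s) (chartAt EM q x) v) j
  rw [← h1, ← pdel_pi hM]
  have h2 : h.gramL q (chartAt EM q x) (h.locD q (loc EM r q s) (chartAt EM q x) v) =
      pdel (fun y => h.gramL q y (loc EM r q s y)) (chartAt EM q x) v := by
    rw [locD, ← mul_apply_eq_comp, Ring.mul_inverse_cancel _ hu]
    rfl
  rw [← h2, gramL, hyx]
  rfl

end HermitianMetric
end Metric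

/-! ### Curvature of the Chern connection -/

section Curvature

variable {EM : Type*} [NormedAddCommGroup EM] [NormedSpace ℂ EM]
  {M : Type*} [TopologicalSpace M] [ChartedSpace EM M] {r : ℕ}
  {E : M → Type*} [∀ x, AddCommGroup (E x)] [∀ x, Module ℂ (E x)]
  [TopologicalSpace (TotalSpace (Fin r → ℂ) E)] [∀ x, TopologicalSpace (E x)]
  [FiberBundle (Fin r → ℂ) E] [VectorBundle ℂ (Fin r → ℂ) E]
  [IsManifold 𝓘(ℂ, EM) ω M] [ContMDiffVectorBundle ω (Fin r → ℂ) E 𝓘(ℂ, EM)]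

namespace HermitianMetric

variable (h : HermitianMetric EM r E)

theorem isUnit_gramL_chart {q x : M} (hx : x ∈ dom EM E r q) :
    IsUnit (h.gramL q (chartAt EM q x)) :=
  h.isUnit_gramL (by rw [(chartAt EM q).left_inv hx.1]; exact hx.2)

theorem contDiffAt_inverse_gramL {q x : M} (hx : x ∈ dom EM E r q) :
    ContDiffAt ℝ ∞ (fun y => Ring.inverse (h.gramL q y)) (chartAt EM q x) := by
  obtain ⟨u, hu⟩ := h.isUnit_gramL_chart hx
  have := contDiffAt_ringInverse (n := ∞) ℝ u
  rw [hu] at this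
  exact this.comp _ (h.contDiffAt_gramL hx)

/-- The `(1, 0)`-form `θ = L⁻¹ ∂ L` of the Chern connection. -/
def connForm (q : M) (y v : EM) : (Fin r → ℂ) →L[ℂ] (Fin r → ℂ) :=
  Ring.inverse (h.gramL q y) * pdel (h.gramL q) y v

theorem locD_eq {q x : M} (hx : x ∈ dom EM E r q) {g : EM → Fin r → ℂ}
    (hg : DifferentiableAt ℝ g (chartAt EM q x)) (v : EM) :
    h.locD q g (chartAt EM q x) v =
      pdel g (chartAt EM q x) v + h.connForm q (chartAt EM q x) v (g (chartAt EM q x)) := by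
  rw [locD, pdel_clm_apply ((h.contDiffAt_gramL hx).differentiableAt (by simp)) hg, map_add,
    ← mul_apply_eq_comp, Ring.inverse_mul_cancel _ (h.isUnit_gramL_chart hx), connForm]
  rfl

theorem contDiffAt_locD {q x : M} (hx : x ∈ dom EM E r q) {g : EM → Fin r → ℂ}
    (hg : ContDiffAt ℝ ∞ g (chartAt EM q x)) (v : EM) :
    ContDiffAt ℝ ∞ (fun y => h.locD q g y v) (chartAt EM q x) :=
  contDiffAt_clm_apply (h.contDiffAt_inverse_gramL hx)
    (contDiffAt_pdel (contDiffAt_clm_apply (h.contDiffAt_gramL hx) hg) v)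

theorem locD_congr {q : M} {g g' : EM → Fin r → ℂ} {y : EM} (hg : g =ᶠ[𝓝 y] g') (v : EM) :
    h.locD q g y v = h.locD q g' y v := by
  rw [locD, locD]
  congr 1
  refine pdel_congr ?_ v
  filter_upwards [hg] with z hz
  rw [hz]

theorem locD_I_smul (q : M) (g : EM → Fin r → ℂ) (y v : EM) :
    h.locD q g y (I • v) = I • h.locD q g y v := by
  simp [locD, pdel_I_smul]

theorem locD_add {q x : M} (hx : x ∈ dom EM E r q) {g g' : EM → Fin r → ℂ}
    (hg : DifferentiableAt ℝ g (chartAt EM q x)) (hg' : DifferentiableAt ℝ g' (chartAt EM q x))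
    (v : EM) : h.locD q (fun y => g y + g' y) (chartAt EM q x) v =
      h.locD q g (chartAt EM q x) v + h.locD q g' (chartAt EM q x) v := by
  rw [h.locD_eq hx hg, h.locD_eq hx hg', h.locD_eq hx (hg.fun_add hg'), pdel_add hg hg', map_add]
  abel

theorem locD_const_smul {q x : M} (hx : x ∈ dom EM E r q) {g : EM → Fin r → ℂ}
    (hg : DifferentiableAt ℝ g (chartAt EM q x)) (c : ℂ) (v : EM) :
    h.locD q (fun y => c • g y) (chartAt EM q x) v = c • h.locD q g (chartAt EM q x) v := by
  rw [h.locD_eq hx hg, h.locD_eq hx (hg.fun_const_smul c), pdel_const_smul hg, map_smul, smul_add]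

/-- The `(2, 0)`-part of the curvature of the Chern connection vanishes. -/
theorem locD_locD_comm {q x : M} (hx : x ∈ dom EM E r q) {g : EM → Fin r → ℂ}
    (hg : ContDiffAt ℝ ∞ g (chartAt EM q x)) (v w : EM) :
    h.locD q (fun y => h.locD q g y w) (chartAt EM q x) v =
      h.locD q (fun y => h.locD q g y v) (chartAt EM q x) w := by
  have hLg := contDiffAt_clm_apply (h.contDiffAt_gramL hx) hg
  -- `L` conjugates `D'` into `∂`, so commutation of `∂`-derivatives carries over.
  have hE : ∀ u, (fun y => h.gramL q y (h.locD q g y u)) =ᶠ[𝓝 (chartAt EM q x)]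
      fun y => pdel (fun y => h.gramL q y (g y)) y u := by
    intro u
    filter_upwards [eventually_chart_symm_mem hx.1 ((isOpen_dom EM E q).mem_nhds hx)] with y hy
    rw [locD, ← mul_apply_eq_comp, Ring.mul_inverse_cancel _ (h.isUnit_gramL hy.2)]
    rfl
  rw [locD, pdel_congr (hE w), pdel_pdel_comm hLg, ← pdel_congr (hE v)]
  rfl

/-- Smoothness at `x` yields differentiability nearby; the formula on a neighbourhood is what allows
a second derivative to be taken. -/
theorem chernD_eventuallyEq {q x : M} (hx : x ∈ dom EM E r q) {s : ∀ x, E x}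
    (hs : SmoothAt (Fin r → ℂ) EM s x) (v : EM) : ∀ᶠ x' in 𝓝 x,
      h.chernD s x' (constField q v x') =
        vec r q x' (h.locD q (loc EM r q s) (chartAt EM q x') v) := by
  have h1 : ∀ᶠ y in 𝓝 (chartAt EM q x), DifferentiableAt ℝ (loc EM r q s) y := by
    filter_upwards [(((smoothAt_iff hx s).1 hs).of_le (n := ∞) (m := 1)
      (by exact_mod_cast le_top)).eventually (by simp)] with y hy
      using hy.differentiableAt (by simp)
  filter_upwards [(isOpen_dom EM E q).mem_nhds hx,
    ((chartAt EM q).continuousAt hx.1).eventually h1] with x' hx' hd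
  exact h.chernD_constField hx' hd v

theorem _root_.HiggsBundle.dbar_eventuallyEq {q x : M} (hx : x ∈ dom EM E r q) {s : ∀ x, E x}
    (hs : SmoothAt (Fin r → ℂ) EM s x) (v : EM) : ∀ᶠ x' in 𝓝 x,
      dbar r s x' (constField q v x') =
        vec r q x' (pdelBar (loc EM r q s) (chartAt EM q x') v) := by
  have h1 : ∀ᶠ y in 𝓝 (chartAt EM q x), DifferentiableAt ℝ (loc EM r q s) y := by
    filter_upwards [(((smoothAt_iff hx s).1 hs).of_le (n := ∞) (m := 1)
      (by exact_mod_cast le_top)).eventually (by simp)] with y hy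
      using hy.differentiableAt (by simp)
  filter_upwards [(isOpen_dom EM E q).mem_nhds hx,
    ((chartAt EM q).continuousAt hx.1).eventually h1] with x' hx' hd
  exact dbar_constField hx' hd v

theorem loc_eventuallyEq_of_vec {q x : M} (hx : x ∈ dom EM E r q) {s : ∀ x, E x}
    {g : EM → Fin r → ℂ} (hs : ∀ᶠ x' in 𝓝 x, s x' = vec r q x' (g (chartAt EM q x'))) :
    loc EM r q s =ᶠ[𝓝 (chartAt EM q x)] g :=
  (loc_congr hx.1 hs).trans (loc_vec_eventuallyEq hx g)

theorem adj_zero (q : M) : h.adj (0 : Module.End ℂ (E q)) = 0 := by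
  ext b
  refine h.ext_stdFrame (mem_dom (r := r) EM E q).2 fun j => ?_
  simp [h.form_adj]

/-- Where the Higgs field vanishes, flatness of `D' + ∂̄` means that `D'` is holomorphic. -/
theorem chernDHolomorphicOn_of_higgs_eq_zero
    {Φ : ∀ x, TangentSpace 𝓘(ℂ, EM) x →ₗ[ℂ] Module.End ℂ (E x)} (hΦ : IsHarmonicHiggs h Φ)
    {V : Set M} (hV : IsOpen V) (h0 : ∀ q ∈ V, Φ q = 0) : h.ChernDHolomorphicOn V := by
  intro q hq s hs
  suffices key : ∀ v w : EM, h.chernD (fun x => dbar r s x (constField q w x)) q v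
      - dbar r (fun x => h.chernD s x (constField q v x)) q w = 0 from fun v w => key v w
  intro v w
  set y₀ := chartAt EM q q with hy₀
  have hq' : q ∈ dom EM E r q := mem_dom EM E q
  set g := loc EM r q s with hg
  have hgs : ContDiffAt ℝ ∞ g y₀ := (smoothAt_iff hq' s).1 hs
  have hD := fun u => h.contDiffAt_locD hq' hgs u
  have hB := fun u => contDiffAt_pdelBar hgs u
  have hDd := fun u => (hD u).differentiableAt (by simp)
  have hBd := fun u => (hB u).differentiableAt (by simp)
  have hconn : ∀ x ∈ V, ∀ (s : ∀ x, E x) u,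
      h.higgsConn Φ s x u = h.chernD s x u + dbar r s x u := by
    intro x hx s u
    simp [higgsConn, h0 x hx, h.adj_zero]
  have hE1 : ∀ u, loc EM r q (fun x => h.chernD s x (constField q u x)) =ᶠ[𝓝 y₀]
      fun y => h.locD q g y u := fun u =>
    loc_eventuallyEq_of_vec hq' (h.chernD_eventuallyEq hq' hs u)
  have hE2 : ∀ u, loc EM r q (fun x => dbar r s x (constField q u x)) =ᶠ[𝓝 y₀]
      fun y => pdelBar g y u := fun u => loc_eventuallyEq_of_vec hq' (dbar_eventuallyEq hq' hs u)
  have hE3 : ∀ u, loc EM r q (fun x => h.higgsConn Φ s x (constField q u x)) =ᶠ[𝓝 y₀]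
      fun y => h.locD q g y u + pdelBar g y u := by
    intro u
    refine loc_eventuallyEq_of_vec (g := fun y => h.locD q g y u + pdelBar g y u) hq' ?_
    filter_upwards [h.chernD_eventuallyEq hq' hs u, dbar_eventuallyEq hq' hs u, hV.mem_nhds hq]
      with x h1 h2 h3
    rw [hconn x h3, h1, h2, map_add]
  have hchern : ∀ (t : ∀ x, E x) (G : EM → Fin r → ℂ), loc EM r q t =ᶠ[𝓝 y₀] G →
      ContDiffAt ℝ ∞ G y₀ → ∀ u : EM, h.chernD t q u = vec r q q (h.locD q G y₀ u) := by
    intro t G ht hG u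
    rw [← h.locD_congr ht]
    have := h.chernD_constField hq'
      ((hG.congr_of_eventuallyEq ht).differentiableAt (by simp)) u
    rwa [constField_self] at this
  have hdbar : ∀ (t : ∀ x, E x) (G : EM → Fin r → ℂ), loc EM r q t =ᶠ[𝓝 y₀] G →
      ContDiffAt ℝ ∞ G y₀ → ∀ u : EM, dbar r t q u = vec r q q (pdelBar G y₀ u) := by
    intro t G ht hG u
    rw [← pdelBar_congr ht]
    have := dbar_constField hq'
      ((hG.congr_of_eventuallyEq ht).differentiableAt (by simp)) u
    rwa [constField_self] at this
  -- Flatness in coordinates, with the `(2,0)`-terms already removed.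
  have hF : ∀ v w : EM,
      h.locD q (fun y => pdelBar g y w) y₀ v + pdelBar (fun y => h.locD q g y w) y₀ v
        + pdelBar (fun y => pdelBar g y w) y₀ v
      - (h.locD q (fun y => pdelBar g y v) y₀ w + pdelBar (fun y => h.locD q g y v) y₀ w
        + pdelBar (fun y => pdelBar g y v) y₀ w) = 0 := by
    intro v w
    have h1 := (congrArg₂ (fun a b => a - b)
      (hconn q hq (fun x => h.higgsConn Φ s x (constField q w x)) v)
      (hconn q hq (fun x => h.higgsConn Φ s x (constField q v x)) w)).symm.trans
        (hΦ.integrable q s hs v w)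
    have e1 := hchern _ _ (hE3 w) ((hD w).add (hB w)) v
    have e2 := hchern _ _ (hE3 v) ((hD v).add (hB v)) w
    have e3 := hdbar _ _ (hE3 w) ((hD w).add (hB w)) v
    have e4 := hdbar _ _ (hE3 v) ((hD v).add (hB v)) w
    have h2 : vec (E := E) r q q (h.locD q (fun y => h.locD q g y w + pdelBar g y w) y₀ v
        + pdelBar (fun y => h.locD q g y w + pdelBar g y w) y₀ v
        - (h.locD q (fun y => h.locD q g y v + pdelBar g y v) y₀ w
        + pdelBar (fun y => h.locD q g y v + pdelBar g y v) y₀ w)) = 0 := by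
      rw [map_sub, map_add, map_add, ← e1, ← e2, ← e3, ← e4]
      exact h1
    have h3 := vec_injective hq'.2 (h2.trans (map_zero _).symm)
    rw [h.locD_add hq' (hDd w) (hBd w), h.locD_add hq' (hDd v) (hBd v),
      pdelBar_add (hDd w) (hBd w), pdelBar_add (hDd v) (hBd v), h.locD_locD_comm hq' hgs v w] at h3
    rw [← h3]
    abel
  have hF1 := hF v w
  -- Passing from `v` to `iv` multiplies `D'_v` by `i` and `∂̄_v` by `-i`. Half the relation for `v`
  -- plus `-i/2` times the one for `iv` keeps exactly the terms with `D'_v`, so the `(0,2)`-part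
  -- needs no separate treatment.
  have hF2 := hF (I • v) w
  have n1 : ∀ u : EM, (fun y => pdelBar g y (I • u)) = fun y => (-I) • pdelBar g y u := by
    intro u; ext1 y; rw [pdelBar_I_smul, neg_smul]
  have n2 : ∀ u : EM, (fun y => h.locD q g y (I • u)) = fun y => I • h.locD q g y u := by
    intro u; ext1 y; rw [locD_I_smul]
  rw [n1, n2, h.locD_I_smul, pdelBar_I_smul, pdelBar_I_smul, h.locD_const_smul hq' (hBd v),
    pdelBar_const_smul (hBd v), pdelBar_const_smul (hDd v)] at hF2
  have hF3 : h.locD q (fun y => pdelBar g y w) y₀ v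
      - pdelBar (fun y => h.locD q g y v) y₀ w = 0 := by
    have h4 := congrArg (fun z => (-I / 2) • z) hF2
    have h5 := congrArg (fun z => (1 / 2 : ℂ) • z) hF1
    have h6 := congrArg₂ (· + ·) h4 h5
    simp only [smul_zero, add_zero] at h6
    rw [← h6]
    match_scalars
    all_goals ring_nf
    all_goals norm_num [I_sq]
  have e1 := hchern _ _ (hE2 w) (hB w) v
  have e2 := hdbar _ _ (hE1 v) (hD v) w
  rw [e1, e2, ← map_sub, hF3, map_zero]

end HermitianMetric
end Curvature

/-! ### Holomorphy of the connection form and parallel frames -/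

section HolomorphicConnection

/-- The `(1, 0)`-part of the differential at a point as a complex-linear map. -/
def pdelLin {V : Type*} [NormedAddCommGroup V] [NormedSpace ℂ V]
    {F : Type*} [NormedAddCommGroup F] [NormedSpace ℂ F] (f : V → F) (y : V) : V →ₗ[ℂ] F where
  toFun := pdel f y
  map_add' v w := by simp only [pdel, smul_add, map_add]; module
  map_smul' c v := by
    have h1 : c • v = c.re • v + c.im • (I • v) := by
      conv_lhs => rw [← re_add_im c, add_smul, mul_smul]
      rw [coe_smul, coe_smul]
    rw [h1, RingHom.id_apply]
    have h2 : ∀ (a : ℝ) (u : V), pdel f y (a • u) = (a : ℂ) • pdel f y u := by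
      intro a u
      rw [← pdelL_apply, map_smul, pdelL_apply, coe_smul]
    have h3 : pdel f y (c.re • v + c.im • (I • v)) =
        pdel f y (c.re • v) + pdel f y (c.im • (I • v)) := by
      rw [← pdelL_apply, map_add, pdelL_apply, pdelL_apply]
    rw [h3, h2, h2, pdel_I_smul, smul_smul, ← add_smul, re_add_im]

variable {EM : Type*} [NormedAddCommGroup EM] [NormedSpace ℂ EM]
  {M : Type*} [TopologicalSpace M] [ChartedSpace EM M] {r : ℕ}
  {E : M → Type*} [∀ x, AddCommGroup (E x)] [∀ x, Module ℂ (E x)]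
  [TopologicalSpace (TotalSpace (Fin r → ℂ) E)] [∀ x, TopologicalSpace (E x)]
  [FiberBundle (Fin r → ℂ) E] [VectorBundle ℂ (Fin r → ℂ) E]
  [IsManifold 𝓘(ℂ, EM) ω M] [ContMDiffVectorBundle ω (Fin r → ℂ) E 𝓘(ℂ, EM)]

theorem eventually_of_chart {q : M} {S : Set M} (hS : S ∈ 𝓝 q) {P : EM → Prop}
    (hP : ∀ x ∈ S, x ∈ (chartAt EM q).source → P (chartAt EM q x)) :
    ∀ᶠ y in 𝓝 (chartAt EM q q), P y := by
  filter_upwards [eventually_chart_symm_mem (mem_chart_source EM q) hS,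
    (chartAt EM q).open_target.mem_nhds (mem_chart_target EM q)] with y h1 h2
  have := hP _ h1 ((chartAt EM q).map_target h2)
  rwa [(chartAt EM q).right_inv h2] at this

/-- Change of chart for coordinate vector fields. -/
theorem constField_change {q x x' : M} (hq : x' ∈ (chartAt EM q).source)
    (hx : x' ∈ (chartAt EM x).source) (w : EM) :
    constField q w x' =
      constField x (fderiv ℂ (chartAt EM x ∘ (chartAt EM q).symm) (chartAt EM q x') w) x' := by
  rw [constField, constField, coordField_eq hq, coordField_eq hx]
  have hx' := mem_chart_source EM x'
  have h1 := (contDiffAt_chart_transition hq hx).differentiableAt (by simp)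
  have h2 := (contDiffAt_chart_transition hx hx').differentiableAt (by simp)
  have hpt : (chartAt EM x ∘ (chartAt EM q).symm) (chartAt EM q x') = chartAt EM x x' := by
    simp [(chartAt EM q).left_inv hq]
  have hE : chartAt EM x' ∘ (chartAt EM q).symm =ᶠ[𝓝 (chartAt EM q x')]
      (chartAt EM x' ∘ (chartAt EM x).symm) ∘ (chartAt EM x ∘ (chartAt EM q).symm) := by
    filter_upwards [eventually_chart_symm_mem hq ((chartAt EM x).open_source.mem_nhds hx)] with y hy
    simp [(chartAt EM x).left_inv hy]
  rw [hE.fderiv_eq, fderiv_comp _ (by rw [hpt]; exact h2) h1, hpt]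
  rfl

theorem mdifferentiableAt_vec {q x : M} (hx : x ∈ dom EM E r q) {g : EM → Fin r → ℂ}
    (hg : DifferentiableAt ℂ g (chartAt EM q x)) :
    MDifferentiableAt 𝓘(ℂ, EM) (𝓘(ℂ, EM).prod 𝓘(ℂ, Fin r → ℂ))
      (fun x => TotalSpace.mk' (Fin r → ℂ) x (vec (E := E) r q x (g (chartAt EM q x)))) x :=
  (mdifferentiableAt_section_iff_loc hx fun x => vec (E := E) r q x (g (chartAt EM q x))).2
    (hg.congr_of_eventuallyEq (loc_vec_eventuallyEq hx g))

namespace HermitianMetric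

variable (h : HermitianMetric EM r E)

theorem locD_sum_smul (q : M) (g : EM → Fin r → ℂ) (y : EM) {ι : Type*} (I : Finset ι)
    (c : ι → ℂ) (v : ι → EM) :
    h.locD q g y (∑ i ∈ I, c i • v i) = ∑ i ∈ I, c i • h.locD q g y (v i) := by
  have h1 : ∀ u, pdel (fun y => h.gramL q y (g y)) y u =
    pdelLin (fun y => h.gramL q y (g y)) y u := fun _ => rfl
  simp only [locD, h1, map_sum, map_smul]

/-- If `D'` is holomorphic, then it maps the holomorphic frame to holomorphic forms. -/
theorem differentiableAt_locD_const [FiniteDimensional ℂ EM] {V : Set M}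
    (hD : h.ChernDHolomorphicOn V) {q x : M} (hx : x ∈ dom EM E r q) (hxV : x ∈ V)
    (k : Fin r → ℂ) (w : EM) :
    DifferentiableAt ℂ (fun y => h.locD q (fun _ => k) y w) (chartAt EM q x) := by
  have hx0 : x ∈ dom EM E r x := mem_dom EM E x
  set s : ∀ x', E x' := fun x' => vec r q x' k with hs_def
  have hs : SmoothAt (Fin r → ℂ) EM s x := smoothAt_vec hx (g := fun _ => k) contDiffAt_const
  set g := loc EM r x s with hg_def
  have hg : ContDiffAt ℝ ∞ g (chartAt EM x x) := (smoothAt_iff hx0 s).1 hs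
  have hgh : ∀ᶠ x' in 𝓝 x, ∀ u, pdelBar g (chartAt EM x x') u = 0 := by
    filter_upwards [(isOpen_dom EM E q).mem_nhds hx, (isOpen_dom EM E x).mem_nhds hx0]
      with x' h1 h2 u
    exact pdelBar_eq_zero ((mdifferentiableAt_section_iff_loc h2 s).1
      (mdifferentiableAt_vec h1 (g := fun _ => k) (differentiableAt_const k))) u
  -- The hypothesis on `D'` at `x` concerns coordinate fields of the chart at `x`, so these come
  -- first. As `s` is holomorphic near `x`, the commutator reduces to `∂̄` of `D'_v s`.
  have hT : ∀ v : EM, MDifferentiableAt 𝓘(ℂ, EM) (𝓘(ℂ, EM).prod 𝓘(ℂ, Fin r → ℂ))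
      (fun x' => TotalSpace.mk' (Fin r → ℂ) x' (h.chernD s x' (constField x v x'))) x := by
    intro v
    rw [mdifferentiableAt_section_iff_loc hx0 fun x' => h.chernD s x' (constField x v x')]
    have hE := loc_eventuallyEq_of_vec (g := fun y => h.locD x g y v) hx0
      (h.chernD_eventuallyEq hx0 hs v)
    have hsm := (h.contDiffAt_locD hx0 hg v).congr_of_eventuallyEq hE
    have hdiff := hsm.differentiableAt (by simp)
    refine differentiableAt_of_pdelBar_eq_zero hdiff fun u => ?_
    have h1 : h.chernD (fun x' => dbar r s x' (constField x u x')) x v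
      - dbar r (fun x' => h.chernD s x' (constField x v x')) x u = 0 := hD x hxV s hs v u
    have h2 : h.chernD (fun x' => dbar r s x' (constField x u x')) x v = 0 := by
      have hE2 : loc EM r x (fun x' => dbar r s x' (constField x u x'))
          =ᶠ[𝓝 (chartAt EM x x)] fun _ => 0 := by
        refine loc_eventuallyEq_of_vec hx0 ?_
        filter_upwards [dbar_eventuallyEq hx0 hs u, hgh] with x' h3 h4
        rw [h3, ← hg_def, h4]
      have h5 := h.chernD_constField hx0
        ((differentiableAt_const (0 : Fin r → ℂ)).congr_of_eventuallyEq hE2) v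
      rw [constField_self] at h5
      rw [h5, h.locD_congr hE2]
      simp [locD, pdel]
    have h3 := dbar_constField hx0 hdiff u
    rw [constField_self] at h3
    have h4 : dbar r (fun x' => h.chernD s x' (constField x v x')) x u = 0 := by
      have := h1
      rw [h2] at this
      simpa using this
    rw [h4] at h3
    exact vec_injective hx0.2 (h3.symm.trans (map_zero _).symm)
  have hE : loc EM r q (fun x' => h.chernD s x' (constField q w x'))
      =ᶠ[𝓝 (chartAt EM q x)] fun y => h.locD q (fun _ => k) y w := by
    have h1 := loc_eventuallyEq_of_vec (g := fun y => h.locD q (loc EM r q s) y w) hx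
      (h.chernD_eventuallyEq hx hs w)
    have h2 := (loc_vec_eventuallyEq (E := E) hx fun _ => k).eventuallyEq_nhds
    filter_upwards [h1, h2] with y h3 h4
    rw [h3]
    exact h.locD_congr h4 w
  refine DifferentiableAt.congr_of_eventuallyEq ?_ hE.symm
  let β := Module.finBasis ℂ EM
  set b : EM → EM := fun y => fderiv ℂ (chartAt EM x ∘ (chartAt EM q).symm) y w with hb
  have hbd : DifferentiableAt ℂ b (chartAt EM q x) := by
    have := (contDiffAt_chart_transition hx.1 hx0.1).fderiv_right (m := ω) (by simp)
    exact (this.differentiableAt (by simp)).clm_apply (differentiableAt_const w)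
  -- Back to the chart at `q`: its coordinate field is a combination of those at `x` with
  -- holomorphic coefficients. Finite dimension of `EM` gives the finite basis for this expansion.
  have hE2 : loc EM r q (fun x' => h.chernD s x' (constField q w x'))
      =ᶠ[𝓝 (chartAt EM q x)] fun y => ∑ i, β.coord i (b y) •
        loc EM r q (fun x' => h.chernD s x' (constField x (β i) x')) y := by
    have h1 : ∀ᶠ x' in 𝓝 x, ∀ i, h.chernD s x' (constField x (β i) x') =
        vec r x x' (h.locD x g (chartAt EM x x') (β i)) :=
      Filter.eventually_all.2 fun i => h.chernD_eventuallyEq hx0 hs (β i)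
    have h2 : ∀ᶠ x' in 𝓝 x, DifferentiableAt ℝ g (chartAt EM x x') := by
      refine ((chartAt EM x).continuousAt hx0.1).eventually ?_
      filter_upwards [(hg.of_le (n := ∞) (m := 1)
        (by exact_mod_cast le_top)).eventually (by simp)] with y hy
        using hy.differentiableAt (by simp)
    filter_upwards [eventually_chart_symm_mem hx.1 (Filter.inter_mem
      (Filter.inter_mem h1 h2) (Filter.inter_mem ((isOpen_dom EM E q).mem_nhds hx)
        ((isOpen_dom EM E x).mem_nhds hx0))),
      (chartAt EM q).open_target.mem_nhds ((chartAt EM q).map_source hx.1)] with y hy hy'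
    obtain ⟨⟨h3, h4⟩, h5, h6⟩ := hy
    set x' := (chartAt EM q).symm y with hx'
    have hyx : chartAt EM q x' = y := (chartAt EM q).right_inv hy'
    have h7 : h.chernD s x' (constField q w x') =
        ∑ i, β.coord i (b y) • h.chernD s x' (constField x (β i) x') := by
      rw [constField_change h5.1 h6.1, hyx, h.chernD_constField h6 h4]
      have : b y = ∑ i, β.coord i (b y) • β i := (β.sum_repr (b y)).symm
      rw [show fderiv ℂ (chartAt EM x ∘ (chartAt EM q).symm) y w = b y from rfl, this,
        h.locD_sum_smul, map_sum, ← this]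
      refine Finset.sum_congr rfl fun i _ => ?_
      rw [map_smul, h3 i]
    have h8 : ∀ i, loc EM r q (fun x' => h.chernD s x' (constField x (β i) x')) y =
        coord r q (fun x' => h.chernD s x' (constField x (β i) x')) x' := fun i => rfl
    simp only [h8]
    rw [← coord_linear h5.2, loc, coord, coord, ← hx', h7]
  refine DifferentiableAt.congr_of_eventuallyEq (DifferentiableAt.fun_sum fun i _ => ?_) hE2
  have hc : DifferentiableAt ℂ (fun y => β.coord i (b y)) (chartAt EM q x) :=
    (LinearMap.toContinuousLinearMap (β.coord i)).differentiableAt.comp _ hbd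
  exact hc.fun_smul ((mdifferentiableAt_section_iff_loc hx fun x' =>
    h.chernD s x' (constField x (β i) x')).1 (hT (β i)))

/-- If `D'` is holomorphic near `q`, then it has local parallel frames in coordinates. -/
theorem exists_parallel_coordFrame [FiniteDimensional ℂ EM] {V : Set M} (hV : IsOpen V)
    (hD : h.ChernDHolomorphicOn V) {q : M} (hq : q ∈ V) :
    ∃ F : EM → (Fin r → ℂ) →L[ℂ] (Fin r → ℂ), F (chartAt EM q q) = 1 ∧
      ∀ᶠ y in 𝓝 (chartAt EM q q), ContDiffAt ℝ ∞ F y ∧ IsUnit (F y) ∧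
        ∀ v, fderiv ℝ F y v = -(h.connForm q y v * F y) := by
  have hS : dom EM E r q ∩ V ∈ 𝓝 q :=
    Filter.inter_mem ((isOpen_dom EM E q).mem_nhds (mem_dom EM E q)) (hV.mem_nhds hq)
  refine exists_frame_of_logDel (L := h.gramL q)
    (eventually_of_chart hS fun x hx _ => h.contDiffAt_gramL hx.1)
    (eventually_of_chart hS fun x hx _ => h.isUnit_gramL_chart hx.1)
    (eventually_of_chart hS fun x hx _ v w => ?_)
  ext1 k
  have hd : DifferentiableAt ℝ (fun y => h.connForm q y w) (chartAt EM q x) := by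
    have := ((contDiffAt_logDel (h.contDiffAt_gramL hx.1) (h.isUnit_gramL_chart hx.1)).clm_apply
      (contDiffAt_const (c := w))).differentiableAt (by simp)
    simp_rw [logDel_apply] at this
    exact this
  have h1 := pdelBar_clm_comp (ContinuousLinearMap.apply ℂ (Fin r → ℂ) k) hd v
  -- Applied to constant coordinates `k`, the connection form is `D'` of a holomorphic section, so
  -- it can be tested for holomorphy one vector at a time.
  have hE : (fun y => h.connForm q y w k) =ᶠ[𝓝 (chartAt EM q x)]
      fun y => h.locD q (fun _ => k) y w := by
    filter_upwards [eventually_chart_symm_mem hx.1.1 ((isOpen_dom EM E q).mem_nhds hx.1),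
      (chartAt EM q).open_target.mem_nhds ((chartAt EM q).map_source hx.1.1)] with y h2 h3
    have := h.locD_eq h2 (g := fun _ => k) (differentiableAt_const k) w
    rw [(chartAt EM q).right_inv h3] at this
    rw [this]
    simp [pdel]
  have h2 := pdelBar_eq_zero (h.differentiableAt_locD_const hD hx.1 hx.2 k w) v
  rw [← pdelBar_congr hE] at h2
  exact h1.symm.trans h2

end HermitianMetric
end HolomorphicConnection

/-! ### Flat holomorphic eigenframes -/

section FlatFrame

variable {EM : Type*} [NormedAddCommGroup EM] [NormedSpace ℂ EM]
  {M : Type*} [TopologicalSpace M] [ChartedSpace EM M] {r : ℕ}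
  {E : M → Type*} [∀ x, AddCommGroup (E x)] [∀ x, Module ℂ (E x)]
  [TopologicalSpace (TotalSpace (Fin r → ℂ) E)] [∀ x, TopologicalSpace (E x)]
  [FiberBundle (Fin r → ℂ) E] [VectorBundle ℂ (Fin r → ℂ) E]

/-- The preferred trivialization at `q` as a linear equivalence of fibres. -/
def vecEquiv {q x : M} (hx : x ∈ (trivializationAt (Fin r → ℂ) E q).baseSet) :
    (Fin r → ℂ) ≃ₗ[ℂ] E x :=
  LinearEquiv.ofBijective (vec r q x) ⟨vec_injective hx, vec_surjective hx⟩

theorem finiteDimensional_fibre (r : ℕ) (E : M → Type*) [∀ x, AddCommGroup (E x)]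
    [∀ x, Module ℂ (E x)] [TopologicalSpace (TotalSpace (Fin r → ℂ) E)]
    [∀ x, TopologicalSpace (E x)] [FiberBundle (Fin r → ℂ) E] [VectorBundle ℂ (Fin r → ℂ) E] (x : M) :
    FiniteDimensional ℂ (E x) :=
  (vecEquiv (E := E) (r := r) (FiberBundle.mem_baseSet_trivializationAt' x)).finiteDimensional

theorem finrank_fibre (r : ℕ) (E : M → Type*) [∀ x, AddCommGroup (E x)]
    [∀ x, Module ℂ (E x)] [TopologicalSpace (TotalSpace (Fin r → ℂ) E)]
    [∀ x, TopologicalSpace (E x)] [FiberBundle (Fin r → ℂ) E] [VectorBundle ℂ (Fin r → ℂ) E] (x : M) :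
    Module.finrank ℂ (E x) = r := by
  rw [← (vecEquiv (E := E) (r := r) (FiberBundle.mem_baseSet_trivializationAt' x)).finrank_eq]
  simp

variable [IsManifold 𝓘(ℂ, EM) ω M] [ContMDiffVectorBundle ω (Fin r → ℂ) E 𝓘(ℂ, EM)]

namespace HermitianMetric

variable (h : HermitianMetric EM r E)

/-- A vector orthogonal to a spanning family is zero. -/
theorem eq_zero_of_form_eq_zero {q : M} {ι : Type*} {e : ι → E q}
    (he : Submodule.span ℂ (Set.range e) = ⊤) {a : E q} (ha : ∀ i, h.form q a (e i) = 0) :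
    a = 0 := by
  by_contra h0
  have h1 : a ∈ Submodule.span ℂ (Set.range e) := by rw [he]; trivial
  have h2 : h.form q a a = 0 := by
    refine Submodule.span_induction (p := fun b _ => h.form q a b = 0) ?_ (map_zero _) ?_ ?_ h1
    · rintro _ ⟨i, rfl⟩
      exact ha i
    · intro b c _ _ hb hc
      rw [map_add, hb, hc, add_zero]
    · intro c b _ hb
      rw [map_smul, hb, smul_zero]
  have := h.pos q a h0
  rw [h2] at this
  simp at this

/-- The Chern connection is compatible with the metric. -/
theorem del_form {x : M} {a b : ∀ x, E x} (ha : SmoothAt (Fin r → ℂ) EM a x)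
    (hb : SmoothAt (Fin r → ℂ) EM b x) (v : TangentSpace 𝓘(ℂ, EM) x) :
    del (fun x => h.form x (a x) (b x)) x v =
      h.form x (dbar r a x v) (b x) + h.form x (a x) (h.chernD b x v) := by
  have hx : x ∈ dom EM E r x := mem_dom EM E x
  have hyx : (chartAt EM x).symm (chartAt EM x x) = x := (chartAt EM x).left_inv hx.1
  have ha' := ((smoothAt_iff hx a).1 ha).differentiableAt (by simp)
  have hb' := ((smoothAt_iff hx b).1 hb).differentiableAt (by simp)
  have hL : DifferentiableAt ℝ (h.gramL x) (chartAt EM x x) :=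
    (h.contDiffAt_gramL hx).differentiableAt (by simp)
  have hM := differentiableAt_clm_apply hL hb'
  have hMj : ∀ j, DifferentiableAt ℝ (fun y => h.gramL x y (loc EM r x b y) j) (chartAt EM x x) :=
    fun j => differentiableAt_pi.1 hM j
  have haj : ∀ j, DifferentiableAt ℝ (fun y => loc EM r x a y j) (chartAt EM x x) :=
    fun j => differentiableAt_pi.1 ha' j
  have hE : ((fun x' => h.form x' (a x') (b x')) ∘ (chartAt EM x).symm)
      =ᶠ[𝓝 (chartAt EM x x)] fun y => ∑ j, conj (loc EM r x a y j) *
          (h.gramL x y (loc EM r x b y) j) := by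
    filter_upwards [eventually_chart_symm_mem hx.1 ((isOpen_dom EM E x).mem_nhds hx)] with y h1
    conv_lhs => rw [Function.comp, ← vec_coord h1.2 a, h.form_vec h1.2]
    refine Finset.sum_congr rfl fun j _ => ?_
    rw [h.gramL_apply h1.2, loc, loc, vec_coord h1.2]
  have hprod : ∀ j, DifferentiableAt ℝ (fun y => conj (loc EM r x a y j) *
          (h.gramL x y (loc EM r x b y) j)) (chartAt EM x x) := fun j =>
    ((conjCLE : ℂ →L[ℝ] ℂ).differentiableAt.comp _ (haj j)).mul (hMj j)
  suffices key : ∀ v : EM, del (fun x => h.form x (a x) (b x)) x (constField x v x) =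
      h.form x (dbar r a x (constField x v x)) (b x) +
        h.form x (a x) (h.chernD b x (constField x v x)) by
    obtain ⟨v, rfl⟩ := exists_constField_eq hx.1 v
    exact key v
  intro v
  rw [del_constField hx.1 ((DifferentiableAt.fun_sum fun j _ => hprod j).congr_of_eventuallyEq hE),
    pdel_congr hE, pdel_finset_sum _ fun j _ => hprod j, dbar_constField hx ha',
    h.chernD_constField hx hb']
  conv_rhs => rw [← vec_coord hx.2 a]
  rw [h.form_vec hx.2, h.form_vec hx.2, ← Finset.sum_add_distrib]
  refine Finset.sum_congr rfl fun j _ => ?_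
  rw [pdel_conj_mul (haj j) (hMj j)]
  congr 1
  · congr 1
    · congr 1
      exact (pdelBar_clm_comp (ContinuousLinearMap.proj (R := ℂ) (φ := fun _ : Fin r => ℂ) j)
        ha' v)
    · rw [h.gramL_apply (by rw [hyx]; exact hx.2), loc, hyx, vec_coord hx.2]
  · rw [loc, hyx]
    congr 1
    rw [← pdel_pi hM, ← h.frameGram_mulVec hx.2]
    have h2 : h.gramL x (chartAt EM x x) (h.locD x (loc EM r x b) (chartAt EM x x) v) =
        pdel (fun y => h.gramL x y (loc EM r x b y)) (chartAt EM x x) v := by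
      rw [locD, ← mul_apply_eq_comp, Ring.mul_inverse_cancel _ (h.isUnit_gramL_chart hx)]
      rfl
    rw [← h2, gramL, hyx]
    rfl

/-- A self-adjoint endomorphism that is flat for `D'` maps a flat holomorphic frame to
holomorphic sections. -/
theorem dbar_apply_eq_zero {Q : ∀ x, Module.End ℂ (E x)} {e : Fin r → ∀ x, E x} {x : M}
    (hQs : ∀ i, SmoothAt (Fin r → ℂ) EM (fun x => Q x (e i x)) x)
    (hQ : ∀ x a b, h.form x (Q x a) b = h.form x a (Q x b))
    (he : ∀ i, SmoothAt (Fin r → ℂ) EM (e i) x)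
    (hspan : Submodule.span ℂ (Set.range fun i => e i x) = ⊤)
    (v : TangentSpace 𝓘(ℂ, EM) x) (hd : ∀ i, dbar r (e i) x v = 0)
    (hD : ∀ i, h.chernD (e i) x v = 0) (hDQ : ∀ i, h.chernD (fun x => Q x (e i x)) x v = 0)
    (j : Fin r) : dbar r (fun x => Q x (e j x)) x v = 0 := by
  refine h.eq_zero_of_form_eq_zero hspan fun i => ?_
  -- The function `h(Q e_j, e_i) = h(e_j, Q e_i)` is differentiated in both forms: the second
  -- derivative expression vanishes, the first leaves `h(∂̄(Q e_j), e_i)`.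
  have h1 := h.del_form (hQs j) (he i) v
  have h2 := h.del_form (he j) (hQs i) v
  rw [hD, map_zero, add_zero] at h1
  rw [hd, hDQ, map_zero, map_zero, add_zero, LinearMap.zero_apply] at h2
  rw [← h1, ← h2]
  simp_rw [hQ]

theorem connForm_I_smul (q : M) (y v : EM) : h.connForm q y (I • v) = I • h.connForm q y v := by
  rw [connForm, pdel_I_smul]
  exact ContinuousLinearMap.comp_smul _ _ _

/-- The connection form is of type `(1,0)`, so the differential of a parallel `g` respects
multiplication by `i`. -/
theorem pdelBar_eq_zero_of_parallel {q : M} {y : EM} {g : EM → Fin r → ℂ}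
    (hg : ∀ v, fderiv ℝ g y v = -(h.connForm q y v (g y))) (v : EM) : pdelBar g y v = 0 := by
  rw [pdelBar, hg, hg, connForm_I_smul, smul_apply, smul_neg, smul_smul, I_mul_I]
  simp

theorem locD_eq_zero_of_parallel {q x : M} (hx : x ∈ dom EM E r q) {g : EM → Fin r → ℂ}
    (hd : DifferentiableAt ℝ g (chartAt EM q x))
    (hg : ∀ v, fderiv ℝ g (chartAt EM q x) v = -(h.connForm q (chartAt EM q x) v
      (g (chartAt EM q x)))) (v : EM) : h.locD q g (chartAt EM q x) v = 0 := by
  rw [h.locD_eq hx hd, pdel_eq_fderiv_of_pdelBar_eq_zero (h.pdelBar_eq_zero_of_parallel hg v), hg,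
    neg_add_cancel]

/-- A section killed by `D'` and `∂̄` is parallel in coordinates. -/
theorem fderiv_loc_eq {q x : M} (hx : x ∈ dom EM E r q) {s : ∀ x, E x}
    (hs : SmoothAt (Fin r → ℂ) EM s x) (hD : ∀ v, h.chernD s x v = 0)
    (hd : ∀ v : TangentSpace 𝓘(ℂ, EM) x, dbar r s x v = 0) (v : EM) :
    fderiv ℝ (loc EM r q s) (chartAt EM q x) v =
      -(h.connForm q (chartAt EM q x) v (loc EM r q s (chartAt EM q x))) := by
  have hs' := ((smoothAt_iff hx s).1 hs).differentiableAt (by simp)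
  have h1 := h.chernD_constField hx hs' v
  have h2 := dbar_constField hx hs' v
  rw [hD] at h1
  rw [hd] at h2
  have h3 := vec_injective hx.2 (h1.symm.trans (map_zero _).symm)
  have h4 := vec_injective hx.2 (h2.symm.trans (map_zero _).symm)
  rw [h.locD_eq hx hs', pdel_eq_fderiv_of_pdelBar_eq_zero h4] at h3
  exact eq_neg_of_add_eq_zero_left h3

end HermitianMetric

/-- Where the Higgs field vanishes there are local flat holomorphic frames that diagonalize `Q`. -/
theorem exists_flat_eigenframe [FiniteDimensional ℂ EM] {h : HermitianMetric EM r E}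
    {Φ : ∀ x, TangentSpace 𝓘(ℂ, EM) x →ₗ[ℂ] Module.End ℂ (E x)}
    {U Q : ∀ x, Module.End ℂ (E x)} (hE : IsIntegrableHarmonicHiggs h Φ U Q)
    {V : Set M} (hV : IsOpen V) (h0 : ∀ q ∈ V, Φ q = 0) {q₀ : M} (hq₀ : q₀ ∈ V) :
    ∃ V' : Set M, IsOpen V' ∧ q₀ ∈ V' ∧ V' ⊆ V ∧
      ∃ (e : Fin r → ∀ x, E x) (Λ : Fin r → ℝ), IsFlatHolomorphicFrameOn h e V' ∧
        (∀ q ∈ V', ∀ i, Q q (e i q) = (Λ i : ℂ) • e i q) ∧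
        ∀ q ∈ V', ∀ i, SmoothAt (Fin r → ℂ) EM (e i) q := by
  have hD := h.chernDHolomorphicOn_of_higgs_eq_zero hE.toIsHarmonicHiggs hV h0
  have hd₀ : q₀ ∈ dom EM E r q₀ := mem_dom EM E q₀
  set y₀ := chartAt EM q₀ q₀ with hy₀
  obtain ⟨F, hF1, hF⟩ := h.exists_parallel_coordFrame hV hD hq₀
  obtain ⟨c, hc⟩ := exists_bound_logDel (h.contDiffAt_gramL hd₀) (h.isUnit_gramL_chart hd₀)
  have hQ : ∀ x a b, h.form x (Q x a) b = h.form x a (Q x b) := by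
    intro x a b
    rw [← h.form_adj, hE.adj_Q]
  have : FiniteDimensional ℂ (E q₀) := finiteDimensional_fibre r E q₀
  obtain ⟨b, Λ, hb⟩ := exists_eigenbasis_of_selfAdjoint (finrank_fibre r E q₀) (h.form q₀)
    (h.symm q₀) (h.pos q₀) (Q q₀) (hQ q₀)
  have hev : ∀ᶠ y in 𝓝 y₀, ((ContDiffAt ℝ ∞ F y ∧ IsUnit (F y) ∧
        ∀ v, fderiv ℝ F y v = -(h.connForm q₀ y v * F y)) ∧
      (∀ v, ‖h.connForm q₀ y v‖ ≤ c * ‖v‖)) ∧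
      (chartAt EM q₀).symm y ∈ V ∩ dom EM E r q₀ ∧ y ∈ (chartAt EM q₀).target :=
    (hF.and hc).and ((eventually_chart_symm_mem hd₀.1 (Filter.inter_mem (hV.mem_nhds hq₀)
      ((isOpen_dom EM E q₀).mem_nhds hd₀))).and
      ((chartAt EM q₀).open_target.mem_nhds ((chartAt EM q₀).map_source hd₀.1)))
  -- A coordinate ball, because the final uniqueness argument runs along rays from its centre.
  obtain ⟨ρ, hρ, hball⟩ := Metric.eventually_nhds_iff_ball.1 hev
  set V' := (chartAt EM q₀).source ∩ chartAt EM q₀ ⁻¹' Metric.ball y₀ ρ with hV'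
  have hVd : ∀ x ∈ V', x ∈ V ∩ dom EM E r q₀ := by
    intro x hx
    have := (hball _ hx.2).2.1
    rwa [(chartAt EM q₀).left_inv hx.1] at this
  -- Coordinates of the eigenbasis at `q₀`. As `F` is the identity there, the transported sections
  -- start at the eigenvectors.
  let k : Fin r → Fin r → ℂ := fun i => (vecEquiv (E := E) hd₀.2).symm (b i)
  let G : Fin r → EM → Fin r → ℂ := fun i y => F y (k i)
  let e : Fin r → ∀ x, E x := fun i x => vec r q₀ x (G i (chartAt EM q₀ x))
  have hGd : ∀ i, ∀ y ∈ Metric.ball y₀ ρ, ContDiffAt ℝ ∞ (G i) y := fun i y hy =>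
    contDiffAt_clm_apply (hball y hy).1.1.1 contDiffAt_const
  have hGp : ∀ i, ∀ y ∈ Metric.ball y₀ ρ, ∀ v, fderiv ℝ (G i) y v =
      -(h.connForm q₀ y v (G i y)) := by
    intro i y hy v
    have := fderiv_clm_apply_complex ((hball y hy).1.1.1.differentiableAt (by simp))
      (differentiableAt_const (k i)) v
    rw [(hball y hy).1.1.2.2 v] at this
    refine this.trans ?_
    simp [G]
  have hes : ∀ x ∈ V', ∀ i, SmoothAt (Fin r → ℂ) EM (e i) x := fun x hx i =>
    smoothAt_vec (hVd x hx).2 (hGd i _ hx.2)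
  have hloc : ∀ x ∈ V', ∀ i, loc EM r q₀ (e i) =ᶠ[𝓝 (chartAt EM q₀ x)] G i := fun x hx i =>
    loc_vec_eventuallyEq (hVd x hx).2 (G i)
  have hflat : ∀ x ∈ V', ∀ i v, h.chernD (e i) x v = 0 := by
    intro x hx i v
    obtain ⟨v, rfl⟩ := exists_constField_eq (hVd x hx).2.1 v
    have hs := ((smoothAt_iff (hVd x hx).2 _).1 (hes x hx i)).differentiableAt (by simp)
    rw [h.chernD_constField (hVd x hx).2 hs, h.locD_congr (hloc x hx i),
      h.locD_eq_zero_of_parallel (hVd x hx).2 ((hGd i _ hx.2).differentiableAt (by simp))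
        (hGp i _ hx.2), map_zero]
  have hhol : ∀ x ∈ V', ∀ i (v : TangentSpace 𝓘(ℂ, EM) x), dbar r (e i) x v = 0 := by
    intro x hx i v
    obtain ⟨v, rfl⟩ := exists_constField_eq (hVd x hx).2.1 v
    have hs := ((smoothAt_iff (hVd x hx).2 _).1 (hes x hx i)).differentiableAt (by simp)
    rw [dbar_constField (hVd x hx).2 hs, pdelBar_congr (hloc x hx i),
      h.pdelBar_eq_zero_of_parallel (hGp i _ hx.2), map_zero]
  have hframe : ∀ x ∈ V', ∃ f : E q₀ ≃ₗ[ℂ] E x, ∀ i, e i x = f (b i) := by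
    intro x hx
    have hu := (hball _ hx.2).1.1.2.1
    rw [ContinuousLinearMap.isUnit_iff_bijective] at hu
    exact ⟨((vecEquiv hd₀.2).symm.trans (LinearEquiv.ofBijective (F (chartAt EM q₀ x)).toLinearMap
      hu)).trans (vecEquiv (hVd x hx).2.2), fun i => rfl⟩
  have hspan : ∀ x ∈ V', Submodule.span ℂ (Set.range fun i => e i x) = ⊤ := by
    intro x hx
    obtain ⟨f, hf⟩ := hframe x hx
    simp_rw [hf]
    have := (b.map f).span_eq
    rwa [show (⇑(b.map f)) = fun i => f (b i) from funext fun i => b.map_apply f i] at this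
  have hQs : ∀ x ∈ V', ∀ i, SmoothAt (Fin r → ℂ) EM (fun x => Q x (e i x)) x :=
    fun x hx i => hE.smooth_Q x _ (hes x hx i)
  have hQflat : ∀ x ∈ V', ∀ i v, h.chernD (fun x => Q x (e i x)) x v = 0 := by
    intro x hx i v
    have := hE.chern_Q x (e i) (hes x hx i) v
    rw [HermitianMetric.chernDEnd, hflat x hx, h0 x (hVd x hx).1] at this
    simpa using this
  have hQhol : ∀ x ∈ V', ∀ i (v : TangentSpace 𝓘(ℂ, EM) x),
      dbar r (fun x => Q x (e i x)) x v = 0 := fun x hx i v =>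
    h.dbar_apply_eq_zero (hQs x hx) hQ (hes x hx) (hspan x hx) v (fun i => hhol x hx i v)
      (fun i => hflat x hx i v) (fun i => hQflat x hx i v) i
  refine ⟨V', (chartAt EM q₀).isOpen_inter_preimage Metric.isOpen_ball,
    ⟨hd₀.1, Metric.mem_ball_self hρ⟩, fun x hx => (hVd x hx).1, e, Λ,
    ⟨fun i x hx => ?_, fun i x hx => hflat x hx i, fun x hx => ?_, hspan⟩, fun x hx i => ?_, hes⟩
  · refine mdifferentiableAt_vec (hVd x hx).2 (differentiableAt_of_pdelBar_eq_zero
      ((hGd i _ hx.2).differentiableAt (by simp)) (h.pdelBar_eq_zero_of_parallel (hGp i _ hx.2)))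
  · obtain ⟨f, hf⟩ := hframe x hx
    simp_rw [hf]
    exact b.linearIndependent.map' f.toLinearMap f.ker
  · set A := loc EM r q₀ (fun x => Q x (e i x)) with hA
    have hpt : ∀ y ∈ Metric.ball y₀ ρ, (chartAt EM q₀).symm y ∈ V' ∧
        chartAt EM q₀ ((chartAt EM q₀).symm y) = y := by
      intro y hy
      have h1 := (chartAt EM q₀).right_inv (hball y hy).2.2
      refine ⟨⟨(hball y hy).2.1.2.1, ?_⟩, h1⟩
      rwa [Set.mem_preimage, h1]
    have hAs : ∀ y ∈ Metric.ball y₀ ρ, DifferentiableAt ℝ A y := by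
      intro y hy
      obtain ⟨h1, h2⟩ := hpt y hy
      have := ((smoothAt_iff (hVd _ h1).2 _).1 (hQs _ h1 i)).differentiableAt (by simp)
      rwa [h2] at this
    have hAp : ∀ y ∈ Metric.ball y₀ ρ, ∀ v, fderiv ℝ A y v = -(h.connForm q₀ y v (A y)) := by
      intro y hy v
      obtain ⟨h1, h2⟩ := hpt y hy
      have := h.fderiv_loc_eq (hVd _ h1).2 (hQs _ h1 i) (hQflat _ h1 i) (hQhol _ h1 i) v
      rwa [h2] at this
    -- Both terms solve the same linear parallel equation and agree at the centre, so their
    -- difference vanishes on the ball.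
    have hzero := eq_zero_of_norm_fderiv_le (g := fun y => A y - (Λ i : ℂ) • G i y) (y₀ := y₀)
      (ρ := ρ) (c := c) (fun y hy => (hAs y hy).fun_sub
        (((hGd i y hy).differentiableAt (by simp)).fun_const_smul _)) (fun y hy v => ?_) ?_
    · have h1 := hzero _ hx.2
      rw [sub_eq_zero, hA, loc, (chartAt EM q₀).left_inv hx.1] at h1
      rw [← vec_coord (hVd x hx).2.2 fun x => Q x (e i x), h1, map_smul]
    · have h1 := ((hGd i y hy).differentiableAt (by simp))
      rw [fderiv_fun_sub (hAs y hy) (h1.fun_const_smul _), fderiv_fun_const_smul h1, sub_apply,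
        smul_apply, hAp y hy, hGp i y hy]
      have h2 : -(h.connForm q₀ y v (A y)) - (Λ i : ℂ) • -(h.connForm q₀ y v (G i y)) =
          -(h.connForm q₀ y v (A y - (Λ i : ℂ) • G i y)) := by
        rw [map_sub, map_smul, smul_neg]
        abel
      rw [h2, norm_neg]
      exact (ContinuousLinearMap.le_opNorm _ _).trans
        (mul_le_mul_of_nonneg_right ((hball y hy).1.2 v) (norm_nonneg _))
    · have h1 : e i q₀ = b i := by
        have : e i q₀ = vecEquiv hd₀.2 (F y₀ (k i)) := rfl
        rw [this, hF1]
        exact (vecEquiv hd₀.2).apply_symm_apply (b i)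
      have h2 : A y₀ = (Λ i : ℂ) • G i y₀ := by
        rw [hA, loc, hy₀, (chartAt EM q₀).left_inv hd₀.1]
        refine coord_vec hd₀.2 ?_
        rw [h1, hb, map_smul, ← h1]
      rw [h2, sub_self]

end FlatFrame

/-! ### Leibniz rules and the structure connection -/

section Leibniz

variable {V : Type*} [NormedAddCommGroup V] [NormedSpace ℂ V]
  {F : Type*} [NormedAddCommGroup F] [NormedSpace ℂ F]

theorem fderiv_smul_complex {f : V → ℂ} {g : V → F} {y : V} (hf : DifferentiableAt ℝ f y)
    (hg : DifferentiableAt ℝ g y) (v : V) :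
    fderiv ℝ (fun y => f y • g y) y v = f y • fderiv ℝ g y v + fderiv ℝ f y v • g y :=
  DFunLike.congr_fun (hf.hasFDerivAt.smul hg.hasFDerivAt).fderiv v

theorem pdel_smul {f : V → ℂ} {g : V → F} {y : V} (hf : DifferentiableAt ℝ f y)
    (hg : DifferentiableAt ℝ g y) (v : V) :
    pdel (fun y => f y • g y) y v = f y • pdel g y v + pdel f y v • g y := by
  simp only [pdel, fderiv_smul_complex hf hg]
  module

theorem pdelBar_smul {f : V → ℂ} {g : V → F} {y : V} (hf : DifferentiableAt ℝ f y)
    (hg : DifferentiableAt ℝ g y) (v : V) :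
    pdelBar (fun y => f y • g y) y v = f y • pdelBar g y v + pdelBar f y v • g y := by
  simp only [pdelBar, fderiv_smul_complex hf hg]
  module

theorem del_eq_pdel (f : V → F) (y v : V) : del (EM := V) f y v = pdel f y v := by
  have h : realDiff (EM := V) f y = fderiv ℝ f y := mfderiv_eq_fderiv
  simp only [del, h]
  rfl

theorem delBar_eq_pdelBar (f : V → F) (y v : V) : delBar (EM := V) f y v = pdelBar f y v := by
  have h : realDiff (EM := V) f y = fderiv ℝ f y := mfderiv_eq_fderiv
  simp only [delBar, h]
  rfl

variable {EM : Type*} [NormedAddCommGroup EM] [NormedSpace ℂ EM]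
  {M : Type*} [TopologicalSpace M] [ChartedSpace EM M] {r : ℕ}
  {E : M → Type*} [∀ x, AddCommGroup (E x)] [∀ x, Module ℂ (E x)]
  [TopologicalSpace (TotalSpace (Fin r → ℂ) E)] [∀ x, TopologicalSpace (E x)]
  [FiberBundle (Fin r → ℂ) E] [VectorBundle ℂ (Fin r → ℂ) E]

theorem delBar_constField [IsManifold 𝓘(ℂ, EM) ω M] {f : M → F}
    {q x : M} (hx : x ∈ (chartAt EM q).source)
    (hf : DifferentiableAt ℝ (f ∘ (chartAt EM q).symm) (chartAt EM q x)) (v : EM) :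
    delBar f x (constField q v x) = pdelBar (f ∘ (chartAt EM q).symm) (chartAt EM q x) v := by
  rw [delBar, ← constField_smul hx, realDiff_constField hx hf, realDiff_constField hx hf]
  rfl

variable [IsManifold 𝓘(ℂ, EM) ω M] [ContMDiffVectorBundle ω (Fin r → ℂ) E 𝓘(ℂ, EM)]

theorem loc_sum_smul_eventuallyEq {ι : Type*} [Fintype ι] (q : M) (f : ι → M → ℂ)
    (e : ι → ∀ x, E x) : loc EM r q (fun x => ∑ i, f i x • e i x) =ᶠ[𝓝 (chartAt EM q q)]
      fun y => ∑ i, (f i ∘ (chartAt EM q).symm) y • loc EM r q (e i) y := by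
  filter_upwards [eventually_chart_symm_mem (mem_chart_source EM q)
    ((isOpen_dom EM E q).mem_nhds (mem_dom (r := r) EM E q))] with y hy
  exact coord_linear hy.2 Finset.univ (fun i => f i _) e

/-- The Leibniz rule for `∂̄`. -/
theorem dbar_sum_smul {ι : Type*} [Fintype ι] {q : M} {f : ι → M → ℂ} {e : ι → ∀ x, E x}
    (hf : ∀ i, ContMDiffAt 𝓘(ℝ, EM) 𝓘(ℝ, ℂ) ∞ (f i) q)
    (he : ∀ i, SmoothAt (Fin r → ℂ) EM (e i) q) (v : TangentSpace 𝓘(ℂ, EM) q) :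
    dbar r (fun x => ∑ i, f i x • e i x) q v =
      ∑ i, (f i q • dbar r (e i) q v + delBar (f i) q v • e i q) := by
  have hq : q ∈ dom EM E r q := mem_dom EM E q
  obtain ⟨v, rfl⟩ := exists_constField_eq hq.1 v
  have hf' := fun i => ((contMDiffAt_real_iff hq.1).1 (hf i)).differentiableAt (by simp)
  have he' := fun i => ((smoothAt_iff hq _).1 (he i)).differentiableAt (by simp)
  have hE := loc_sum_smul_eventuallyEq (r := r) (EM := EM) q f e
  have hd := fun i => (hf' i).fun_smul (he' i)
  rw [dbar_constField hq ((DifferentiableAt.fun_sum fun i _ => hd i).congr_of_eventuallyEq hE),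
    pdelBar_congr hE, pdelBar_finset_sum _ fun i _ => hd i, map_sum]
  refine Finset.sum_congr rfl fun i _ => ?_
  rw [pdelBar_smul (hf' i) (he' i), dbar_constField hq (he' i), delBar_constField hq.1 (hf' i),
    map_add, map_smul, map_smul, loc_chart EM hq.1, vec_coord hq.2, Function.comp,
    (chartAt EM q).left_inv hq.1]

/-- The Leibniz rule for `D'`. -/
theorem HermitianMetric.chernD_sum_smul (h : HermitianMetric EM r E) {ι : Type*} [Fintype ι]
    {q : M} {f : ι → M → ℂ} {e : ι → ∀ x, E x}
    (hf : ∀ i, ContMDiffAt 𝓘(ℝ, EM) 𝓘(ℝ, ℂ) ∞ (f i) q)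
    (he : ∀ i, SmoothAt (Fin r → ℂ) EM (e i) q) (v : TangentSpace 𝓘(ℂ, EM) q) :
    h.chernD (fun x => ∑ i, f i x • e i x) q v =
      ∑ i, (f i q • h.chernD (e i) q v + del (f i) q v • e i q) := by
  have hq : q ∈ dom EM E r q := mem_dom EM E q
  obtain ⟨v, rfl⟩ := exists_constField_eq hq.1 v
  have hf' := fun i => ((contMDiffAt_real_iff hq.1).1 (hf i)).differentiableAt (by simp)
  have he' := fun i => ((smoothAt_iff hq _).1 (he i)).differentiableAt (by simp)
  have hE := loc_sum_smul_eventuallyEq (r := r) (EM := EM) q f e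
  have hd := fun i => (hf' i).fun_smul (he' i)
  have hs := DifferentiableAt.fun_sum (u := Finset.univ) fun i _ => hd i
  rw [h.chernD_constField hq (hs.congr_of_eventuallyEq hE), h.locD_congr hE, h.locD_eq hq hs,
    pdel_finset_sum _ fun i _ => hd i, map_sum, ← Finset.sum_add_distrib, map_sum]
  refine Finset.sum_congr rfl fun i _ => ?_
  rw [pdel_smul (hf' i) (he' i), h.chernD_constField hq (he' i), del_constField hq.1 (hf' i),
    h.locD_eq hq (he' i), map_smul, add_right_comm, ← smul_add, map_add, map_smul, map_smul,
    loc_chart EM hq.1, vec_coord hq.2, Function.comp, (chartAt EM q).left_inv hq.1]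

section PullBack

variable {f : Fin r → ℂ → M → ℂ} {e : Fin r → ∀ x, E x} {z : ℂ} {q : M}

omit [IsManifold 𝓘(ℂ, EM) ω M] [ContMDiffVectorBundle ω (Fin r → ℂ) E 𝓘(ℂ, EM)] in
theorem contMDiffAt_slices {f : ℂ → M → ℂ}
    (hf : ContMDiffAt (𝓘(ℝ, ℂ).prod 𝓘(ℝ, EM)) 𝓘(ℝ, ℂ) ∞ (fun y : ℂ × M => f y.1 y.2) (z, q)) :
    DifferentiableAt ℝ (fun z' => f z' q) z ∧ ContMDiffAt 𝓘(ℝ, EM) 𝓘(ℝ, ℂ) ∞ (f z) q := by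
  constructor
  · have := hf.comp z ((contMDiffAt_id (I := 𝓘(ℝ, ℂ)) (n := ∞)).prodMk
      (contMDiffAt_const (I' := 𝓘(ℝ, EM)) (c := q)))
    exact (contMDiffAt_iff_contDiffAt.1 this).differentiableAt (by simp)
  · exact hf.comp q ((contMDiffAt_const (I' := 𝓘(ℝ, ℂ)) (c := z)).prodMk
      (contMDiffAt_id (I := 𝓘(ℝ, EM)) (n := ∞)))

variable (hf : ∀ i, ContMDiffAt (𝓘(ℝ, ℂ).prod 𝓘(ℝ, EM)) 𝓘(ℝ, ℂ) ∞
    (fun y : ℂ × M => f i y.1 y.2) (z, q))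
  (he : ∀ i, SmoothAt (Fin r → ℂ) EM (e i) q)
include hf he

/-- The pull-back of `D'` in the pull-back of a flat frame. -/
theorem pullD_sum_smul (h : HermitianMetric EM r E) (v : TangentSpace 𝓘(ℂ, EM) q)
    (hflat : ∀ i, h.chernD (e i) q v = 0) (ζ : ℂ) :
    pullD h (fun z' x => ∑ i, f i z' x • e i x) z q ζ v = ∑ i, delProd (f i) z q ζ v • e i q := by
  have hq := (mem_dom (r := r) EM E q).2
  -- The pulled-back frame does not depend on `z`, so in the `z`-direction only the coefficients are
  -- differentiated.
  have h1 : (fun z' => (trivializationAt (Fin r → ℂ) E q ⟨q, ∑ i, f i z' q • e i q⟩).2) =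
      fun z' => ∑ i, f i z' q • coord r q (e i) q :=
    funext fun z' => coord_linear hq Finset.univ (fun i => f i z' q) e
  have h2 := fun i => (contMDiffAt_slices (hf i)).1
  rw [pullD, h1, del_eq_pdel, pdel_finset_sum _ fun i _ => (h2 i).fun_smul
    (differentiableAt_const (coord r q (e i) q)),
    ← vec_apply hq, map_sum, h.chernD_sum_smul (fun i => (contMDiffAt_slices (hf i)).2) he,
    ← Finset.sum_add_distrib]
  refine Finset.sum_congr rfl fun i _ => ?_
  rw [pdel_smul (h2 i) (differentiableAt_const _), hflat, map_add, map_smul, map_smul,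
    vec_coord hq, smul_zero, zero_add, delProd, del_eq_pdel, add_smul]
  simp [pdel]

/-- The pull-back of `∂̄` in the pull-back of a holomorphic frame. -/
theorem pullDbar_sum_smul (v : TangentSpace 𝓘(ℂ, EM) q)
    (hhol : ∀ i, dbar r (e i) q v = 0) (ζ : ℂ) :
    pullDbar r (fun z' x => ∑ i, f i z' x • e i x) z q ζ v =
      ∑ i, delBarProd (f i) z q ζ v • e i q := by
  have hq := (mem_dom (r := r) EM E q).2
  have h1 : (fun z' => (trivializationAt (Fin r → ℂ) E q ⟨q, ∑ i, f i z' q • e i q⟩).2) =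
      fun z' => ∑ i, f i z' q • coord r q (e i) q :=
    funext fun z' => coord_linear hq Finset.univ (fun i => f i z' q) e
  have h2 := fun i => (contMDiffAt_slices (hf i)).1
  rw [pullDbar, h1, delBar_eq_pdelBar, pdelBar_finset_sum _ fun i _ => (h2 i).fun_smul
    (differentiableAt_const (coord r q (e i) q)),
    ← vec_apply hq, map_sum, dbar_sum_smul (fun i => (contMDiffAt_slices (hf i)).2) he,
    ← Finset.sum_add_distrib]
  refine Finset.sum_congr rfl fun i _ => ?_
  rw [pdelBar_smul (h2 i) (differentiableAt_const _), hhol, map_add, map_smul, map_smul,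
    vec_coord hq, smul_zero, zero_add, delBarProd, delBar_eq_pdelBar, add_smul]
  simp [pdelBar]

end PullBack

theorem HolomorphicOn.dbar_eq_zero {s : ∀ x, E x} {V : Set M}
    (hs : HolomorphicOn (Fin r → ℂ) EM s V) {q : M} (hq : q ∈ V) (v : TangentSpace 𝓘(ℂ, EM) q) :
    dbar r s q v = 0 := by
  have hq' : q ∈ dom EM E r q := mem_dom EM E q
  obtain ⟨v, rfl⟩ := exists_constField_eq hq'.1 v
  have h1 := (mdifferentiableAt_section_iff_loc hq' s).1 (hs q hq)
  rw [dbar_constField hq' (h1.restrictScalars ℝ), pdelBar_eq_zero h1, map_zero]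

/-- With `Φ` and `U` zero at `q`, and so `U†` too, only `-Q + w / 2` remains beside the pull-back of
`D'`, and it acts on each `e i` by a scalar. -/
theorem structureConn_eq {h : HermitianMetric EM r E}
    {Φ : ∀ x, TangentSpace 𝓘(ℂ, EM) x →ₗ[ℂ] Module.End ℂ (E x)}
    {U Q : ∀ x, Module.End ℂ (E x)} {q : M} (hΦ : Φ q = 0) (hU : U q = 0)
    {e : Fin r → ∀ x, E x} {μ : Fin r → ℂ} (hQ : ∀ i, Q q (e i q) = μ i • e i q) (w : ℂ)
    (f : Fin r → ℂ → M → ℂ) (z ζ : ℂ) (v : TangentSpace 𝓘(ℂ, EM) q) :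
    structureConn h Φ U Q w (fun z' x => ∑ i, f i z' x • e i x) z q ζ v
      = pullD h (fun z' x => ∑ i, f i z' x • e i x) z q ζ v
        + ∑ i, ((-μ i + w / 2) * f i z q * (ζ / z)) • e i q := by
  have h1 : ∑ i, ((-μ i + w / 2) * f i z q * (ζ / z)) • e i q = (ζ / z) •
      (-(Q q (∑ i, f i z q • e i q)) + (w / 2) • ∑ i, f i z q • e i q) := by
    rw [map_sum, ← Finset.sum_neg_distrib, Finset.smul_sum, ← Finset.sum_add_distrib,
      Finset.smul_sum]
    refine Finset.sum_congr rfl fun i _ => ?_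
    rw [map_smul, hQ]
    module
  rw [h1, structureConn, hΦ, hU, h.adj_zero]
  simp only [LinearMap.zero_apply]
  module

theorem structureDbar_eq {h : HermitianMetric EM r E}
    {Φ : ∀ x, TangentSpace 𝓘(ℂ, EM) x →ₗ[ℂ] Module.End ℂ (E x)} {q : M} (hΦ : Φ q = 0)
    (σ : ℂ → ∀ x, E x) (z ζ : ℂ) (v : TangentSpace 𝓘(ℂ, EM) q) :
    structureDbar h Φ σ z q ζ v = pullDbar r σ z q ζ v := by
  simp [structureDbar, hΦ, h.adj_zero]

end Leibniz

/-! ### Openness of the IS condition and determination of the Higgs field -/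

section ISCondition

variable {EM : Type*} [NormedAddCommGroup EM] [NormedSpace ℂ EM]
  {M : Type*} [TopologicalSpace M] [ChartedSpace EM M] {r : ℕ}
  {E : M → Type*} [∀ x, AddCommGroup (E x)] [∀ x, Module ℂ (E x)]
  [TopologicalSpace (TotalSpace (Fin r → ℂ) E)] [∀ x, TopologicalSpace (E x)]
  [FiberBundle (Fin r → ℂ) E] [VectorBundle ℂ (Fin r → ℂ) E]
  [IsManifold 𝓘(ℂ, EM) ω M] [ContMDiffVectorBundle ω (Fin r → ℂ) E 𝓘(ℂ, EM)]

theorem continuousAt_coord {q x : M} (hx : x ∈ dom EM E r q) {s : ∀ x, E x}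
    (hs : SmoothAt (Fin r → ℂ) EM s x) : ContinuousAt (coord r q s) x := by
  have h1 := ((smoothAt_iff hx s).1 hs).continuousAt.comp ((chartAt EM q).continuousAt hx.1)
  refine h1.congr ?_
  filter_upwards [(chartAt EM q).open_source.mem_nhds hx.1] with x' hx'
  exact loc_chart EM hx' s

/-- The IS condition is open. -/
theorem isOpen_dom_inter_IS {Q : ∀ x, Module.End ℂ (E x)} (hQ : SmoothEnd EM r Q) (p : M) :
    IsOpen (dom EM E r p ∩ {x | IS (Q x)}) := by
  -- The matrix of `Q` in the frame at `p`. It represents `Q` only on the trivializing domain, hence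
  -- the intersection with `dom`.
  let N : M → Matrix (Fin r) (Fin r) ℂ := fun x =>
    Matrix.of fun j k => coord r p (fun x => Q x (stdFrame r p k x)) x j
  have hN : ContinuousOn N (dom EM E r p) := fun x hx => by
    refine ContinuousAt.continuousWithinAt
      (continuousAt_pi.2 fun j => continuousAt_pi.2 fun k => ?_)
    exact (continuous_apply j).continuousAt.comp
      (continuousAt_coord hx (hQ x _ (smoothAt_stdFrame hx k)))
  have hconj : ∀ x (hx : x ∈ dom EM E r p) (k : Fin r → ℂ),
      vecEquiv (E := E) hx.2 (Matrix.toLin' (N x) k) = Q x (vecEquiv hx.2 k) := by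
    intro x hx k
    change vec r p x (Matrix.toLin' (N x) k) = Q x (vec r p x k)
    have h1 : Matrix.toLin' (N x) k =
        ∑ i, k i • coord r p (fun x => Q x (stdFrame r p i x)) x := by
      ext j
      simp [N, Matrix.mulVec, dotProduct, mul_comm]
    rw [h1, map_sum, vec_eq_sum hx.2, map_sum]
    refine Finset.sum_congr rfl fun i _ => ?_
    rw [map_smul, vec_coord hx.2, map_smul]
  have hW : dom EM E r p ∩ {x | IS (Q x)} =
      dom EM E r p ∩ N ⁻¹' {N | IS (Matrix.toLin' N)} := by
    ext x
    refine and_congr_right fun hx => ⟨fun h => ?_, fun h => ?_⟩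
    · refine IS.conj (vecEquiv hx.2).symm (fun v => ?_) h
      rw [LinearEquiv.symm_apply_eq, hconj x hx, LinearEquiv.apply_symm_apply]
    · exact IS.conj (vecEquiv hx.2) (hconj x hx) h
  rw [hW]
  exact hN.isOpen_inter_preimage (isOpen_dom EM E p) (isOpen_setOf_IS (Fin r))

variable {h : HermitianMetric EM r E}
  {Φ : ∀ x, TangentSpace 𝓘(ℂ, EM) x →ₗ[ℂ] Module.End ℂ (E x)}
  {U Q : ∀ x, Module.End ℂ (E x)}

/-- Where `Q` satisfies the IS condition, the Higgs field is determined by `D'(U)`. -/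
theorem IsIntegrableHarmonicHiggs.eq_higgs (hE : IsIntegrableHarmonicHiggs h Φ U Q) {q : M}
    (hq : IS (Q q)) {v : TangentSpace 𝓘(ℂ, EM) q} {X : Module.End ℂ (E q)}
    (hX : ∀ s : ∀ x, E x, SmoothAt (Fin r → ℂ) EM s q →
      h.chernDEnd U s q v - (X * Q q - Q q * X) (s q) + X (s q) = 0) : X = Φ q v := by
  have : FiniteDimensional ℂ (E q) := finiteDimensional_fibre r E q
  rw [← sub_eq_zero]
  refine hq.eq_zero ?_
  ext a
  obtain ⟨s, hs, rfl⟩ := exists_smoothAt_eq (EM := EM) (r := r) q a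
  -- Subtracting the two equations cancels `D'(U)` and leaves the homogeneous equation for `X -
  -- Φ_v`, tested on the arbitrary vector `s q`.
  have h1 := congrArg₂ (fun a b => a - b) (hX s hs) (hE.chern_U q s hs v)
  simp only [sub_zero] at h1
  rw [LinearMap.zero_apply, ← h1]
  simp only [LinearMap.add_apply, LinearMap.neg_apply, LinearMap.sub_apply, Module.End.mul_apply,
    map_sub]
  abel

/-- Where `Q` satisfies the IS condition and `D'(U) = 0`, the Higgs field vanishes. -/
theorem IsIntegrableHarmonicHiggs.higgs_eq_zero (hE : IsIntegrableHarmonicHiggs h Φ U Q)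
    {V : Set M} (hV : h.ChernDEndZeroOn U V) {q : M} (hqV : q ∈ V) (hq : IS (Q q)) :
    Φ q = 0 := by
  ext1 v
  refine (hE.eq_higgs hq fun s hs => ?_).symm
  rw [hV q hqV s hs]
  simp

end ISCondition

end HiggsBundle

end

/-! ### The main theorem -/

theorem theorem1
    {EM : Type*} [NormedAddCommGroup EM] [NormedSpace ℂ EM] [FiniteDimensional ℂ EM]
    {M : Type*} [TopologicalSpace M] [ChartedSpace EM M] [IsManifold 𝓘(ℂ, EM) ω M]
    {r : ℕ} {E : M → Type*} [∀ x, AddCommGroup (E x)] [∀ x, Module ℂ (E x)]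
    [TopologicalSpace (TotalSpace (Fin r → ℂ) E)] [∀ x, TopologicalSpace (E x)]
    [FiberBundle (Fin r → ℂ) E] [VectorBundle ℂ (Fin r → ℂ) E]
    [ContMDiffVectorBundle ω (Fin r → ℂ) E 𝓘(ℂ, EM)]
    (h : HiggsBundle.HermitianMetric EM r E)
    (Φ : ∀ x, TangentSpace 𝓘(ℂ, EM) x →ₗ[ℂ] Module.End ℂ (E x))
    (U Q : ∀ x, Module.End ℂ (E x))
    (hE : HiggsBundle.IsIntegrableHarmonicHiggs h Φ U Q)
    (p : M) (hp : HiggsBundle.IS (Q p)) :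
    (∃ W : Set M, IsOpen W ∧ p ∈ W ∧
      -- the IS condition holds on `W`
      (∀ q ∈ W, HiggsBundle.IS (Q q)) ∧
      -- on `W` the field `Φ` is the unique solution of `D'(U) - [X, Q] + X = 0`
      (∀ q ∈ W, ∀ (v : TangentSpace 𝓘(ℂ, EM) q) (X : Module.End ℂ (E q)),
        (∀ s : ∀ x, E x, HiggsBundle.SmoothAt (Fin r → ℂ) EM s q →
          h.chernDEnd U s q v - (X * Q q - Q q * X) (s q) + X (s q) = 0) ↔ X = Φ q v) ∧
      -- hence it is determined by `D'(U)` among all structures with the same `E`, `h`, `Q`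
      (∀ (Φ' : ∀ x, TangentSpace 𝓘(ℂ, EM) x →ₗ[ℂ] Module.End ℂ (E x))
        (U' : ∀ x, Module.End ℂ (E x)), HiggsBundle.IsIntegrableHarmonicHiggs h Φ' U' Q →
        ∀ q ∈ W, (∀ s : ∀ x, E x, HiggsBundle.SmoothAt (Fin r → ℂ) EM s q →
          ∀ v, h.chernDEnd U' s q v = h.chernDEnd U s q v) → Φ' q = Φ q) ∧
      -- the case `D'(U) = 0`
      (∀ V : Set M, IsOpen V → V ⊆ W → h.ChernDEndZeroOn U V →
        (∀ q ∈ V, Φ q = 0) ∧ h.ChernDHolomorphicOn V ∧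
        ∀ q₀ ∈ V, ∃ V' : Set M, IsOpen V' ∧ q₀ ∈ V' ∧ V' ⊆ V ∧
          ∃ (e : Fin r → ∀ x, E x) (Λ : Fin r → ℝ),
            HiggsBundle.IsFlatHolomorphicFrameOn h e V' ∧
            (∀ q ∈ V', ∀ i, Q q (e i q) = (Λ i : ℂ) • e i q) ∧
            -- the case `U = 0`, for the section `∑ i, f i • e i` of the pull-back bundle
            ((∀ q ∈ V', U q = 0) → ∀ (w : ℂ) (f : Fin r → ℂ → M → ℂ) (z : ℂ), z ≠ 0 →
              ∀ q ∈ V',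
              (∀ i, ContMDiffAt (𝓘(ℝ, ℂ).prod 𝓘(ℝ, EM)) 𝓘(ℝ, ℂ) ∞
                (fun y : ℂ × M => f i y.1 y.2) (z, q)) →
              ∀ (ζ : ℂ) (v : TangentSpace 𝓘(ℂ, EM) q),
                HiggsBundle.structureConn h Φ U Q w (fun z' x => ∑ i, f i z' x • e i x) z q ζ v
                  = HiggsBundle.pullD h (fun z' x => ∑ i, f i z' x • e i x) z q ζ v
                    + ∑ i, ((-(Λ i : ℂ) + w / 2) * f i z q * (ζ / z)) • e i q ∧
                HiggsBundle.structureConn h Φ U Q w (fun z' x => ∑ i, f i z' x • e i x) z q ζ v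
                  = ∑ i, (HiggsBundle.delProd (f i) z q ζ v
                    + (-(Λ i : ℂ) + w / 2) * f i z q * (ζ / z)) • e i q ∧
                HiggsBundle.structureDbar h Φ (fun z' x => ∑ i, f i z' x • e i x) z q ζ v
                  = ∑ i, HiggsBundle.delBarProd (f i) z q ζ v • e i q))) ∧
    -- if the IS condition holds on all of `M` and `D'(U) = 0`, then `U` is a potential
    ((∀ q, HiggsBundle.IS (Q q)) → h.ChernDEndZeroOn U Set.univ →
      HiggsBundle.IsPotential h Φ U) := by
  -- The witness for `W` is the IS locus inside the trivializing chart domain at `p`.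
  refine ⟨⟨_, HiggsBundle.isOpen_dom_inter_IS (EM := EM) hE.smooth_Q p,
    ⟨HiggsBundle.mem_dom EM E p, hp⟩, fun q hq => hq.2, fun q hq v X => ⟨hE.eq_higgs hq.2, ?_⟩,
    fun Φ' U' hE' q hq hU => ?_, fun V hV hVW hUV => ?_⟩, fun hIS hU => ⟨hE.smooth_U, ?_⟩⟩
  · rintro rfl s hs
    exact hE.chern_U q s hs v
  · ext1 v
    -- Since the two derivatives agree at `q`, `Φ'_v` solves the equation that characterizes `Φ_v`.
    refine hE.eq_higgs hq.2 fun s hs => ?_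
    rw [← hU s hs]
    exact hE'.chern_U q s hs v
  · have hΦ : ∀ q ∈ V, Φ q = 0 := fun q hq => hE.higgs_eq_zero hUV hq (hVW hq).2
    refine ⟨hΦ, h.chernDHolomorphicOn_of_higgs_eq_zero hE.toIsHarmonicHiggs hV hΦ, fun q₀ hq₀ => ?_⟩
    obtain ⟨V', hV'o, hq₀', hV', e, Λ, he, hΛ, hes⟩ :=
      HiggsBundle.exists_flat_eigenframe hE hV hΦ hq₀
    refine ⟨V', hV'o, hq₀', hV', e, Λ, he, hΛ, fun hU w f z _ q hq hf ζ v => ?_⟩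
    have hS := HiggsBundle.structureConn_eq (h := h) (hΦ q (hV' hq)) (hU q hq) (hΛ q hq) w f z ζ v
    refine ⟨hS, ?_, ?_⟩
    · rw [hS, HiggsBundle.pullD_sum_smul hf (hes q hq) h v (fun i => he.flat i q hq v) ζ,
        ← Finset.sum_add_distrib]
      simp_rw [add_smul]
    · rw [HiggsBundle.structureDbar_eq (hΦ q (hV' hq))]
      exact HiggsBundle.pullDbar_sum_smul hf (hes q hq) v
        (fun i => (he.holomorphic i).dbar_eq_zero hq v) ζ
  · intro q s hs v
    -- The potential equation holds because both of its sides are zero.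
    rw [hE.higgs_eq_zero hU (Set.mem_univ q) (hIS q), hU q (Set.mem_univ q) s hs]
    rfl
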